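/- Consider Bianchi type I space-times $ds^2=-dt^2+g_{ij}(t)\,dx^i dx^j$ ($g$ positive definite) solving Einstein's equations $R_{\mu\nu}-\tfrac12 R g_{\mu\nu}=T^{\rm pf}_{\mu\nu}+T^{\rm jf}_{\mu\nu}$ ($8\pi G=c=1$, no cosmological constant), where $T^{\rm pf}$ is the energy-momentum tensor of a perfect fluid comoving with $\partial_t$, with density $\rho(t)$ and pressure $p=(\gamma-1)\rho$, separately conserved, and $T^{\rm jf}_{\mu\nu}=\mathcal J_\mu\mathcal J_\nu-\tfrac12 g_{\mu\nu}\mathcal J_\alpha\mathcal J^\alpha$ for a homogeneous, purely spatial 1-form $\mathcal J(t)$ with $\nabla_{[\mu}\mathcal J_{\nu]}=0$ and $\nabla_\mu\mathcal J^\mu=0$. Let $\theta_{ij}=\tfrac12\dot g_{ij}$, $H=\tfrac13 g^{ij}\theta_{ij}$, and define $q$ by $\dot H=-(1+q)H^2$. In a spatial orthonormal frame $(e_1,e_2,e_3)$ with $e_1$ pointing along $\mathcal J\neq0$ put $\Sigma_{ab}=\theta_{ab}/H-\delta_{ab}$, $V_a=\mathcal J_a/(\sqrt6 H)$, $\Omega_{\rm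 pf}=\rho/(3H^2)$. The state space consists of all $(\Sigma,V,\Omega_{\rm pf})$ with $\Sigma$ symmetric and trace-free, $V_1>0=V_2=V_3$, $\Omega_{\rm pf}>0$ and $\tfrac16\Sigma_{ab}\Sigma^{ab}+V_aV^a+\Omega_{\rm pf}=1$. (1) For $\gamma>0$, there is a solution for $t>0$ with $\rho>0$, $\mathcal J\neq0$ and metric $$ds^2=-dt^2+t^2dx^2+t^{\frac{2-\gamma}{\gamma}}(dy^2+dz^2)$$ ("Wonderland") if and only if $\gamma\in(2/3,2)$. (2) For $\gamma\in(2/3,2)$ Wonderland is locally rotationally symmetric about the $x$-axis, $\mathcal J$ is aligned with that axis, it is self-similar (it has a proper homothetic vector field nowhere tangent to the surfaces $t=$ const), $H>0$, $q=\tfrac32\gamma-1$, and its state is constant, equal to the point $W_\gamma$ of the state space given by $\Sigma=\mathrm{diag}(-2\Sigma_+,\Sigma_+,\Sigma_+)$ with $\Sigma_+=-\tfrac{3\gamma-2}{4}$ (so $\Sigma_{11}>\Sigma_{22}=\Sigma_{33}$: prolate), $V_1=\tfrac14\sqrt{3(2-\gamma)(3\gamma-2)}$, $\Omega_{\rm pf}=\tfrac34(2-\gamma)$.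 (3) $W_\gamma$ tends to the flat FLRW state ($\Sigma=0,V=0,\Omega_{\rm pf}=1$) as $\gamma\to2/3^+$ and to the Kasner state ($\Sigma=\mathrm{diag}(2,-1,-1)$, i.e. $\Sigma_+=-1$, $V=0$, $\Omega_{\rm pf}=0$) as $\gamma\to2^-$. (4) For $\gamma\in(2/3,6/5]$, $W_\gamma$ is the global attractor of the state space: for every point of the state space, every $H_0>0$ and every $t_0$ there is a solution, defined for all $t\ge t_0$, with that state and $H=H_0$ at $t_0$; along every solution on an interval $(a,\infty)$ which at some time has $H>0$, $\rho>0$, $\mathcal J\ne0$, one has $H>0$ throughout, the state stays in the state space and converges to $W_\gamma$ as $t\to\infty$; and $W_\gamma$ is Lyapunov stable. -/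

import Mathlib

open Set Filter Topology
open scoped Matrix ContDiff

namespace BianchiI

noncomputable section

/-! ### Coordinate differential geometry on `ℝ⁴`, coordinates `x 0 = t`, `x 1, x 2, x 3` -/

/-- Points of the coordinate space `ℝ⁴`. -/
abbrev Point := Fin 4 → ℝ

/-- A field of symmetric (by use) covariant 2-tensors, given by its component matrix. -/
abbrev TensorField := Point → Matrix (Fin 4) (Fin 4) ℝ

/-- The partial derivative `∂_μ f` at `x`. -/
def pd (μ : Fin 4) (f : Point → ℝ) (x : Point) : ℝ :=
  lineDeriv ℝ f x (Pi.single μ 1)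

/-- The Christoffel symbol `Γ^α_{μν}` of the metric `G`. -/
def christoffel (G : TensorField) (α μ ν : Fin 4) (x : Point) : ℝ :=
  (1 / 2) * ∑ σ, (G x)⁻¹ α σ *
    (pd μ (fun y => G y σ ν) x + pd ν (fun y => G y σ μ) x - pd σ (fun y => G y μ ν) x)

/-- The Ricci tensor
`R_{μν} = ∂_α Γ^α_{μν} - ∂_ν Γ^α_{μα} + Γ^α_{αβ} Γ^β_{μν} - Γ^α_{νβ} Γ^β_{μα}`. -/
def ricci (G : TensorField) (x : Point) : Matrix (Fin 4) (Fin 4) ℝ :=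
  Matrix.of fun μ ν =>
    ∑ α, (pd α (christoffel G α μ ν) x - pd ν (christoffel G α μ α) x
      + ∑ β, (christoffel G α α β x * christoffel G β μ ν x
        - christoffel G α ν β x * christoffel G β μ α x))

/-- The scalar curvature `R = g^{μν} R_{μν}`. -/
def scalarCurvature (G : TensorField) (x : Point) : ℝ :=
  ∑ μ, ∑ ν, (G x)⁻¹ μ ν * ricci G x μ ν

/-- The Einstein tensor `R_{μν} - (1/2) R g_{μν}`. -/
def einstein (G : TensorField) (x : Point) : Matrix (Fin 4) (Fin 4) ℝ :=
  ricci G x - ((1 / 2) * scalarCurvature G x) • G x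

/-- The covariant derivative `∇_α T_{μν}`. -/
def covDeriv₂ (G T : TensorField) (α μ ν : Fin 4) (x : Point) : ℝ :=
  pd α (fun y => T y μ ν) x
    - ∑ β, (christoffel G β α μ x * T x β ν + christoffel G β α ν x * T x μ β)

/-- The divergence `∇^μ T_{μν}`. -/
def divergence (G T : TensorField) (ν : Fin 4) (x : Point) : ℝ :=
  ∑ α, ∑ μ, (G x)⁻¹ α μ * covDeriv₂ G T α μ ν x

/-- The covariant derivative `∇_μ A_ν` of a covector field. -/
def covDeriv₁ (G : TensorField) (A : Point → Fin 4 → ℝ) (μ ν : Fin 4) (x : Point) : ℝ :=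
  pd μ (fun y => A y ν) x - ∑ β, christoffel G β μ ν x * A x β

/-- The Lie derivative `(L_X g)_{μν} = X^α ∂_α g_{μν} + g_{αν} ∂_μ X^α + g_{μα} ∂_ν X^α`. -/
def lieDeriv (X : Point → Fin 4 → ℝ) (G : TensorField) (x : Point) :
    Matrix (Fin 4) (Fin 4) ℝ :=
  Matrix.of fun μ ν =>
    ∑ α, (X x α * pd α (fun y => G y μ ν) x
      + G x α ν * pd μ (fun y => X y α) x + G x μ α * pd ν (fun y => X y α) x)

/-! ### Bianchi type I models with a perfect fluid and a `j`-form -/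

/-- The fields of a Bianchi type I model: the spatial metric `g_ij(t)` in
`ds² = -dt² + g_ij(t) dx^i dx^j`, the energy density `ρ(t)` of the perfect fluid, and the
components `(J_0, J_1, J_2, J_3)(t)` of the homogeneous field strength in the coordinate basis.
The equations they obey are in `IsSolution`. -/
structure Model where
  g : ℝ → Matrix (Fin 3) (Fin 3) ℝ
  ρ : ℝ → ℝ
  J : ℝ → Fin 4 → ℝ

/-- The space-time metric `-dt² + g_ij(t) dx^i dx^j`. -/
def Model.metric (M : Model) : TensorField := fun x =>
  Matrix.of fun μ ν =>
    Fin.cases (Fin.cases (-1) (fun _ => 0) ν)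
      (fun i => Fin.cases 0 (fun j => M.g (x 0) i j) ν) μ

/-- The field strength as a covector field on space-time. -/
def Model.field (M : Model) : Point → Fin 4 → ℝ := fun x => M.J (x 0)

/-- Energy-momentum tensor `(ρ + p) u_μ u_ν + p g_{μν}` of the `γ`-law fluid, `p = (γ - 1) ρ`,
with 4-velocity `u = ∂/∂t`, so `u_μ = g_{μ0}`. -/
def Model.fluidTensor (γ : ℝ) (M : Model) : TensorField := fun x =>
  Matrix.of fun μ ν =>
    (M.ρ (x 0) + (γ - 1) * M.ρ (x 0)) * (M.metric x μ 0 * M.metric x ν 0)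
      + (γ - 1) * M.ρ (x 0) * M.metric x μ ν

/-- Energy-momentum tensor `J_μ J_ν - (1/2) g_{μν} J_α J^α` of the `j`-form. -/
def Model.formTensor (M : Model) : TensorField := fun x =>
  Matrix.of fun μ ν =>
    M.field x μ * M.field x ν
      - (1 / 2) * M.metric x μ ν *
        ∑ α, ∑ β, (M.metric x)⁻¹ α β * M.field x α * M.field x β

/-- `M` is, during the open time interval `I`, a Bianchi type I solution of the Einstein equations
(`8πG = c = 1`) with a `γ`-law perfect fluid and a purely spatial, source-free `j`-form, the two
fluids not interacting. -/
structure IsSolution (γ : ℝ) (M : Model) (I : Set ℝ) : Prop where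
  posDef : ∀ t ∈ I, (M.g t).PosDef
  contDiff_g : ∀ i j, ContDiffOn ℝ 2 (fun t => M.g t i j) I
  contDiff_ρ : ContDiffOn ℝ 1 M.ρ I
  contDiff_J : ∀ μ, ContDiffOn ℝ 1 (fun t => M.J t μ) I
  spatial : ∀ t ∈ I, M.J t 0 = 0
  einstein_eq : ∀ x : Point, x 0 ∈ I →
    einstein M.metric x = M.fluidTensor γ x + M.formTensor x
  fluid_eq : ∀ x : Point, x 0 ∈ I → ∀ ν, divergence M.metric (M.fluidTensor γ) ν x = 0
  closed : ∀ x : Point, x 0 ∈ I → ∀ μ ν,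
    covDeriv₁ M.metric M.field μ ν x - covDeriv₁ M.metric M.field ν μ x = 0
  coclosed : ∀ x : Point, x 0 ∈ I →
    ∑ μ, ∑ ν, (M.metric x)⁻¹ μ ν * covDeriv₁ M.metric M.field μ ν x = 0

/-! ### Kinematics and expansion-normalized variables -/

/-- The expansion tensor `θ_ij = ∇_i u_j = (1/2) dg_ij/dt` of the normal congruence. -/
def Model.expansion (M : Model) (t : ℝ) : Matrix (Fin 3) (Fin 3) ℝ :=
  Matrix.of fun i j => (1 / 2) * deriv (fun s => M.g s i j) t

/-- The Hubble parameter `H = (1/3) g^{ij} θ_ij`. -/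
def Model.hubble (M : Model) (t : ℝ) : ℝ :=
  (1 / 3) * ((M.g t)⁻¹ * M.expansion t).trace

/-- The deceleration parameter `q`, defined by `dH/dt = -(1 + q) H²` (used where `H ≠ 0`). -/
def Model.deceleration (M : Model) (t : ℝ) : ℝ :=
  -1 - deriv M.hubble t / M.hubble t ^ 2

/-- The components of the spatial part of the field strength in the frame whose vectors are the
columns of `E`. -/
def Model.frameField (M : Model) (t : ℝ) (E : Matrix (Fin 3) (Fin 3) ℝ) : Fin 3 → ℝ :=
  (fun i : Fin 3 => M.J t i.succ) ᵥ* E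

/-- The columns of `E` form a spatial orthonormal frame at time `t` whose first vector points along
the (nonzero) spatial field strength. -/
structure IsAlignedFrame (M : Model) (t : ℝ) (E : Matrix (Fin 3) (Fin 3) ℝ) : Prop where
  orthonormal : Eᵀ * M.g t * E = 1
  pos : 0 < M.frameField t E 0
  zero₁ : M.frameField t E 1 = 0
  zero₂ : M.frameField t E 2 = 0

/-- Expansion-normalized variables: shear `Σ_ab`, field strength `V_a`, fluid density `Ω_pf`. -/
abbrev State := Matrix (Fin 3) (Fin 3) ℝ × (Fin 3 → ℝ) × ℝ

/-- `Σ_ab = σ_ab / H = θ_ab / H - δ_ab`, `V_a = v_a / (√6 H)`, `Ω_pf = ρ / (3 H²)`, with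
components in the frame `E`. -/
def Model.state (M : Model) (t : ℝ) (E : Matrix (Fin 3) (Fin 3) ℝ) : State :=
  ((M.hubble t)⁻¹ • (Eᵀ * M.expansion t * E) - 1,
    (Real.sqrt 6 * M.hubble t)⁻¹ • M.frameField t E,
    M.ρ t / (3 * M.hubble t ^ 2))

/-- The type I state space, with both the fluid and the (purely spatial) `j`-form present, in frames
aligned with the field strength; the last condition is the Hamiltonian constraint
`Σ² + V² + Ω_pf = 1`, with `Σ² = Σ_ab Σ^ab / 6`. -/
def stateSpace : Set State :=
  {S | S.1ᵀ = S.1 ∧ S.1.trace = 0 ∧ 0 < S.2.1 0 ∧ S.2.1 1 = 0 ∧ S.2.1 2 = 0 ∧ 0 < S.2.2 ∧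
    (1 / 6) * (S.1 * S.1).trace + ∑ a, S.2.1 a ^ 2 + S.2.2 = 1}

/-- `S` is the global attractor of the type I state space: every point of the state space evolves
for all future times, every orbit stays in the state space and converges to `S`, and `S` is
(Lyapunov) stable. -/
structure IsGlobalAttractor (γ : ℝ) (S : State) : Prop where
  evolves : ∀ S₀ ∈ stateSpace, ∀ H₀ > 0, ∀ t₀ : ℝ, ∃ a < t₀, ∃ (M : Model) (E : _),
    IsSolution γ M (Ioi a) ∧ IsAlignedFrame M t₀ E ∧ M.hubble t₀ = H₀ ∧ M.state t₀ E = S₀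
  invariant : ∀ (a : ℝ) (M : Model), IsSolution γ M (Ioi a) → ∀ t₀ > a,
    0 < M.hubble t₀ → 0 < M.ρ t₀ → M.J t₀ ≠ 0 →
    ∀ t > a, 0 < M.hubble t ∧ ∀ E, IsAlignedFrame M t E → M.state t E ∈ stateSpace
  attracts : ∀ (a : ℝ) (M : Model), IsSolution γ M (Ioi a) → ∀ t₀ > a,
    0 < M.hubble t₀ → 0 < M.ρ t₀ → M.J t₀ ≠ 0 →
    ∀ E : ℝ → Matrix (Fin 3) (Fin 3) ℝ, (∀ t > a, IsAlignedFrame M t (E t)) →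
      Tendsto (fun t => M.state t (E t)) atTop (𝓝 S)
  stable : ∀ U ∈ 𝓝 S, ∃ U₀ ∈ 𝓝 S, ∀ (a : ℝ) (M : Model), IsSolution γ M (Ioi a) → ∀ t₀ > a,
    0 < M.hubble t₀ → 0 < M.ρ t₀ →
    ∀ E₀, IsAlignedFrame M t₀ E₀ → M.state t₀ E₀ ∈ U₀ →
      ∀ t ≥ t₀, ∀ E, IsAlignedFrame M t E → M.state t E ∈ U

/-! ### Symmetries -/

/-- The rotation by `φ` about the `x`-axis, as a linear map of `ℝ⁴`. -/
def rotX (φ : ℝ) : Matrix (Fin 4) (Fin 4) ℝ :=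
  !![1, 0, 0, 0;
     0, 1, 0, 0;
     0, 0, Real.cos φ, -Real.sin φ;
     0, 0, Real.sin φ, Real.cos φ]

/-- Local rotational symmetry with axis along `x`: the rotations about the `x`-axis are isometries
and preserve the field strength (the density depends on `t` only). Together with the spatial
translations this gives a rotation group about every point. -/
def IsLRSAboutX (M : Model) (I : Set ℝ) : Prop :=
  ∀ (φ : ℝ) (x : Point), x 0 ∈ I →
    (rotX φ)ᵀ * M.metric (rotX φ *ᵥ x) * rotX φ = M.metric x ∧
    M.field (rotX φ *ᵥ x) ᵥ* rotX φ = M.field x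

/-- Self-similarity: there is a proper homothetic vector field, `L_X g = 2 c g` with a constant
`c ≠ 0`, nowhere tangent to the surfaces of homogeneity. -/
def IsSelfSimilar (M : Model) (I : Set ℝ) : Prop :=
  ∃ X : Point → Fin 4 → ℝ, ContDiffOn ℝ ∞ X {x | x 0 ∈ I} ∧ ∃ c : ℝ, c ≠ 0 ∧
    ∀ x : Point, x 0 ∈ I → X x 0 ≠ 0 ∧ lieDeriv X M.metric x = (2 * c) • M.metric x

/-! ### Wonderland -/

/-- The spatial part of `-dt² + t² dx² + t^{(2-γ)/γ} (dy² + dz²)`. -/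
def wonderlandMetric (γ t : ℝ) : Matrix (Fin 3) (Fin 3) ℝ :=
  Matrix.diagonal ![t ^ 2, t ^ ((2 - γ) / γ), t ^ ((2 - γ) / γ)]

/-- `M` is Wonderland: a solution for `t > 0` with the Wonderland line element that contains both
the perfect fluid and a `j`-form. -/
structure IsWonderland (γ : ℝ) (M : Model) : Prop where
  metric_eq : M.g = wonderlandMetric γ
  solution : IsSolution γ M (Ioi 0)
  fluid_pos : ∀ t > 0, 0 < M.ρ t
  field_ne : ∀ t > 0, M.J t ≠ 0

/-- The expansion-normalized state with `Σ_ab = diag(-2Σ₊, Σ₊, Σ₊)`, `Σ₊ = -(3γ-2)/4`,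
`V_1 = √(3(2-γ)(3γ-2))/4`, `Ω_pf = 3(2-γ)/4`. -/
def wonderlandState (γ : ℝ) : State :=
  (Matrix.diagonal ![(3 * γ - 2) / 2, -(3 * γ - 2) / 4, -(3 * γ - 2) / 4],
    ![Real.sqrt (3 * (2 - γ) * (3 * γ - 2)) / 4, 0, 0],
    3 * (2 - γ) / 4)

/-- The flat FLRW state: no shear, no `j`-form, `Ω_pf = 1`. -/
def flrwState : State := (0, 0, 1)

/-- The LRS Kasner state with `Σ₊ = -1`: no matter, `Σ_ab = diag(2, -1, -1)`. -/
def kasnerState : State := (Matrix.diagonal ![2, -1, -1], 0, 0)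

end

end BianchiI

/-!
For a spatially homogeneous metric with vanishing shift the field equations reduce to ordinary
differential equations for the expansion tensor, the density and the field, together with the
Hamiltonian constraint, which these equations propagate. Conservation makes the components of the
field in the coordinate coframe constant.

*Attraction.* The moments `n·(1 + Σ)^k n`, with `n` the unit vector in the direction of the field,
do not depend on the choice of an aligned frame. By Cayley-Hamilton the fourth one is a function
of the lower ones and the constraint, so that `Σ_11`, `Σ_12² + Σ_13²`, a cubic invariant, `V²` and
`Ω_pf` form a closed dynamical system. With `σ = (3γ - 2) / 2`, the function `σ log V² + 2 log
Ω_pf - (4 + 2σ) log (1 - σ Σ_11 / 4)` is maximal at Wonderland, and its rate of growth is a sum of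
terms which are nonnegative as long as `σ ≤ 4 / 5`, that is, `γ ≤ 6 / 5`. Being bounded above, it
converges, so its rate in the time with derivative `H` tends to zero by Barbalat's lemma. Further
applications of this lemma to the reduced equations give the limits of those variables which the
rate does not control. Stability follows because the gap to the maximum bounds the distance to
Wonderland.

*Existence.* In an orthonormal frame propagated along the fluid the equations form an autonomous
polynomial system. The constraint bounds all variables by the expansion, which decreases, so
solutions exist for all later times, and the metric is recovered from the propagated coframe.

*Wonderland.* For a power-law metric the field equations become algebraic equations for the
exponents. They determine the density and the square of the field, which is positive exactly if `2
/ 3 < γ < 2`. A dilation with weights adapted to the exponents is homothetic.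
-/

namespace BianchiI

noncomputable section

/-! ### Curvature of the metric `-dt² + g_ij(t) dx^i dx^j` -/

/-- The block matrix with a scalar time-time entry and a spatial block; the space-time metric is
`block (-1) g`. -/
def block (a : ℝ) (A : Matrix (Fin 3) (Fin 3) ℝ) : Matrix (Fin 4) (Fin 4) ℝ :=
  Matrix.of fun μ ν =>
    Fin.cases (Fin.cases a (fun _ => 0) ν) (fun i => Fin.cases 0 (fun j => A i j) ν) μ

@[simp] lemma block_zero_zero (a : ℝ) (A : Matrix (Fin 3) (Fin 3) ℝ) : block a A 0 0 = a := rfl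

@[simp] lemma block_zero_succ (a : ℝ) (A : Matrix (Fin 3) (Fin 3) ℝ) (j : Fin 3) :
    block a A 0 j.succ = 0 := rfl

@[simp] lemma block_succ_zero (a : ℝ) (A : Matrix (Fin 3) (Fin 3) ℝ) (i : Fin 3) :
    block a A i.succ 0 = 0 := rfl

@[simp] lemma block_succ_succ (a : ℝ) (A : Matrix (Fin 3) (Fin 3) ℝ) (i j : Fin 3) :
    block a A i.succ j.succ = A i j := rfl

-- `Fin.sum_univ_succ` itself would also break up the spatial sums.
lemma sum_fin_four {R : Type*} [AddCommMonoid R] (f : Fin 4 → R) :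
    ∑ μ, f μ = f 0 + ∑ i : Fin 3, f i.succ :=
  Fin.sum_univ_succ f

lemma matrix_ext_zero_succ {R : Type*} {m n : ℕ} {A B : Matrix (Fin (m + 1)) (Fin (n + 1)) R}
    (zero_zero : A 0 0 = B 0 0) (zero_succ : ∀ j : Fin n, A 0 j.succ = B 0 j.succ)
    (succ_zero : ∀ i : Fin m, A i.succ 0 = B i.succ 0)
    (succ_succ : ∀ (i : Fin m) (j : Fin n), A i.succ j.succ = B i.succ j.succ) : A = B := by
  ext μ ν
  refine Fin.cases ?_ (fun i => ?_) μ <;> refine Fin.cases ?_ (fun j => ?_) ν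
  exacts [zero_zero, zero_succ j, succ_zero i, succ_succ i j]

lemma block_inj {a b : ℝ} {A B : Matrix (Fin 3) (Fin 3) ℝ} :
    block a A = block b B ↔ a = b ∧ A = B := by
  refine ⟨fun h => ⟨congrFun₂ h 0 0, ?_⟩, fun h => h.1 ▸ h.2 ▸ rfl⟩
  ext i j
  exact congrFun₂ h i.succ j.succ

lemma block_mul_block (a b : ℝ) (A B : Matrix (Fin 3) (Fin 3) ℝ) :
    block a A * block b B = block (a * b) (A * B) := by
  apply matrix_ext_zero_succ <;> intros <;> simp [Matrix.mul_apply, sum_fin_four]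

lemma block_one_one : block 1 1 = 1 := by
  apply matrix_ext_zero_succ <;> intros <;>
    simp [Matrix.one_apply, Fin.succ_ne_zero, (Fin.succ_ne_zero _).symm]

lemma metric_eq_block (M : Model) (x : Point) : M.metric x = block (-1) (M.g (x 0)) := rfl

lemma metric_inv (M : Model) {x : Point} (h : IsUnit (M.g (x 0)).det) :
    (M.metric x)⁻¹ = block (-1) (M.g (x 0))⁻¹ := by
  apply Matrix.inv_eq_right_inv
  rw [metric_eq_block, block_mul_block, Matrix.mul_nonsing_inv _ h, neg_one_mul, neg_neg,
    block_one_one]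

lemma pd_zero_of_eqOn {I : Set ℝ} (hI : IsOpen I) {f : Point → ℝ} {F : ℝ → ℝ}
    (h : ∀ y : Point, y 0 ∈ I → f y = F (y 0)) {x : Point} (hx : x 0 ∈ I) :
    pd 0 f x = deriv F (x 0) := by
  have hnhds : ∀ᶠ t : ℝ in 𝓝 0, x 0 + t ∈ I := by
    have : ContinuousAt (fun t : ℝ => x 0 + t) 0 := by fun_prop
    exact this.eventually_mem (by simpa using hI.mem_nhds hx)
  have hline : (fun t : ℝ => f (x + t • Pi.single 0 1)) =ᶠ[𝓝 0] fun t => F (x 0 + t) := by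
    filter_upwards [hnhds] with t ht
    rw [h] <;> simp [ht]
  rw [pd, lineDeriv, hline.deriv_eq, deriv_comp_const_add, add_zero]

lemma pd_succ_of_eqOn {I : Set ℝ} {f : Point → ℝ} {F : ℝ → ℝ}
    (h : ∀ y : Point, y 0 ∈ I → f y = F (y 0)) {x : Point} (hx : x 0 ∈ I) (i : Fin 3) :
    pd i.succ f x = 0 := by
  have hline : (fun t : ℝ => f (x + t • Pi.single i.succ 1)) = fun _ => F (x 0) := by
    funext t
    rw [h] <;> simp [hx, (Fin.succ_ne_zero i).symm]
  rw [pd, lineDeriv, hline, deriv_const]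

@[simp] lemma pd_const (μ : Fin 4) (c : ℝ) (x : Point) : pd μ (fun _ => c) x = 0 := by
  simp [pd, lineDeriv]

lemma pd_zero_comp (F : ℝ → ℝ) (x : Point) : pd 0 (fun y => F (y 0)) x = deriv F (x 0) :=
  pd_zero_of_eqOn isOpen_univ (fun _ _ => rfl) (mem_univ _)

lemma pd_succ_comp (F : ℝ → ℝ) (x : Point) (i : Fin 3) : pd i.succ (fun y => F (y 0)) x = 0 :=
  pd_succ_of_eqOn (I := univ) (fun _ _ => rfl) (mem_univ _) i

/-- The mixed expansion tensor `K^i_j = g^{ik} θ_kj`. -/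
def Model.mixed (M : Model) (t : ℝ) : Matrix (Fin 3) (Fin 3) ℝ := (M.g t)⁻¹ * M.expansion t

lemma pd_zero_metric_succ (M : Model) (x : Point) (i j : Fin 3) :
    pd 0 (fun y => M.metric y i.succ j.succ) x = 2 * M.expansion (x 0) i j := by
  have := pd_zero_comp (fun t => M.g t i j) x
  simp only [metric_eq_block, block_succ_succ, this, Model.expansion, Matrix.of_apply]
  ring

lemma pd_succ_metric (M : Model) (x : Point) (k : Fin 3) (μ ν : Fin 4) :
    pd k.succ (fun y => M.metric y μ ν) x = 0 :=
  pd_succ_comp (fun t => block (-1) (M.g t) μ ν) x k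

lemma pd_metric_zero_left (M : Model) (x : Point) (μ ν : Fin 4) :
    pd μ (fun y => M.metric y 0 ν) x = 0 := by
  refine Fin.cases ?_ (fun j => ?_) ν <;> simp [metric_eq_block]

lemma pd_metric_zero_right (M : Model) (x : Point) (μ ν : Fin 4) :
    pd μ (fun y => M.metric y ν 0) x = 0 := by
  refine Fin.cases ?_ (fun j => ?_) ν <;> simp [metric_eq_block]

lemma christoffel_zero_zero (M : Model) (α : Fin 4) (x : Point) :
    christoffel M.metric α 0 0 x = 0 := by
  simp [christoffel, pd_metric_zero_left, pd_metric_zero_right]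

section Christoffel

variable (M : Model) {x : Point} (h : IsUnit (M.g (x 0)).det)
include h

lemma christoffel_zero_zero_succ (j : Fin 3) : christoffel M.metric 0 0 j.succ x = 0 := by
  simp [christoffel, pd_metric_zero_left, pd_metric_zero_right, metric_inv M h, sum_fin_four]

lemma christoffel_zero_succ_zero (j : Fin 3) : christoffel M.metric 0 j.succ 0 x = 0 := by
  simp [christoffel, pd_metric_zero_left, pd_metric_zero_right, metric_inv M h, sum_fin_four]

lemma christoffel_zero_succ_succ (i j : Fin 3) :
    christoffel M.metric 0 i.succ j.succ x = M.expansion (x 0) i j := by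
  simp [christoffel, pd_succ_metric, pd_zero_metric_succ, metric_inv M h, sum_fin_four]

lemma christoffel_succ_zero_succ (k j : Fin 3) :
    christoffel M.metric k.succ 0 j.succ x = M.mixed (x 0) k j := by
  simp only [christoffel, metric_inv M h, sum_fin_four, pd_metric_zero_left,
    pd_zero_metric_succ, block_succ_zero, block_succ_succ, Model.mixed, Matrix.mul_apply,
    pd_metric_zero_right]
  simp only [mul_zero, zero_add, add_zero, sub_zero, Finset.mul_sum]
  exact Finset.sum_congr rfl fun _ _ => by ring

lemma christoffel_succ_succ_zero (k j : Fin 3) :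
    christoffel M.metric k.succ j.succ 0 x = M.mixed (x 0) k j := by
  rw [← christoffel_succ_zero_succ M h]
  simp only [christoffel, sum_fin_four, pd_metric_zero_left,
    pd_zero_metric_succ, pd_metric_zero_right]
  simp

lemma christoffel_succ_succ_succ (k i j : Fin 3) :
    christoffel M.metric k.succ i.succ j.succ x = 0 := by
  simp [christoffel, metric_inv M h, sum_fin_four, pd_succ_metric]

end Christoffel

section Ricci

variable (M : Model) {I : Set ℝ} (hI : IsOpen I) (h : ∀ t ∈ I, IsUnit (M.g t).det)
  {x : Point} (hx : x 0 ∈ I)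
include hI h hx

lemma pd_zero_christoffel {F : ℝ → ℝ} {α μ ν : Fin 4}
    (hF : ∀ y : Point, IsUnit (M.g (y 0)).det → christoffel M.metric α μ ν y = F (y 0)) :
    pd 0 (christoffel M.metric α μ ν) x = deriv F (x 0) :=
  pd_zero_of_eqOn hI (fun y hy => hF y (h _ hy)) hx

omit hI in
lemma pd_succ_christoffel (i : Fin 3) (α μ ν : Fin 4) :
    pd i.succ (christoffel M.metric α μ ν) x = 0 := by
  have of_time : ∀ F : ℝ → ℝ,
      (∀ y : Point, IsUnit (M.g (y 0)).det → christoffel M.metric α μ ν y = F (y 0)) →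
      pd i.succ (christoffel M.metric α μ ν) x = 0 := fun F hF =>
    pd_succ_of_eqOn (fun y hy => hF y (h _ hy)) hx i
  induction α using Fin.cases <;> induction μ using Fin.cases <;> induction ν using Fin.cases
  · exact of_time (fun _ => 0) fun y _ => christoffel_zero_zero M _ y
  · exact of_time (fun _ => 0) fun y hy => christoffel_zero_zero_succ M hy _
  · exact of_time (fun _ => 0) fun y hy => christoffel_zero_succ_zero M hy _
  · exact of_time (fun t => M.expansion t _ _) fun y hy => christoffel_zero_succ_succ M hy _ _
  · exact of_time (fun _ => 0) fun y _ => christoffel_zero_zero M _ y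
  · exact of_time (fun t => M.mixed t _ _) fun y hy => christoffel_succ_zero_succ M hy _ _
  · exact of_time (fun t => M.mixed t _ _) fun y hy => christoffel_succ_succ_zero M hy _ _
  · exact of_time (fun _ => 0) fun y hy => christoffel_succ_succ_succ M hy _ _ _

lemma ricci_zero_zero :
    ricci M.metric x 0 0 = -(∑ i, deriv (fun t => M.mixed t i i) (x 0))
      - (M.mixed (x 0) * M.mixed (x 0)).trace := by
  have hu := h _ hx
  have hΓ₀ := pd_zero_christoffel M hI h hx (fun y _ => christoffel_zero_zero M 0 y)
    (F := fun _ => 0)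
  have hΓ : ∀ i j : Fin 3, pd 0 (christoffel M.metric i.succ 0 j.succ) x
      = deriv (fun t => M.mixed t i j) (x 0) := fun i j =>
    pd_zero_christoffel M hI h hx (fun y hy => christoffel_succ_zero_succ M hy i j)
  simp only [ricci, Matrix.of_apply, sum_fin_four, pd_succ_christoffel M h hx, hΓ₀, hΓ,
    christoffel_zero_zero M, christoffel_zero_zero_succ M hu,
    christoffel_succ_zero_succ M hu, Matrix.trace, Matrix.diag_apply,
    Matrix.mul_apply]
  simp only [deriv_const, mul_zero, sub_zero, zero_sub, zero_add, add_zero,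
    Finset.sum_const_zero, Finset.sum_add_distrib, Finset.sum_neg_distrib]
  ring

lemma ricci_zero_succ (j : Fin 3) : ricci M.metric x 0 j.succ = 0 := by
  have hu := h _ hx
  have hΓ := pd_zero_christoffel M hI h hx (fun y hy => christoffel_zero_zero_succ M hy j)
    (F := fun _ => 0)
  simp only [ricci, Matrix.of_apply, sum_fin_four, pd_succ_christoffel M h hx, hΓ,
    christoffel_zero_zero M, christoffel_zero_zero_succ M hu, christoffel_zero_succ_zero M hu,
    christoffel_succ_zero_succ M hu, christoffel_succ_succ_succ M hu]
  simp

lemma ricci_succ_zero (i : Fin 3) : ricci M.metric x i.succ 0 = 0 := by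
  have hu := h _ hx
  have hΓ₀ := pd_zero_christoffel M hI h hx (fun y hy => christoffel_zero_succ_zero M hy i)
    (F := fun _ => 0)
  have hΓ : ∀ k l j : Fin 3, pd 0 (christoffel M.metric k.succ l.succ j.succ) x = 0 :=
    fun k l j => (pd_zero_christoffel M hI h hx (F := fun _ => 0)
      (fun y hy => christoffel_succ_succ_succ M hy k l j)).trans (deriv_const _ _)
  simp only [ricci, Matrix.of_apply, sum_fin_four, pd_succ_christoffel M h hx, hΓ₀, hΓ,
    christoffel_zero_zero M, christoffel_zero_zero_succ M hu, christoffel_zero_succ_zero M hu,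
    christoffel_succ_zero_succ M hu, christoffel_succ_succ_succ M hu,
    christoffel_succ_succ_zero M hu]
  simp

lemma ricci_succ_succ (i j : Fin 3) :
    ricci M.metric x i.succ j.succ = deriv (fun t => M.expansion t i j) (x 0)
      + (M.mixed (x 0)).trace * M.expansion (x 0) i j
      - ((M.expansion (x 0) * M.mixed (x 0)) j i + (M.expansion (x 0) * M.mixed (x 0)) i j) := by
  have hu := h _ hx
  have hΓ := pd_zero_christoffel M hI h hx (fun y hy => christoffel_zero_succ_succ M hy i j)
    (F := fun t => M.expansion t i j)
  have hcomm : ∀ k, M.mixed (x 0) k j * M.expansion (x 0) i k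
      = M.expansion (x 0) i k * M.mixed (x 0) k j := fun k => mul_comm _ _
  simp only [ricci, Matrix.of_apply, sum_fin_four, pd_succ_christoffel M h hx, hΓ,
    christoffel_zero_zero M, christoffel_zero_zero_succ M hu, christoffel_zero_succ_zero M hu,
    christoffel_succ_succ_succ M hu, christoffel_succ_succ_zero M hu,
    christoffel_zero_succ_succ M hu, Matrix.trace, Matrix.diag_apply, Matrix.mul_apply]
  simp only [mul_zero, zero_mul, sub_zero, zero_sub, zero_add, add_zero,
    Finset.sum_const_zero, Finset.sum_neg_distrib, Finset.sum_sub_distrib,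
    Finset.sum_mul, hcomm]
  ring

end Ricci

/-! ### Trace reversal -/

section MetricTrace

variable {n : Type*} [Fintype n] [DecidableEq n]

/-- The trace `g^{μν} A_{μν}` of a covariant 2-tensor `A` with respect to the metric `g`. -/
def metricTrace (g A : Matrix n n ℝ) : ℝ := ∑ μ, ∑ ν, g⁻¹ μ ν * A μ ν

lemma metricTrace_eq_trace (g A : Matrix n n ℝ) : metricTrace g A = (g⁻¹ * Aᵀ).trace := rfl

lemma metricTrace_add (g A B : Matrix n n ℝ) :
    metricTrace g (A + B) = metricTrace g A + metricTrace g B := by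
  simp only [metricTrace_eq_trace, Matrix.transpose_add, Matrix.mul_add, Matrix.trace_add]

lemma metricTrace_sub (g A B : Matrix n n ℝ) :
    metricTrace g (A - B) = metricTrace g A - metricTrace g B := by
  simp only [metricTrace_eq_trace, Matrix.transpose_sub, Matrix.mul_sub, Matrix.trace_sub]

lemma metricTrace_smul (g : Matrix n n ℝ) (c : ℝ) (A : Matrix n n ℝ) :
    metricTrace g (c • A) = c * metricTrace g A := by
  simp only [metricTrace_eq_trace, Matrix.transpose_smul, Matrix.mul_smul, Matrix.trace_smul,
    smul_eq_mul]

lemma metricTrace_self {g : Matrix n n ℝ} (hsymm : gᵀ = g) (hdet : IsUnit g.det) :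
    metricTrace g g = Fintype.card n := by
  rw [metricTrace_eq_trace, hsymm, Matrix.nonsing_inv_mul _ hdet, Matrix.trace_one]

lemma sub_half_metricTrace_smul_eq_iff {g R T : Matrix n n ℝ} (hg : metricTrace g g = 4) :
    R - (1 / 2 * metricTrace g R) • g = T ↔ R = T - (1 / 2 * metricTrace g T) • g := by
  constructor
  · rintro rfl
    rw [metricTrace_sub, metricTrace_smul, hg, sub_sub, ← add_smul, eq_comm, sub_eq_self]
    convert zero_smul ℝ g using 2
    ring
  · rintro rfl
    rw [metricTrace_sub, metricTrace_smul, hg, sub_sub, ← add_smul, sub_eq_self]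
    convert zero_smul ℝ g using 2
    ring

end MetricTrace

section PosDef

variable {n : Type*} [Fintype n] [DecidableEq n] {A : Matrix n n ℝ}

lemma isUnit_det_of_posDef (h : A.PosDef) : IsUnit A.det :=
  h.det_pos.ne'.isUnit

omit [Fintype n] [DecidableEq n] in
lemma transpose_eq_of_posDef (h : A.PosDef) : Aᵀ = A := by
  simpa only [Matrix.IsHermitian, Matrix.conjTranspose_eq_transpose_of_trivial] using h.isHermitian

lemma transpose_inv_eq_of_posDef (h : A.PosDef) : (A⁻¹)ᵀ = A⁻¹ := by
  rw [Matrix.transpose_nonsing_inv, transpose_eq_of_posDef h]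

end PosDef

/-! ### The field equations as ordinary differential equations -/

/-- The spatial components of the field strength. -/
def Model.spatialField (M : Model) (t : ℝ) : Fin 3 → ℝ := fun i => M.J t i.succ

/-- The square `J_α J^α` of the spatial field strength. -/
def Model.fieldSq (M : Model) (t : ℝ) : ℝ :=
  M.spatialField t ⬝ᵥ ((M.g t)⁻¹ *ᵥ M.spatialField t)

/-- The field equations as ordinary differential equations for the metric components:
`expansion_eq` and `raychaudhuri` are the spatial and the time-time component of the
trace-reversed Einstein equations. -/
structure IsEvolution (γ : ℝ) (M : Model) (I : Set ℝ) : Prop where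
  posDef : ∀ t ∈ I, (M.g t).PosDef
  contDiff_g : ∀ i j, ContDiffOn ℝ 2 (fun t => M.g t i j) I
  contDiff_ρ : ContDiffOn ℝ 1 M.ρ I
  contDiff_J : ∀ μ, ContDiffOn ℝ 1 (fun t => M.J t μ) I
  spatial : ∀ t ∈ I, M.J t 0 = 0
  expansion_eq : ∀ t ∈ I, ∀ i j, deriv (fun s => M.expansion s i j) t
    = 2 * (M.expansion t * M.mixed t) i j - (M.mixed t).trace * M.expansion t i j
      + M.spatialField t i * M.spatialField t j + (2 - γ) / 2 * M.ρ t * M.g t i j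
  raychaudhuri : ∀ t ∈ I, ∑ i, deriv (fun s => M.mixed s i i) t
    = -(M.mixed t * M.mixed t).trace - (3 * γ - 2) / 2 * M.ρ t
  fluid : ∀ t ∈ I, deriv M.ρ t = -γ * (M.mixed t).trace * M.ρ t
  field : ∀ t ∈ I, ∀ i : Fin 3, deriv (fun s => M.J s i.succ) t = 0

section Components

variable {M : Model} {I : Set ℝ}

lemma expansion_transpose (hI : IsOpen I) (h : ∀ t ∈ I, (M.g t).PosDef) {t : ℝ} (ht : t ∈ I) :
    (M.expansion t)ᵀ = M.expansion t := by
  ext i j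
  simp only [Model.expansion, Matrix.transpose_apply, Matrix.of_apply]
  congr 1
  refine Filter.EventuallyEq.deriv_eq ?_
  filter_upwards [hI.mem_nhds ht] with s hs
  exact congrFun₂ (transpose_eq_of_posDef (h s hs)) i j

lemma expansion_mul_mixed_transpose (hI : IsOpen I) (h : ∀ t ∈ I, (M.g t).PosDef) {t : ℝ}
    (ht : t ∈ I) : (M.expansion t * M.mixed t)ᵀ = M.expansion t * M.mixed t := by
  rw [Model.mixed, ← Matrix.mul_assoc, Matrix.transpose_mul, Matrix.transpose_mul,
    expansion_transpose hI h ht, transpose_inv_eq_of_posDef (h t ht), Matrix.mul_assoc]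

lemma ricci_eq_block (hI : IsOpen I) (h : ∀ t ∈ I, (M.g t).PosDef) {x : Point} (hx : x 0 ∈ I) :
    ricci M.metric x = block
      (-(∑ i, deriv (fun t => M.mixed t i i) (x 0)) - (M.mixed (x 0) * M.mixed (x 0)).trace)
      (Matrix.of (fun i j => deriv (fun t => M.expansion t i j) (x 0))
        + (M.mixed (x 0)).trace • M.expansion (x 0)
        - (2 : ℝ) • (M.expansion (x 0) * M.mixed (x 0))) := by
  have hdet : ∀ t ∈ I, IsUnit (M.g t).det := fun t ht => isUnit_det_of_posDef (h t ht)
  refine matrix_ext_zero_succ (ricci_zero_zero M hI hdet hx) (ricci_zero_succ M hI hdet hx)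
    (ricci_succ_zero M hI hdet hx) fun i j => ?_
  have hsymm := congrFun₂ (expansion_mul_mixed_transpose hI h hx) i j
  rw [Matrix.transpose_apply] at hsymm
  rw [ricci_succ_succ M hI hdet hx, hsymm]
  simp only [block_succ_succ, Matrix.sub_apply, Matrix.add_apply, Matrix.smul_apply,
    Matrix.of_apply, smul_eq_mul]
  ring

lemma metric_transpose {x : Point} (h : (M.g (x 0)).PosDef) : (M.metric x)ᵀ = M.metric x :=
  matrix_ext_zero_succ rfl (fun _ => rfl) (fun _ => rfl) fun i j =>
    congrFun₂ (transpose_eq_of_posDef h) i j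

lemma isUnit_det_metric {x : Point} (h : (M.g (x 0)).PosDef) : IsUnit (M.metric x).det := by
  refine Matrix.isUnit_det_of_right_inverse (B := block (-1) (M.g (x 0))⁻¹) ?_
  rw [metric_eq_block, block_mul_block, Matrix.mul_nonsing_inv _ (isUnit_det_of_posDef h),
    neg_one_mul, neg_neg, block_one_one]

lemma metricTrace_metric {x : Point} (h : (M.g (x 0)).PosDef) (A : Matrix (Fin 4) (Fin 4) ℝ) :
    metricTrace (M.metric x) A
      = -A 0 0 + metricTrace (M.g (x 0)) (A.submatrix Fin.succ Fin.succ) := by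
  simp [metricTrace, metric_inv M (isUnit_det_of_posDef h), sum_fin_four]

lemma metricTrace_field {x : Point} (h : (M.g (x 0)).PosDef) (hJ : M.J (x 0) 0 = 0) :
    metricTrace (M.metric x) (Matrix.vecMulVec (M.field x) (M.field x)) = M.fieldSq (x 0) := by
  rw [metricTrace_metric h]
  simp only [metricTrace, Model.fieldSq, dotProduct, Matrix.mulVec,
    Matrix.submatrix_apply, Matrix.vecMulVec_apply, Model.field, hJ, Finset.mul_sum, mul_zero,
    neg_zero, zero_add, Model.spatialField]
  exact Finset.sum_congr rfl fun i _ => Finset.sum_congr rfl fun j _ => by ring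

lemma formTensor_eq {x : Point} (h : (M.g (x 0)).PosDef) (hJ : M.J (x 0) 0 = 0) :
    M.formTensor x = Matrix.vecMulVec (M.field x) (M.field x)
      - (1 / 2 * M.fieldSq (x 0)) • M.metric x := by
  ext μ ν
  simp only [Model.formTensor, ← metricTrace_field h hJ, metricTrace, Matrix.of_apply,
    Matrix.sub_apply, Matrix.smul_apply, Matrix.vecMulVec_apply, smul_eq_mul, mul_assoc]
  ring

lemma fluidTensor_eq_block (γ : ℝ) (M : Model) (x : Point) :
    M.fluidTensor γ x = block (M.ρ (x 0)) (((γ - 1) * M.ρ (x 0)) • M.g (x 0)) := by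
  apply matrix_ext_zero_succ <;> intros <;>
    simp [Model.fluidTensor, metric_eq_block]

lemma metricTrace_matter (γ : ℝ) {x : Point} (h : (M.g (x 0)).PosDef) (hJ : M.J (x 0) 0 = 0) :
    metricTrace (M.metric x) (M.fluidTensor γ x + M.formTensor x)
      = (3 * γ - 4) * M.ρ (x 0) - M.fieldSq (x 0) := by
  have hfluid : metricTrace (M.metric x) (M.fluidTensor γ x) = (3 * γ - 4) * M.ρ (x 0) := by
    have hsub : (M.fluidTensor γ x).submatrix Fin.succ Fin.succ
        = ((γ - 1) * M.ρ (x 0)) • M.g (x 0) := by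
      rw [fluidTensor_eq_block]; rfl
    rw [metricTrace_metric h, hsub, metricTrace_smul,
      metricTrace_self (transpose_eq_of_posDef h) (isUnit_det_of_posDef h), fluidTensor_eq_block,
      block_zero_zero, Fintype.card_fin]
    push_cast
    ring
  rw [metricTrace_add, hfluid, formTensor_eq h hJ, metricTrace_sub, metricTrace_smul,
    metricTrace_field h hJ, metricTrace_self (metric_transpose h) (isUnit_det_metric h),
    Fintype.card_fin]
  push_cast
  ring

lemma traceReversed_matter (γ : ℝ) {x : Point} (h : (M.g (x 0)).PosDef) (hJ : M.J (x 0) 0 = 0) :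
    M.fluidTensor γ x + M.formTensor x
        - (1 / 2 * metricTrace (M.metric x) (M.fluidTensor γ x + M.formTensor x)) • M.metric x
      = block ((3 * γ - 2) / 2 * M.ρ (x 0))
          (Matrix.vecMulVec (M.spatialField (x 0)) (M.spatialField (x 0))
            + ((2 - γ) / 2 * M.ρ (x 0)) • M.g (x 0)) := by
  rw [metricTrace_matter γ h hJ, formTensor_eq h hJ, fluidTensor_eq_block, metric_eq_block]
  apply matrix_ext_zero_succ <;> intros <;>
    simp only [Matrix.sub_apply, Matrix.add_apply, Matrix.smul_apply, Matrix.vecMulVec_apply,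
      smul_eq_mul, block_zero_zero, block_zero_succ, block_succ_zero, block_succ_succ,
      Model.field, Model.spatialField, hJ] <;> ring

lemma einstein_eq_iff (γ : ℝ) (hI : IsOpen I) (h : ∀ t ∈ I, (M.g t).PosDef) {x : Point}
    (hx : x 0 ∈ I) (hJ : M.J (x 0) 0 = 0) :
    einstein M.metric x = M.fluidTensor γ x + M.formTensor x ↔
      (∀ i j, deriv (fun s => M.expansion s i j) (x 0)
        = 2 * (M.expansion (x 0) * M.mixed (x 0)) i j
          - (M.mixed (x 0)).trace * M.expansion (x 0) i j
          + M.spatialField (x 0) i * M.spatialField (x 0) j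
          + (2 - γ) / 2 * M.ρ (x 0) * M.g (x 0) i j) ∧
      ∑ i, deriv (fun s => M.mixed s i i) (x 0)
        = -(M.mixed (x 0) * M.mixed (x 0)).trace - (3 * γ - 2) / 2 * M.ρ (x 0) := by
  have hdim : metricTrace (M.metric x) (M.metric x) = 4 := by
    rw [metricTrace_self (metric_transpose (h _ hx)) (isUnit_det_metric (h _ hx)),
      Fintype.card_fin, Nat.cast_ofNat]
  have hreversed : einstein M.metric x = M.fluidTensor γ x + M.formTensor x ↔ _ :=
    sub_half_metricTrace_smul_eq_iff hdim
  rw [hreversed, traceReversed_matter γ (h _ hx) hJ, ricci_eq_block hI h hx, block_inj, and_comm]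
  refine and_congr ?_ ⟨fun H => by linear_combination -H, fun H => by linear_combination -H⟩
  simp only [← Matrix.ext_iff, Matrix.sub_apply, Matrix.add_apply, Matrix.smul_apply,
    Matrix.of_apply, Matrix.vecMulVec_apply, smul_eq_mul]
  exact forall₂_congr fun i j =>
    ⟨fun H => by linear_combination H, fun H => by linear_combination H⟩

lemma covDeriv₂_fluid_zero_zero (γ : ℝ) (M : Model) (x : Point) :
    covDeriv₂ M.metric (M.fluidTensor γ) 0 0 0 x = deriv M.ρ (x 0) := by
  have := pd_zero_comp M.ρ x
  simp [covDeriv₂, fluidTensor_eq_block, christoffel_zero_zero, this]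

lemma covDeriv₂_fluid_zero_zero_succ (γ : ℝ) {x : Point} (h : IsUnit (M.g (x 0)).det)
    (j : Fin 3) : covDeriv₂ M.metric (M.fluidTensor γ) 0 0 j.succ x = 0 := by
  simp [covDeriv₂, sum_fin_four, fluidTensor_eq_block, christoffel_zero_zero,
    christoffel_zero_zero_succ M h]

lemma covDeriv₂_fluid_succ_succ_zero (γ : ℝ) {x : Point} (h : IsUnit (M.g (x 0)).det)
    (i j : Fin 3) :
    covDeriv₂ M.metric (M.fluidTensor γ) i.succ j.succ 0 x
      = -(M.ρ (x 0) * M.expansion (x 0) i j)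
        - (γ - 1) * M.ρ (x 0) * M.expansion (x 0) j i := by
  have hlower : ∑ k, M.mixed (x 0) k i * ((γ - 1) * M.ρ (x 0) * M.g (x 0) j k)
      = (γ - 1) * M.ρ (x 0) * M.expansion (x 0) j i := by
    have hmixed : M.g (x 0) * M.mixed (x 0) = M.expansion (x 0) := by
      rw [Model.mixed, Matrix.mul_nonsing_inv_cancel_left _ _ h]
    rw [← hmixed, Matrix.mul_apply, Finset.mul_sum]
    exact Finset.sum_congr rfl fun k _ => by ring
  simp only [covDeriv₂, sum_fin_four, fluidTensor_eq_block, block_succ_zero, block_zero_zero,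
    block_succ_succ, Matrix.smul_apply, smul_eq_mul, pd_const, christoffel_zero_succ_succ M h,
    christoffel_succ_succ_succ M h, christoffel_succ_succ_zero M h, mul_zero, zero_add,
    add_zero, hlower]
  ring

lemma covDeriv₂_fluid_succ_succ_succ (γ : ℝ) {x : Point} (h : IsUnit (M.g (x 0)).det)
    (i j k : Fin 3) : covDeriv₂ M.metric (M.fluidTensor γ) i.succ j.succ k.succ x = 0 := by
  have := pd_succ_comp (fun t => (γ - 1) * M.ρ t * M.g t j k) x i
  simp [covDeriv₂, sum_fin_four, fluidTensor_eq_block, christoffel_succ_succ_succ M h, this]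

lemma divergence_fluid_zero (γ : ℝ) {x : Point} (hI : IsOpen I) (h : ∀ t ∈ I, (M.g t).PosDef)
    (hx : x 0 ∈ I) :
    divergence M.metric (M.fluidTensor γ) 0 x
      = -deriv M.ρ (x 0) - γ * (M.mixed (x 0)).trace * M.ρ (x 0) := by
  have hdet := isUnit_det_of_posDef (h _ hx)
  have hs : ∀ i j, M.expansion (x 0) i j = M.expansion (x 0) j i := fun i j =>
    congrFun (congrFun (expansion_transpose hI h hx) j) i
  have htr : (M.mixed (x 0)).trace
      = ∑ i, ∑ j, (M.g (x 0))⁻¹ i j * M.expansion (x 0) j i := by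
    simp [Matrix.trace, Model.mixed, Matrix.mul_apply]
  simp only [divergence, sum_fin_four, metric_inv M hdet, block_zero_zero, block_zero_succ,
    block_succ_zero, block_succ_succ, covDeriv₂_fluid_zero_zero, zero_mul,
    covDeriv₂_fluid_succ_succ_zero γ hdet, Finset.sum_const_zero, add_zero, zero_add]
  rw [htr, mul_assoc, Finset.sum_mul, Finset.mul_sum, neg_one_mul,
    sub_eq_add_neg (-deriv M.ρ (x 0)), ← Finset.sum_neg_distrib]
  congr 1
  refine Finset.sum_congr rfl fun i _ => ?_
  rw [Finset.sum_mul, Finset.mul_sum, ← Finset.sum_neg_distrib]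
  refine Finset.sum_congr rfl fun j _ => ?_
  rw [hs i j]
  ring

lemma divergence_fluid_succ (γ : ℝ) {x : Point} (h : IsUnit (M.g (x 0)).det) (k : Fin 3) :
    divergence M.metric (M.fluidTensor γ) k.succ x = 0 := by
  simp [divergence, sum_fin_four, metric_inv M h, covDeriv₂_fluid_zero_zero_succ γ h,
    covDeriv₂_fluid_succ_succ_succ γ h]

lemma divergence_fluid_eq_zero_iff (γ : ℝ) (hI : IsOpen I) (h : ∀ t ∈ I, (M.g t).PosDef)
    {x : Point} (hx : x 0 ∈ I) :
    (∀ ν, divergence M.metric (M.fluidTensor γ) ν x = 0) ↔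
      deriv M.ρ (x 0) = -γ * (M.mixed (x 0)).trace * M.ρ (x 0) := by
  rw [Fin.forall_fin_succ, divergence_fluid_zero γ hI h hx,
    and_iff_left (divergence_fluid_succ γ (isUnit_det_of_posDef (h _ hx)))]
  exact ⟨fun H => by linear_combination -H, fun H => by linear_combination -H⟩

lemma christoffel_symm (hI : IsOpen I) (h : ∀ t ∈ I, (M.g t).PosDef) {x : Point} (hx : x 0 ∈ I)
    (α μ ν : Fin 4) : christoffel M.metric α μ ν x = christoffel M.metric α ν μ x := by
  have hdet := isUnit_det_of_posDef (h _ hx)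
  induction α using Fin.cases <;> induction μ using Fin.cases <;> induction ν using Fin.cases <;>
    simp only [christoffel_zero_zero_succ M hdet, christoffel_zero_succ_zero M hdet,
      christoffel_succ_succ_succ M hdet, christoffel_succ_zero_succ M hdet,
      christoffel_succ_succ_zero M hdet, christoffel_zero_succ_succ M hdet]
  rename_i i j
  exact congrFun (congrFun (expansion_transpose hI h hx) j) i

lemma closed_iff (hI : IsOpen I) (h : ∀ t ∈ I, (M.g t).PosDef) {x : Point} (hx : x 0 ∈ I) :
    (∀ μ ν, covDeriv₁ M.metric M.field μ ν x - covDeriv₁ M.metric M.field ν μ x = 0) ↔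
      ∀ i : Fin 3, deriv (fun s => M.J s i.succ) (x 0) = 0 := by
  have hcurl : ∀ μ ν, covDeriv₁ M.metric M.field μ ν x - covDeriv₁ M.metric M.field ν μ x
      = pd μ (fun y => M.field y ν) x - pd ν (fun y => M.field y μ) x := by
    intro μ ν
    simp only [covDeriv₁, christoffel_symm hI h hx _ μ ν]
    ring
  have htime : ∀ ν, pd 0 (fun y => M.field y ν) x = deriv (fun s => M.J s ν) (x 0) := fun ν =>
    pd_zero_comp (fun s => M.J s ν) x
  have hspace : ∀ (i : Fin 3) ν, pd i.succ (fun y => M.field y ν) x = 0 := fun i ν =>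
    pd_succ_comp (fun s => M.J s ν) x i
  simp only [hcurl]
  constructor
  · intro H i
    simpa [htime, hspace] using H 0 i.succ
  · intro H μ ν
    induction μ using Fin.cases <;> induction ν using Fin.cases <;> simp [htime, hspace, H]

lemma coclosed_of_spatial (hI : IsOpen I) (h : ∀ t ∈ I, (M.g t).PosDef)
    (hJ : ∀ t ∈ I, M.J t 0 = 0) {x : Point} (hx : x 0 ∈ I) :
    ∑ μ, ∑ ν, (M.metric x)⁻¹ μ ν * covDeriv₁ M.metric M.field μ ν x = 0 := by
  have hdet := isUnit_det_of_posDef (h _ hx)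
  have htime : pd 0 (fun y => M.field y 0) x = 0 :=
    (pd_zero_of_eqOn hI (F := fun _ => 0) (fun y hy => hJ _ hy) hx).trans (deriv_const _ _)
  have hspace : ∀ (i : Fin 3) ν, pd i.succ (fun y => M.field y ν) x = 0 := fun i ν =>
    pd_succ_comp (fun s => M.J s ν) x i
  have hfield : M.field x 0 = 0 := hJ _ hx
  simp [sum_fin_four, metric_inv M hdet, covDeriv₁, htime, hspace, hfield, christoffel_zero_zero,
    christoffel_succ_succ_succ M hdet]

theorem isSolution_iff_isEvolution (γ : ℝ) (hI : IsOpen I) :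
    IsSolution γ M I ↔ IsEvolution γ M I := by
  constructor
  · intro h
    have heinstein (t : ℝ) (ht : t ∈ I) :=
      (einstein_eq_iff γ hI h.posDef (x := fun _ => t) ht (h.spatial t ht)).1
        (h.einstein_eq _ ht)
    exact
      { posDef := h.posDef
        contDiff_g := h.contDiff_g
        contDiff_ρ := h.contDiff_ρ
        contDiff_J := h.contDiff_J
        spatial := h.spatial
        expansion_eq := fun t ht => (heinstein t ht).1
        raychaudhuri := fun t ht => (heinstein t ht).2
        fluid := fun t ht => (divergence_fluid_eq_zero_iff γ hI h.posDef (x := fun _ => t) ht).1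
          (h.fluid_eq _ ht)
        field := fun t ht => (closed_iff hI h.posDef (x := fun _ => t) ht).1 (h.closed _ ht) }
  · intro h
    exact
      { posDef := h.posDef
        contDiff_g := h.contDiff_g
        contDiff_ρ := h.contDiff_ρ
        contDiff_J := h.contDiff_J
        spatial := h.spatial
        einstein_eq := fun x hx => (einstein_eq_iff γ hI h.posDef hx (h.spatial _ hx)).2
          ⟨h.expansion_eq _ hx, h.raychaudhuri _ hx⟩
        fluid_eq := fun x hx => (divergence_fluid_eq_zero_iff γ hI h.posDef hx).2 (h.fluid _ hx)
        closed := fun x hx => (closed_iff hI h.posDef hx).2 (h.field _ hx)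
        coclosed := fun x hx => coclosed_of_spatial hI h.posDef h.spatial hx }

end Components

/-! ### Entrywise derivatives of matrix-valued functions -/

/-- Entrywise derivative of a matrix-valued function of time. Matrices carry no global norm, so
this is not an instance of `HasDerivAt`. -/
def HasEntryDeriv {m n : Type*} (A : ℝ → Matrix m n ℝ) (A' : Matrix m n ℝ) (t : ℝ) : Prop :=
  ∀ i j, HasDerivAt (fun s => A s i j) (A' i j) t

namespace HasEntryDeriv

variable {l m n : Type*} {t : ℝ}

lemma congr_deriv {A : ℝ → Matrix m n ℝ} {A' A'' : Matrix m n ℝ} (hA : HasEntryDeriv A A' t)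
    (h : A' = A'') : HasEntryDeriv A A'' t := h ▸ hA

lemma congr_of_eventuallyEq {A B : ℝ → Matrix m n ℝ} {A' : Matrix m n ℝ}
    (hA : HasEntryDeriv A A' t) (h : B =ᶠ[𝓝 t] A) : HasEntryDeriv B A' t :=
  fun i j => (hA i j).congr_of_eventuallyEq (h.mono fun _ hs => congrFun₂ hs i j)

lemma diagonal [DecidableEq n] {v : ℝ → n → ℝ} {v' : n → ℝ}
    (hv : ∀ i, HasDerivAt (fun s => v s i) (v' i) t) :
    HasEntryDeriv (fun s => Matrix.diagonal (v s)) (Matrix.diagonal v') t := by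
  intro i j
  rcases eq_or_ne i j with rfl | hij
  · simpa only [Matrix.diagonal_apply_eq] using hv i
  · simpa only [Matrix.diagonal_apply_ne _ hij] using hasDerivAt_const t (0 : ℝ)

lemma transpose {A : ℝ → Matrix m n ℝ} {A' : Matrix m n ℝ} (hA : HasEntryDeriv A A' t) :
    HasEntryDeriv (fun s => (A s)ᵀ) A'ᵀ t :=
  fun i j => hA j i

lemma mul [Fintype m] {A : ℝ → Matrix l m ℝ} {B : ℝ → Matrix m n ℝ} {A' : Matrix l m ℝ}
    {B' : Matrix m n ℝ} (hA : HasEntryDeriv A A' t) (hB : HasEntryDeriv B B' t) :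
    HasEntryDeriv (fun s => A s * B s) (A' * B t + A t * B') t := by
  intro i j
  simp only [Matrix.mul_apply, Matrix.add_apply, ← Finset.sum_add_distrib]
  exact HasDerivAt.fun_sum fun k _ => (hA i k).mul (hB k j)

variable [Fintype n] {A : ℝ → Matrix n n ℝ} {A' : Matrix n n ℝ}

lemma trace (hA : HasEntryDeriv A A' t) : HasDerivAt (fun s => (A s).trace) A'.trace t := by
  simp only [Matrix.trace, Matrix.diag_apply]
  exact HasDerivAt.fun_sum fun i _ => hA i i

variable [DecidableEq n]

lemma differentiableAt_det (hA : HasEntryDeriv A A' t) :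
    DifferentiableAt ℝ (fun s => (A s).det) t := by
  simp only [Matrix.det_apply']
  exact DifferentiableAt.fun_sum fun σ _ =>
    (DifferentiableAt.fun_finsetProd fun i _ => (hA (σ i) i).differentiableAt).const_mul _

lemma differentiableAt_adjugate (hA : HasEntryDeriv A A' t) (i j : n) :
    DifferentiableAt ℝ (fun s => (A s).adjugate i j) t := by
  simp only [Matrix.adjugate_apply]
  refine HasEntryDeriv.differentiableAt_det (A := fun s => (A s).updateRow j (Pi.single i 1))
    (A' := A'.updateRow j 0) fun k l => ?_
  simp only [Matrix.updateRow_apply]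
  split_ifs
  · exact hasDerivAt_const _ _
  · exact hA k l

lemma differentiableAt_inv (hA : HasEntryDeriv A A' t) (hdet : IsUnit (A t).det) (i j : n) :
    DifferentiableAt ℝ (fun s => (A s)⁻¹ i j) t := by
  simp only [Matrix.inv_def, Ring.inverse_eq_inv', Matrix.smul_apply, smul_eq_mul]
  exact (hA.differentiableAt_det.inv hdet.ne_zero).mul (hA.differentiableAt_adjugate i j)

lemma inv (hA : HasEntryDeriv A A' t) (hdet : ∀ᶠ s in 𝓝 t, IsUnit (A s).det) :
    HasEntryDeriv (fun s => (A s)⁻¹) (-((A t)⁻¹ * A' * (A t)⁻¹)) t := by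
  have hdet_t := hdet.self_of_nhds
  set P : Matrix n n ℝ := Matrix.of fun i j => deriv (fun s => (A s)⁻¹ i j) t
  have hP : HasEntryDeriv (fun s => (A s)⁻¹) P t := fun i j =>
    (hA.differentiableAt_inv hdet_t i j).hasDerivAt
  have hproduct : P * A t + (A t)⁻¹ * A' = 0 := by
    ext i j
    refine (hP.mul hA i j).unique ?_
    refine (hasDerivAt_const t ((1 : Matrix n n ℝ) i j)).congr_of_eventuallyEq ?_
    filter_upwards [hdet] with s hs
    rw [Matrix.nonsing_inv_mul _ hs]
  refine hP.congr_deriv ?_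
  rw [← Matrix.mul_nonsing_inv_cancel_right (A t) P hdet_t, eq_neg_of_add_eq_zero_left hproduct,
    Matrix.neg_mul]

end HasEntryDeriv

/-! ### Evolution of the mixed expansion tensor -/

namespace IsEvolution

variable {γ : ℝ} {M : Model} {I : Set ℝ} (h : IsEvolution γ M I) (hI : IsOpen I)
  {t : ℝ} (ht : t ∈ I)
include h hI ht

lemma hasEntryDeriv_g : HasEntryDeriv M.g ((2 : ℝ) • M.expansion t) t := by
  intro i j
  refine (((h.contDiff_g i j).differentiableOn (by norm_num)).differentiableAt
    (hI.mem_nhds ht)).hasDerivAt.congr_deriv ?_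
  simp [Model.expansion]

lemma hasEntryDeriv_expansion : HasEntryDeriv M.expansion
    ((2 : ℝ) • (M.expansion t * M.mixed t) - (M.mixed t).trace • M.expansion t
      + Matrix.vecMulVec (M.spatialField t) (M.spatialField t)
      + ((2 - γ) / 2 * M.ρ t) • M.g t) t := by
  intro i j
  have hderiv : DifferentiableAt ℝ (deriv fun s => M.g s i j) t :=
    (((h.contDiff_g i j).deriv_of_isOpen hI (m := 1) (by norm_num)).differentiableOn
      (by norm_num)).differentiableAt (hI.mem_nhds ht)
  have hexpansion : DifferentiableAt ℝ (fun s => M.expansion s i j) t := by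
    simpa only [Model.expansion, Matrix.of_apply] using hderiv.const_mul (1 / 2)
  refine hexpansion.hasDerivAt.congr_deriv ?_
  rw [h.expansion_eq t ht i j]
  simp [Matrix.vecMulVec_apply]

lemma isUnit_det_eventually : ∀ᶠ s in 𝓝 t, IsUnit (M.g s).det := by
  filter_upwards [hI.mem_nhds ht] with s hs using isUnit_det_of_posDef (h.posDef s hs)

lemma hasEntryDeriv_inv :
    HasEntryDeriv (fun s => (M.g s)⁻¹) (-(2 : ℝ) • (M.mixed t * (M.g t)⁻¹)) t := by
  refine ((h.hasEntryDeriv_g hI ht).inv (h.isUnit_det_eventually hI ht)).congr_deriv ?_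
  simp [Model.mixed]

lemma hasEntryDeriv_mixed : HasEntryDeriv M.mixed
    (-(M.mixed t).trace • M.mixed t
      + Matrix.vecMulVec ((M.g t)⁻¹ *ᵥ M.spatialField t) (M.spatialField t)
      + ((2 - γ) / 2 * M.ρ t) • (1 : Matrix (Fin 3) (Fin 3) ℝ)) t := by
  have hdet := isUnit_det_of_posDef (h.posDef t ht)
  refine ((h.hasEntryDeriv_inv hI ht).mul (h.hasEntryDeriv_expansion hI ht)).congr_deriv ?_
  have hquad : M.mixed t * (M.g t)⁻¹ * M.expansion t
      = (M.g t)⁻¹ * (M.expansion t * M.mixed t) := by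
    simp only [Model.mixed, Matrix.mul_assoc]
  have hmixed : (M.g t)⁻¹ * M.expansion t = M.mixed t := rfl
  simp only [Matrix.mul_add, Matrix.mul_sub, Matrix.mul_smul, Matrix.smul_mul, hquad, hmixed,
    Matrix.mul_vecMulVec, Matrix.nonsing_inv_mul _ hdet]
  module

lemma hasDerivAt_trace : HasDerivAt (fun s => (M.mixed s).trace)
    (-(M.mixed t).trace ^ 2 + M.fieldSq t + 3 / 2 * (2 - γ) * M.ρ t) t := by
  refine (h.hasEntryDeriv_mixed hI ht).trace.congr_deriv ?_
  simp only [Matrix.trace_add, Matrix.trace_smul, Matrix.trace_vecMulVec, Matrix.trace_one,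
    Model.fieldSq, Fintype.card_fin, smul_eq_mul, dotProduct_comm (M.spatialField t)]
  push_cast
  ring

lemma constraint : (M.mixed t).trace ^ 2 - (M.mixed t * M.mixed t).trace
    = 2 * M.ρ t + M.fieldSq t := by
  have htrace := (h.hasDerivAt_trace hI ht).deriv
  have hsum : deriv (fun s => (M.mixed s).trace) t = ∑ i, deriv (fun s => M.mixed s i i) t := by
    simp only [Matrix.trace, Matrix.diag_apply]
    exact deriv_fun_sum fun i _ => (h.hasEntryDeriv_mixed hI ht i i).differentiableAt
  rw [hsum, h.raychaudhuri t ht] at htrace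
  linear_combination htrace

lemma hasDerivAt_ρ : HasDerivAt M.ρ (-γ * (M.mixed t).trace * M.ρ t) t := by
  rw [← h.fluid t ht]
  exact ((h.contDiff_ρ.differentiableOn (by norm_num)).differentiableAt
    (hI.mem_nhds ht)).hasDerivAt

lemma hasDerivAt_spatialField (i : Fin 3) : HasDerivAt (fun s => M.spatialField s i) 0 t := by
  rw [← h.field t ht i]
  exact (((h.contDiff_J i.succ).differentiableOn (by norm_num)).differentiableAt
    (hI.mem_nhds ht)).hasDerivAt

end IsEvolution

/-! ### Moments of the expansion tensor along the field strength -/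

/-- The quadratic form `J_i A^{ij} J_j`. -/
def Model.form (M : Model) (t : ℝ) (A : Matrix (Fin 3) (Fin 3) ℝ) : ℝ :=
  M.spatialField t ⬝ᵥ (A *ᵥ M.spatialField t)

/-- The moment `J_i (K^n)^i_k g^{kj} J_j` of the mixed expansion tensor `K`. -/
def Model.moment (M : Model) (n : ℕ) (t : ℝ) : ℝ := M.form t (M.mixed t ^ n * (M.g t)⁻¹)

lemma Model.moment_zero (M : Model) (t : ℝ) : M.moment 0 t = M.fieldSq t := by
  simp [Model.moment, Model.form, Model.fieldSq]

lemma Model.form_add (M : Model) (t : ℝ) (A B : Matrix (Fin 3) (Fin 3) ℝ) :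
    M.form t (A + B) = M.form t A + M.form t B := by
  simp [Model.form, Matrix.add_mulVec]

lemma Model.form_sub (M : Model) (t : ℝ) (A B : Matrix (Fin 3) (Fin 3) ℝ) :
    M.form t (A - B) = M.form t A - M.form t B := by
  simp [Model.form, Matrix.sub_mulVec]

lemma Model.form_sum (M : Model) (t : ℝ) {ι : Type*} (s : Finset ι)
    (A : ι → Matrix (Fin 3) (Fin 3) ℝ) : M.form t (∑ k ∈ s, A k) = ∑ k ∈ s, M.form t (A k) := by
  simp [Model.form, Matrix.sum_mulVec, dotProduct_sum]

lemma Model.form_smul (M : Model) (t : ℝ) (c : ℝ) (A : Matrix (Fin 3) (Fin 3) ℝ) :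
    M.form t (c • A) = c * M.form t A := by
  simp [Model.form, Matrix.smul_mulVec]

lemma Model.form_mul_vecMulVec_mul (M : Model) (t : ℝ) (A B C : Matrix (Fin 3) (Fin 3) ℝ) :
    M.form t (A * (Matrix.vecMulVec (B *ᵥ M.spatialField t) (M.spatialField t) * C))
      = M.form t (A * B) * M.form t C := by
  rw [Matrix.vecMulVec_mul, Matrix.mul_vecMulVec, Model.form, Model.form, Model.form,
    Matrix.vecMulVec_mulVec, Matrix.mulVec_mulVec, dotProduct_smul, ← Matrix.dotProduct_mulVec]
  simp [mul_comm]

namespace IsEvolution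

variable {γ : ℝ} {M : Model} {I : Set ℝ} (h : IsEvolution γ M I) (hI : IsOpen I)
  {t : ℝ} (ht : t ∈ I)
include h hI ht

lemma hasDerivAt_form {A : ℝ → Matrix (Fin 3) (Fin 3) ℝ} {A' : Matrix (Fin 3) (Fin 3) ℝ}
    (hA : HasEntryDeriv A A' t) : HasDerivAt (fun s => M.form s (A s)) (M.form t A') t := by
  simp only [Model.form, dotProduct, Matrix.mulVec]
  refine HasDerivAt.congr_deriv (HasDerivAt.fun_sum fun i _ =>
    (h.hasDerivAt_spatialField hI ht i).mul (HasDerivAt.fun_sum fun j _ =>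
      (hA i j).mul (h.hasDerivAt_spatialField hI ht j))) ?_
  simp

lemma hasEntryDeriv_mixed_pow_mul_inv (n : ℕ) :
    HasEntryDeriv (fun s => M.mixed s ^ n * (M.g s)⁻¹)
      (-(n * (M.mixed t).trace) • (M.mixed t ^ n * (M.g t)⁻¹)
        + ∑ k ∈ Finset.range n, M.mixed t ^ k *
            (Matrix.vecMulVec ((M.g t)⁻¹ *ᵥ M.spatialField t) (M.spatialField t)
              * (M.mixed t ^ (n - 1 - k) * (M.g t)⁻¹))
        + (n * ((2 - γ) / 2 * M.ρ t)) • (M.mixed t ^ (n - 1) * (M.g t)⁻¹)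
        - (2 : ℝ) • (M.mixed t ^ (n + 1) * (M.g t)⁻¹)) t := by
  induction n with
  | zero =>
    simpa only [pow_zero, Matrix.one_mul, Nat.cast_zero, zero_mul, neg_zero, zero_smul,
      Finset.sum_range_zero, zero_add, zero_sub, pow_one, neg_smul]
      using h.hasEntryDeriv_inv hI ht
  | succ n ih =>
    simp only [pow_succ' _ n, Matrix.mul_assoc]
    refine ((h.hasEntryDeriv_mixed hI ht).mul ih).congr_deriv ?_
    have hpred : (n * ((2 - γ) / 2 * M.ρ t)) • (M.mixed t * (M.mixed t ^ (n - 1) * (M.g t)⁻¹))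
        = (n * ((2 - γ) / 2 * M.ρ t)) • (M.mixed t ^ n * (M.g t)⁻¹) := by
      cases n with
      | zero => simp only [Nat.cast_zero, zero_mul, zero_smul]
      | succ m => rw [Nat.add_sub_cancel, ← Matrix.mul_assoc, ← pow_succ']
    have hshift : ∀ k, n + 1 - 1 - (k + 1) = n - 1 - k := fun k => by omega
    simp only [Finset.sum_range_succ', hshift]
    simp only [Matrix.add_mul, Matrix.smul_mul, Matrix.one_mul, Matrix.mul_add, Matrix.mul_sub,
      Matrix.mul_smul, Matrix.mul_sum, hpred, pow_succ', pow_zero, Nat.sub_zero,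
      Nat.add_sub_cancel, Matrix.mul_assoc]
    push_cast
    module

lemma hasDerivAt_moment (n : ℕ) : HasDerivAt (M.moment n)
    (-(n * (M.mixed t).trace) * M.moment n t
      + ∑ k ∈ Finset.range n, M.moment k t * M.moment (n - 1 - k) t
      + n * ((2 - γ) / 2 * M.ρ t) * M.moment (n - 1) t - 2 * M.moment (n + 1) t) t := by
  refine (h.hasDerivAt_form hI ht (h.hasEntryDeriv_mixed_pow_mul_inv hI ht n)).congr_deriv ?_
  simp only [Model.form_add, Model.form_sub, Model.form_smul, Model.form_sum,
    Model.form_mul_vecMulVec_mul, Model.moment]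

end IsEvolution

/-! ### Aligned frames -/

lemma exists_orthogonal_vecMul_eq_single {n : Type*} [Fintype n] [DecidableEq n] (i₀ : n)
    {f : n → ℝ} (hf : f ≠ 0) :
    ∃ Q : Matrix n n ℝ, Qᵀ * Q = 1 ∧ ∃ r > 0, f ᵥ* Q = Pi.single i₀ r := by
  set F : EuclideanSpace ℝ n := WithLp.toLp 2 f with hF
  have hnorm : 0 < ‖F‖ := norm_pos_iff.2 (by simpa [hF] using hf)
  obtain ⟨b, hb⟩ := Orthonormal.exists_orthonormalBasis_extension_of_card_eq (𝕜 := ℝ)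
    (E := EuclideanSpace ℝ n) (ι := n) (by simp) (v := fun _ => ‖F‖⁻¹ • F) (s := {i₀}) <| by
      constructor
      · intro i
        simp [norm_smul, hnorm.ne']
      · intro i j hij
        exact absurd (Subsingleton.elim i j) hij
  have hF_eq : F = ‖F‖ • b i₀ := by
    rw [hb i₀ rfl, smul_smul, mul_inv_cancel₀ hnorm.ne', one_smul]
  have hinner (x y : EuclideanSpace ℝ n) : inner ℝ x y = ∑ i, x i * y i := by
    simp [PiLp.inner_apply, mul_comm]
  refine ⟨Matrix.of fun i j => b j i, ?_, ‖F‖, hnorm, ?_⟩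
  · ext i j
    rw [Matrix.mul_apply, Matrix.one_apply, ← orthonormal_iff_ite.1 b.orthonormal i j, hinner]
    rfl
  · ext j
    have hcoord : (f ᵥ* (Matrix.of fun i j => b j i)) j = inner ℝ F (b j) := by
      rw [hinner]; rfl
    rw [hcoord, hF_eq, inner_smul_left, orthonormal_iff_ite.1 b.orthonormal i₀ j, ← hF_eq]
    simp [Pi.single_apply, eq_comm]

open scoped MatrixOrder in
lemma exists_eq_transpose_mul_self_of_posDef {n : Type*} [Fintype n] [DecidableEq n]
    {A : Matrix n n ℝ} (h : A.PosDef) : ∃ B, IsUnit B.det ∧ A = Bᵀ * B := by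
  obtain ⟨B, hB⟩ := CStarAlgebra.nonneg_iff_eq_star_mul_self.1 h.posSemidef.nonneg
  rw [Matrix.star_eq_conjTranspose, Matrix.conjTranspose_eq_transpose_of_trivial] at hB
  refine ⟨B, ?_, hB⟩
  have hdet := h.det_pos
  rw [hB, Matrix.det_mul] at hdet
  exact (right_ne_zero_of_mul hdet.ne').isUnit

lemma exists_isAlignedFrame {M : Model} {t : ℝ} (h : (M.g t).PosDef)
    (hJ : M.spatialField t ≠ 0) : ∃ E, IsAlignedFrame M t E := by
  obtain ⟨B, hB, hgB⟩ := exists_eq_transpose_mul_self_of_posDef h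
  have hJB : M.spatialField t ᵥ* B⁻¹ ≠ 0 := by
    intro hzero
    apply hJ
    rw [← Matrix.vecMul_one (M.spatialField t), ← Matrix.nonsing_inv_mul B hB,
      ← Matrix.vecMul_vecMul, hzero, Matrix.zero_vecMul]
  obtain ⟨Q, hQ, r, hr, hJQ⟩ := exists_orthogonal_vecMul_eq_single 0 hJB
  have hfield : M.frameField t (B⁻¹ * Q) = Pi.single 0 r := by
    rw [← hJQ, Matrix.vecMul_vecMul]; rfl
  refine ⟨B⁻¹ * Q, ?_, ?_, ?_, ?_⟩
  · rw [hgB, Matrix.transpose_mul, Matrix.mul_assoc, Matrix.mul_assoc, Matrix.mul_assoc,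
      Matrix.mul_nonsing_inv_cancel_left _ _ hB, Matrix.transpose_nonsing_inv,
      Matrix.nonsing_inv_mul_cancel_left _ _ (by rwa [Matrix.det_transpose]), hQ]
  · simpa [hfield] using hr
  · simp [hfield]
  · simp [hfield]

namespace IsAlignedFrame

variable {M : Model} {t : ℝ} {E : Matrix (Fin 3) (Fin 3) ℝ} (hE : IsAlignedFrame M t E)
include hE

lemma inv_eq : (M.g t)⁻¹ = E * Eᵀ := by
  apply Matrix.inv_eq_left_inv
  rw [Matrix.mul_assoc]
  exact mul_eq_one_comm.1 hE.orthonormal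

lemma frameField_eq : M.frameField t E = Pi.single 0 (M.frameField t E 0) := by
  ext i
  fin_cases i
  · simp
  · simpa using hE.zero₁
  · simpa using hE.zero₂

lemma mixed_eq : M.mixed t = E * (Eᵀ * M.expansion t) := by
  rw [Model.mixed, hE.inv_eq, Matrix.mul_assoc]

lemma mixed_pow_mul (n : ℕ) :
    M.mixed t ^ n * E = E * (Eᵀ * M.expansion t * E) ^ n := by
  have hsemiconj : SemiconjBy E (Eᵀ * M.expansion t * E) (M.mixed t) := by
    rw [SemiconjBy, hE.mixed_eq]
    simp only [Matrix.mul_assoc]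
  exact (hsemiconj.pow_right n).eq.symm

lemma moment_eq (n : ℕ) :
    M.moment n t = M.frameField t E 0 ^ 2 * ((Eᵀ * M.expansion t * E) ^ n) 0 0 := by
  have hframe : M.moment n t = M.frameField t E ⬝ᵥ
      ((Eᵀ * M.expansion t * E) ^ n *ᵥ M.frameField t E) := by
    rw [Model.moment, Model.form, hE.inv_eq, ← Matrix.mul_assoc, hE.mixed_pow_mul,
      Matrix.mul_assoc, ← Matrix.mulVec_mulVec, Matrix.dotProduct_mulVec, ← Matrix.mulVec_mulVec,
      Matrix.mulVec_transpose]
    rfl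
  rw [hframe, hE.frameField_eq, single_dotProduct, Matrix.mulVec_single, Pi.single_eq_same]
  simp only [MulOpposite.smul_eq_mul_unop, Pi.smul_apply, MulOpposite.unop_op, Matrix.col_apply]
  ring

lemma trace_mixed : (M.mixed t).trace = (Eᵀ * M.expansion t * E).trace := by
  rw [hE.mixed_eq, Matrix.trace_mul_comm]

lemma trace_mixed_sq : (M.mixed t * M.mixed t).trace
    = ((Eᵀ * M.expansion t * E) * (Eᵀ * M.expansion t * E)).trace := by
  rw [hE.mixed_eq, Matrix.mul_assoc E, Matrix.trace_mul_comm]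
  simp only [Matrix.mul_assoc]

end IsAlignedFrame

/-! ### Frame-independent normalized variables -/

lemma Model.trace_mixed_eq (M : Model) (t : ℝ) : (M.mixed t).trace = 3 * M.hubble t := by
  rw [Model.hubble, Model.mixed]; ring

/-- `n·(1 + Σ)^k n` with `n` the unit vector along the field strength. -/
def Model.normMoment (M : Model) (k : ℕ) (t : ℝ) : ℝ :=
  M.moment k t / (M.hubble t ^ k * M.moment 0 t)

/-- The square `V_a V^a` of the normalized field strength. -/
def Model.vSq (M : Model) (t : ℝ) : ℝ := M.moment 0 t / (6 * M.hubble t ^ 2)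

/-- The normalized density `Ω_pf`. -/
def Model.omega (M : Model) (t : ℝ) : ℝ := M.ρ t / (3 * M.hubble t ^ 2)

/-- The shear component `Σ_11` along the field strength. -/
def Model.shear (M : Model) (t : ℝ) : ℝ := M.normMoment 1 t - 1

/-- The frame-independent expression of `Σ_12² + Σ_13²`. -/
def Model.tilt (M : Model) (t : ℝ) : ℝ := M.normMoment 2 t - M.normMoment 1 t ^ 2

/-- The frame-independent expression of `(Σ_AB - (1/2) δ_AB Σ_CC) Σ_1A Σ_1B`, indices `A, B`
running over `2, 3`. -/
def Model.coupling (M : Model) (t : ℝ) : ℝ :=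
  M.normMoment 3 t - 3 * M.normMoment 2 t + 3 * M.normMoment 1 t - 1
    - M.shear t ^ 3 - 3 / 2 * M.shear t * M.tilt t

/-- The square of the trace-free part of `Σ_AB`, `A, B = 2, 3`, as given by the constraint. -/
def transverse (s w V W : ℝ) : ℝ := 6 * (1 - V - W) - 3 / 2 * s ^ 2 - 2 * w

lemma Model.normMoment_zero {M : Model} {t : ℝ} (h : M.moment 0 t ≠ 0) :
    M.normMoment 0 t = 1 := by
  rw [Model.normMoment, pow_zero, one_mul, div_self h]

lemma Model.moment_eq_normMoment {M : Model} {t : ℝ} (hH : M.hubble t ≠ 0)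
    (h : M.moment 0 t ≠ 0) (k : ℕ) :
    M.moment k t = M.hubble t ^ k * M.moment 0 t * M.normMoment k t := by
  rw [Model.normMoment, mul_div_cancel₀ _ (mul_ne_zero (pow_ne_zero k hH) h)]

/-! ### The state in an aligned frame -/

section SymmetricEntries

variable {A : Matrix (Fin 3) (Fin 3) ℝ}

lemma one_add_sq_apply_zero (hA : Aᵀ = A) :
    ((1 + A) ^ 2 : Matrix (Fin 3) (Fin 3) ℝ) 0 0
      = (1 + A 0 0) ^ 2 + A 0 1 ^ 2 + A 0 2 ^ 2 := by
  have h10 : A 1 0 = A 0 1 := congrFun₂ hA 0 1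
  have h20 : A 2 0 = A 0 2 := congrFun₂ hA 0 2
  rw [pow_two]
  simp [Matrix.mul_apply, Fin.sum_univ_three, h10, h20]
  ring

lemma one_add_cube_apply_zero (hA : Aᵀ = A) :
    ((1 + A) ^ 3 : Matrix (Fin 3) (Fin 3) ℝ) 0 0
      = (1 + A 0 0) ^ 3 + 2 * (1 + A 0 0) * (A 0 1 ^ 2 + A 0 2 ^ 2)
      + (1 + A 1 1) * A 0 1 ^ 2 + (1 + A 2 2) * A 0 2 ^ 2 + 2 * A 1 2 * A 0 1 * A 0 2 := by
  have h10 : A 1 0 = A 0 1 := congrFun₂ hA 0 1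
  have h20 : A 2 0 = A 0 2 := congrFun₂ hA 0 2
  have h21 : A 2 1 = A 1 2 := congrFun₂ hA 1 2
  rw [pow_succ, pow_two]
  simp [Matrix.mul_apply, Fin.sum_univ_three, h10, h20, h21]
  ring

lemma one_add_pow_four_apply_zero (hA : Aᵀ = A) :
    ((1 + A) ^ 4 : Matrix (Fin 3) (Fin 3) ℝ) 0 0
      = ((1 + A 0 0) ^ 2 + A 0 1 ^ 2 + A 0 2 ^ 2) ^ 2
      + ((1 + A 0 0) * A 0 1 + A 0 1 * (1 + A 1 1) + A 0 2 * A 1 2) ^ 2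
      + ((1 + A 0 0) * A 0 2 + A 0 1 * A 1 2 + A 0 2 * (1 + A 2 2)) ^ 2 := by
  have h10 : A 1 0 = A 0 1 := congrFun₂ hA 0 1
  have h20 : A 2 0 = A 0 2 := congrFun₂ hA 0 2
  have h21 : A 2 1 = A 1 2 := congrFun₂ hA 1 2
  rw [show 4 = 2 * 2 from rfl, pow_mul, pow_two, pow_two]
  simp [Matrix.mul_apply, Fin.sum_univ_three, h10, h20, h21]
  ring

lemma trace_mul_self_of_transpose_eq (hA : Aᵀ = A) :
    (A * A).trace = A 0 0 ^ 2 + A 1 1 ^ 2 + A 2 2 ^ 2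
      + 2 * (A 0 1 ^ 2 + A 0 2 ^ 2 + A 1 2 ^ 2) := by
  have h10 : A 1 0 = A 0 1 := congrFun₂ hA 0 1
  have h20 : A 2 0 = A 0 2 := congrFun₂ hA 0 2
  have h21 : A 2 1 = A 1 2 := congrFun₂ hA 1 2
  simp only [Matrix.trace_fin_three, Matrix.mul_apply, Fin.sum_univ_three, h10, h20, h21]
  ring

end SymmetricEntries

/-- The values of the normalized variables read off from the state in an aligned frame. -/
structure IsReadOff (S : State) (s w z V W : ℝ) : Prop where
  shear : S.1 0 0 = s
  tilt : S.1 0 1 ^ 2 + S.1 0 2 ^ 2 = w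
  coupling : (S.1 1 1 - S.1 2 2) / 2 * (S.1 0 1 ^ 2 - S.1 0 2 ^ 2)
    + 2 * S.1 1 2 * S.1 0 1 * S.1 0 2 = z
  transverse : (S.1 1 1 - S.1 2 2) ^ 2 / 2 + 2 * S.1 1 2 ^ 2 = transverse s w V W
  vSq : S.2.1 0 ^ 2 = V
  omega : S.2.2 = W

section Frame

variable {M : Model} {t : ℝ} {E : Matrix (Fin 3) (Fin 3) ℝ}

lemma frame_expansion_eq (hH : M.hubble t ≠ 0) :
    Eᵀ * M.expansion t * E = M.hubble t • (1 + (M.state t E).1) := by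
  simp [Model.state, hH]

lemma frame_expansion_transpose {I : Set ℝ} (hI : IsOpen I) (hg : ∀ t ∈ I, (M.g t).PosDef)
    (ht : t ∈ I) : (Eᵀ * M.expansion t * E)ᵀ = Eᵀ * M.expansion t * E := by
  simp [Matrix.transpose_mul, expansion_transpose hI hg ht, Matrix.mul_assoc]

lemma state_transpose {I : Set ℝ} (hI : IsOpen I) (hg : ∀ t ∈ I, (M.g t).PosDef) (ht : t ∈ I) :
    (M.state t E).1ᵀ = (M.state t E).1 := by
  simp only [Model.state, Matrix.transpose_sub, Matrix.transpose_smul, Matrix.transpose_one,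
    frame_expansion_transpose hI hg ht]

variable (hE : IsAlignedFrame M t E)
include hE

lemma moment_zero_pos : 0 < M.moment 0 t := by
  rw [hE.moment_eq, pow_zero, Matrix.one_apply_eq, mul_one]
  exact pow_pos hE.pos 2

variable (hH : M.hubble t ≠ 0)
include hH

lemma normMoment_eq (n : ℕ) : M.normMoment n t = ((1 + (M.state t E).1) ^ n) 0 0 := by
  have hv := hE.pos
  rw [Model.normMoment, hE.moment_eq, hE.moment_eq, frame_expansion_eq hH]
  simp only [smul_pow, Matrix.smul_apply, smul_eq_mul, pow_zero, Matrix.one_apply_eq]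
  field_simp

lemma state_trace : (M.state t E).1.trace = 0 := by
  have htrace := congrArg Matrix.trace (frame_expansion_eq (E := E) hH)
  rw [← hE.trace_mixed, Matrix.trace_smul, Matrix.trace_add, Matrix.trace_one, M.trace_mixed_eq,
    Fintype.card_fin, smul_eq_mul, Nat.cast_ofNat] at htrace
  refine (mul_eq_zero.1 (?_ : M.hubble t * (M.state t E).1.trace = 0)).resolve_left hH
  linear_combination -htrace

lemma state_vSq : (M.state t E).2.1 0 ^ 2 = M.vSq t := by
  rw [Model.vSq, hE.moment_eq]
  simp only [Model.state, Pi.smul_apply, smul_eq_mul, pow_zero, Matrix.one_apply_eq, mul_pow,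
    inv_pow, Real.sq_sqrt (show (0 : ℝ) ≤ 6 by norm_num)]
  field_simp

end Frame

section ReadOff

variable {γ : ℝ} {M : Model} {I : Set ℝ} (h : IsEvolution γ M I) (hI : IsOpen I)
  {t : ℝ} (ht : t ∈ I) (hH : M.hubble t ≠ 0) {E : Matrix (Fin 3) (Fin 3) ℝ}
  (hE : IsAlignedFrame M t E)
include h hI ht hH hE

lemma state_constraint : ((M.state t E).1 * (M.state t E).1).trace
    = 6 * (1 - M.vSq t - M.omega t) := by
  have hc := h.constraint hI ht
  rw [hE.trace_mixed_sq, frame_expansion_eq hH, M.trace_mixed_eq, ← M.moment_zero] at hc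
  simp only [Matrix.smul_mul, Matrix.mul_smul, Matrix.trace_smul, Matrix.add_mul, Matrix.mul_add,
    Matrix.trace_add, Matrix.one_mul, Matrix.mul_one, state_trace hE hH, smul_eq_mul,
    Matrix.trace_one, Fintype.card_fin, Nat.cast_ofNat] at hc
  rw [Model.vSq, Model.omega]
  field_simp
  linear_combination -3 * hc

lemma isReadOff_state : IsReadOff (M.state t E) (M.shear t) (M.tilt t) (M.coupling t)
    (M.vSq t) (M.omega t) := by
  have hsymm := state_transpose (E := E) hI h.posDef ht
  have htrace := state_trace hE hH
  rw [Matrix.trace_fin_three] at htrace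
  have hconstraint := state_constraint h hI ht hH hE
  rw [trace_mul_self_of_transpose_eq hsymm] at hconstraint
  have hone : M.normMoment 1 t = 1 + (M.state t E).1 0 0 := by
    rw [normMoment_eq hE hH, pow_one, Matrix.add_apply, Matrix.one_apply_eq]
  have hsq := normMoment_eq hE hH 2
  rw [one_add_sq_apply_zero hsymm] at hsq
  have hcube := normMoment_eq hE hH 3
  rw [one_add_cube_apply_zero hsymm] at hcube
  have hshear : M.shear t = (M.state t E).1 0 0 := by rw [Model.shear, hone]; ring
  have htilt : M.tilt t = (M.state t E).1 0 1 ^ 2 + (M.state t E).1 0 2 ^ 2 := by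
    rw [Model.tilt, hone, hsq]; ring
  refine ⟨hshear.symm, htilt.symm, ?_, ?_, state_vSq hE hH, rfl⟩
  · rw [Model.coupling, hshear, htilt, hone, hsq, hcube]
    linear_combination (-((M.state t E).1 0 1 ^ 2 + (M.state t E).1 0 2 ^ 2) / 2) * htrace
  · rw [BianchiI.transverse, hshear, htilt, ← hconstraint]
    linear_combination
      ((M.state t E).1 0 0 - (M.state t E).1 1 1 - (M.state t E).1 2 2) / 2 * htrace

/-- By Cayley-Hamilton the fourth moment is determined by the lower ones and the constraint, which
closes the system. -/
lemma normMoment_four : M.normMoment 4 t - 4 * M.normMoment 3 t + 6 * M.normMoment 2 t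
      - 4 * M.normMoment 1 t + 1
    = (M.shear t ^ 2 + M.tilt t) ^ 2 + M.shear t ^ 2 * M.tilt t / 4 + M.shear t * M.coupling t
      + transverse (M.shear t) (M.tilt t) (M.vSq t) (M.omega t) * M.tilt t / 2 := by
  have hsymm := state_transpose (E := E) hI h.posDef ht
  have hread := isReadOff_state h hI ht hH hE
  have htrace := state_trace hE hH
  rw [Matrix.trace_fin_three] at htrace
  have h22 : (M.state t E).1 2 2 = -(M.state t E).1 0 0 - (M.state t E).1 1 1 := by
    linear_combination htrace
  simp only [normMoment_eq hE hH, one_add_sq_apply_zero hsymm, one_add_cube_apply_zero hsymm,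
    one_add_pow_four_apply_zero hsymm, pow_one, Matrix.add_apply, Matrix.one_apply_eq]
  rw [← hread.transverse, ← hread.coupling, ← hread.shear, ← hread.tilt, h22]
  ring

omit hH in
lemma state_mem_stateSpace (hpos : 0 < M.hubble t) (hρ : 0 < M.ρ t) :
    M.state t E ∈ stateSpace := by
  have hfield := hE.pos
  have hV₁ : (M.state t E).2.1 1 = 0 := by simp [Model.state, hE.zero₁]
  have hV₂ : (M.state t E).2.1 2 = 0 := by simp [Model.state, hE.zero₂]
  refine ⟨state_transpose hI h.posDef ht, state_trace hE hpos.ne', ?_, hV₁, hV₂, ?_, ?_⟩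
  · simp only [Model.state, Pi.smul_apply, smul_eq_mul]
    positivity
  · simp only [Model.state]
    positivity
  · rw [state_constraint h hI ht hpos.ne' hE, Fin.sum_univ_three, hV₁, hV₂,
      state_vSq hE hpos.ne', Model.omega]
    simp only [Model.state]
    ring

end ReadOff

/-! ### The reduced dynamical system -/

/-- The deceleration parameter as a function of the normalized variables; `σ = (3γ - 2)/2`. -/
def decel (σ V W : ℝ) : ℝ := 2 - 2 * V - (2 - σ) * W

/-- The closed system obeyed by `Model.hubble` and the normalized variables `Model.shear`,
`Model.tilt`, `Model.coupling`, `Model.vSq` and `Model.omega` on a set of times, with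
`σ = (3γ - 2)/2`. -/
structure IsReducedFlow (σ : ℝ) (I : Set ℝ) (H s w z V W : ℝ → ℝ) : Prop where
  H_pos : ∀ t ∈ I, 0 < H t
  V_pos : ∀ t ∈ I, 0 < V t
  W_pos : ∀ t ∈ I, 0 < W t
  w_nonneg : ∀ t ∈ I, 0 ≤ w t
  y_nonneg : ∀ t ∈ I, 0 ≤ transverse (s t) (w t) (V t) (W t)
  z_sq_le : ∀ t ∈ I, z t ^ 2 ≤ transverse (s t) (w t) (V t) (W t) * w t ^ 2 / 2
  H_deriv : ∀ t ∈ I, HasDerivAt H (-(1 + decel σ (V t) (W t)) * H t ^ 2) t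
  s_deriv : ∀ t ∈ I, HasDerivAt s
    (H t * ((decel σ (V t) (W t) - 2) * s t + 4 * V t - 2 * w t)) t
  w_deriv : ∀ t ∈ I, HasDerivAt w
    (H t * (2 * (decel σ (V t) (W t) - 2 + 3 / 2 * s t) * w t - 2 * z t)) t
  z_deriv : ∀ t ∈ I, HasDerivAt z
    (H t * (3 * (decel σ (V t) (W t) - 2 + s t) * z t + w t ^ 2
      - transverse (s t) (w t) (V t) (W t) * w t)) t
  V_deriv : ∀ t ∈ I, HasDerivAt V (H t * (2 * (decel σ (V t) (W t) - s t) * V t)) t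
  W_deriv : ∀ t ∈ I, HasDerivAt W (H t * (2 * (decel σ (V t) (W t) - σ) * W t)) t

namespace IsEvolution

variable {γ : ℝ} {M : Model} {I : Set ℝ} (h : IsEvolution γ M I) (hI : IsOpen I)
  {t : ℝ} (ht : t ∈ I)
include h hI ht

lemma hasDerivAt_moment_zero :
    HasDerivAt (M.moment 0) (-2 * M.moment 1 t) t := by
  refine (h.hasDerivAt_moment hI ht 0).congr_deriv ?_
  rw [Finset.sum_range_zero, Nat.cast_zero]
  ring

variable (hH : M.hubble t ≠ 0)
include hH

lemma hasDerivAt_hubble : HasDerivAt M.hubble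
    (-(1 + decel ((3 * γ - 2) / 2) (M.vSq t) (M.omega t)) * M.hubble t ^ 2) t := by
  have htrace := (h.hasDerivAt_trace hI ht).div_const 3
  simp only [M.trace_mixed_eq, mul_div_cancel_left₀ _ (three_ne_zero (α := ℝ))] at htrace
  refine htrace.congr_deriv ?_
  rw [decel, Model.vSq, Model.omega, Model.moment_zero]
  field_simp
  ring

lemma hasDerivAt_omega : HasDerivAt M.omega (M.hubble t *
    (2 * (decel ((3 * γ - 2) / 2) (M.vSq t) (M.omega t) - (3 * γ - 2) / 2) * M.omega t)) t := by
  refine ((h.hasDerivAt_ρ hI ht).div (((h.hasDerivAt_hubble hI ht hH).pow 2).const_mul 3)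
    (by simpa using hH)).congr_deriv ?_
  rw [M.trace_mixed_eq, Model.omega, Pi.pow_apply]
  field_simp
  ring

variable (hJ : M.moment 0 t ≠ 0)
include hJ

lemma hasDerivAt_vSq : HasDerivAt M.vSq (M.hubble t *
    (2 * (decel ((3 * γ - 2) / 2) (M.vSq t) (M.omega t) - M.shear t) * M.vSq t)) t := by
  refine ((h.hasDerivAt_moment_zero hI ht).div
    (((h.hasDerivAt_hubble hI ht hH).pow 2).const_mul 6) (by simpa using hH)).congr_deriv ?_
  rw [Model.shear, Model.moment_eq_normMoment hH hJ 1, Pi.pow_apply]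
  generalize decel ((3 * γ - 2) / 2) (M.vSq t) (M.omega t) = q
  rw [Model.vSq]
  field_simp
  ring

lemma hasDerivAt_normMoment (n : ℕ) : HasDerivAt (M.normMoment n) (M.hubble t *
    ((n * (decel ((3 * γ - 2) / 2) (M.vSq t) (M.omega t) - 2) + 2 * M.normMoment 1 t)
        * M.normMoment n t
      + 6 * M.vSq t * ∑ k ∈ Finset.range n, M.normMoment k t * M.normMoment (n - 1 - k) t
      + n * ((2 - (3 * γ - 2) / 2) * M.omega t) * M.normMoment (n - 1) t
      - 2 * M.normMoment (n + 1) t)) t := by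
  have hsum : ∑ k ∈ Finset.range n, M.moment k t * M.moment (n - 1 - k) t
      = M.hubble t ^ (n - 1) * M.moment 0 t ^ 2
        * ∑ k ∈ Finset.range n, M.normMoment k t * M.normMoment (n - 1 - k) t := by
    rw [Finset.mul_sum]
    refine Finset.sum_congr rfl fun k hk => ?_
    have hpow : M.hubble t ^ (n - 1) = M.hubble t ^ k * M.hubble t ^ (n - 1 - k) :=
      (pow_mul_pow_sub _ (Nat.le_pred_of_lt (Finset.mem_range.1 hk))).symm
    rw [Model.moment_eq_normMoment hH hJ k, Model.moment_eq_normMoment hH hJ (n - 1 - k), hpow]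
    ring
  refine ((h.hasDerivAt_moment hI ht n).div (((h.hasDerivAt_hubble hI ht hH).pow n).mul
    (h.hasDerivAt_moment_zero hI ht)) (mul_ne_zero (pow_ne_zero n hH) hJ)).congr_deriv ?_
  simp only [Pi.mul_apply, Pi.pow_apply]
  rw [hsum, M.trace_mixed_eq, Model.moment_eq_normMoment hH hJ n,
    Model.moment_eq_normMoment hH hJ (n - 1), Model.moment_eq_normMoment hH hJ (n + 1),
    Model.moment_eq_normMoment hH hJ 1]
  generalize decel ((3 * γ - 2) / 2) (M.vSq t) (M.omega t) = q
  rw [Model.vSq, Model.omega]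
  cases n with
  | zero =>
    simp only [Finset.sum_range_zero, Nat.cast_zero]
    field_simp
    ring
  | succ n =>
    simp only [Nat.add_sub_cancel]
    field_simp
    ring

lemma hasDerivAt_shear : HasDerivAt M.shear (M.hubble t *
    ((decel ((3 * γ - 2) / 2) (M.vSq t) (M.omega t) - 2) * M.shear t + 4 * M.vSq t
      - 2 * M.tilt t)) t := by
  refine ((h.hasDerivAt_normMoment hI ht hH hJ 1).sub_const 1).congr_deriv ?_
  simp only [Finset.sum_range_succ, Finset.sum_range_zero, Nat.sub_self, Nat.cast_one,
    Model.normMoment_zero hJ, Model.shear, Model.tilt, decel]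
  ring

lemma hasDerivAt_tilt : HasDerivAt M.tilt (M.hubble t *
    (2 * (decel ((3 * γ - 2) / 2) (M.vSq t) (M.omega t) - 2 + 3 / 2 * M.shear t) * M.tilt t
      - 2 * M.coupling t)) t := by
  refine ((h.hasDerivAt_normMoment hI ht hH hJ 2).sub
    ((h.hasDerivAt_normMoment hI ht hH hJ 1).pow 2)).congr_deriv ?_
  simp only [Finset.sum_range_succ, Finset.sum_range_zero, Nat.sub_zero, Nat.sub_self,
    Nat.reduceSub, Nat.cast_one, Nat.cast_ofNat, Model.normMoment_zero hJ, Model.coupling,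
    Model.shear, Model.tilt, decel]
  ring

lemma hasDerivAt_coupling : HasDerivAt M.coupling (M.hubble t *
    (3 * (decel ((3 * γ - 2) / 2) (M.vSq t) (M.omega t) - 2 + M.shear t) * M.coupling t
      + M.tilt t ^ 2
      - transverse (M.shear t) (M.tilt t) (M.vSq t) (M.omega t) * M.tilt t)) t := by
  have hfield : M.spatialField t ≠ 0 := by
    intro hzero
    exact hJ (by simp [Model.moment, Model.form, hzero])
  obtain ⟨E, hE⟩ := exists_isAlignedFrame (h.posDef t ht) hfield
  have hfour := normMoment_four h hI ht hH hE
  have hshear := h.hasDerivAt_shear hI ht hH hJ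
  refine ((((((h.hasDerivAt_normMoment hI ht hH hJ 3).sub
    ((h.hasDerivAt_normMoment hI ht hH hJ 2).const_mul 3)).add
    ((h.hasDerivAt_normMoment hI ht hH hJ 1).const_mul 3)).sub_const 1).sub (hshear.pow 3)).sub
    ((hshear.const_mul (3 / 2)).mul (h.hasDerivAt_tilt hI ht hH hJ))).congr_deriv ?_
  simp only [Finset.sum_range_succ, Finset.sum_range_zero, Nat.sub_zero, Nat.sub_self,
    Nat.reduceSub, Nat.reduceAdd, Nat.cast_one, Nat.cast_ofNat, Model.normMoment_zero hJ,
    transverse, Model.coupling, Model.shear, Model.tilt, decel] at hfour ⊢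
  linear_combination (-2 * M.hubble t) * hfour

end IsEvolution

/-! ### Expanding solutions -/

lemma eq_mul_exp_of_hasDerivAt_mul {I : Set ℝ} (hI : IsOpen I) (hconn : I.OrdConnected)
    {A f : ℝ → ℝ} (hA : ContinuousOn A I) (hf : ∀ t ∈ I, HasDerivAt f (A t * f t) t)
    {t₀ t : ℝ} (ht₀ : t₀ ∈ I) (ht : t ∈ I) : f t = f t₀ * Real.exp (∫ s in t₀..t, A s) := by
  set B : ℝ → ℝ := fun u => ∫ s in t₀..u, A s
  have hB : ∀ u ∈ I, HasDerivAt B (A u) u := fun u hu =>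
    intervalIntegral.integral_hasDerivAt_right
      (hA.mono (hconn.uIcc_subset ht₀ hu)).intervalIntegrable
      (hA.stronglyMeasurableAtFilter hI u hu) (hA.continuousAt (hI.mem_nhds hu))
  have hderiv : ∀ u ∈ I, HasDerivAt (fun u => f u * Real.exp (-B u)) 0 u := fun u hu =>
    ((hf u hu).mul (hB u hu).neg.exp).congr_deriv (by ring)
  have hconst : f t * Real.exp (-B t) = f t₀ * Real.exp (-B t₀) :=
    hI.is_const_of_deriv_eq_zero hconn.isPreconnected
      (fun u hu => (hderiv u hu).differentiableAt.differentiableWithinAt)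
      (fun u hu => (hderiv u hu).deriv) ht ht₀
  have hB₀ : B t₀ = 0 := intervalIntegral.integral_same
  rw [hB₀, neg_zero, Real.exp_zero, mul_one] at hconst
  rw [← hconst, mul_assoc, ← Real.exp_add, neg_add_cancel, Real.exp_zero, mul_one]

lemma IsReadOff.coupling_sq_le {S : State} {s w z V W : ℝ} (h : IsReadOff S s w z V W) :
    z ^ 2 ≤ BianchiI.transverse s w V W * w ^ 2 / 2 := by
  rw [← h.transverse, ← h.coupling, ← h.tilt]
  linear_combination sq_nonneg ((S.1 1 1 - S.1 2 2) / 2 * (2 * S.1 0 1 * S.1 0 2)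
    - S.1 1 2 * (S.1 0 1 ^ 2 - S.1 0 2 ^ 2))

/-- The constraint expresses `H²` as a sum of squares and the positive matter terms. -/
lemma hubble_ne_zero {γ : ℝ} {M : Model} {I : Set ℝ} (h : IsEvolution γ M I) (hI : IsOpen I)
    {t : ℝ} (ht : t ∈ I) (hρ : 0 < M.ρ t) (hJ : M.spatialField t ≠ 0) : M.hubble t ≠ 0 := by
  intro hzero
  obtain ⟨E, hE⟩ := exists_isAlignedFrame (h.posDef t ht) hJ
  have hconstraint := h.constraint hI ht
  rw [hE.trace_mixed_sq, trace_mul_self_of_transpose_eq (frame_expansion_transpose hI h.posDef ht),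
    ← M.moment_zero, M.trace_mixed_eq, hzero] at hconstraint
  have hmoment := moment_zero_pos hE
  generalize Eᵀ * M.expansion t * E = A at hconstraint
  nlinarith [sq_nonneg (A 0 0), sq_nonneg (A 1 1), sq_nonneg (A 2 2), sq_nonneg (A 0 1),
    sq_nonneg (A 0 2), sq_nonneg (A 1 2)]

section Expanding

variable {γ : ℝ} {M : Model} {I : Set ℝ} (h : IsEvolution γ M I) (hI : IsOpen I)
  (hconn : I.OrdConnected) {t₀ : ℝ} (ht₀ : t₀ ∈ I) {t : ℝ} (ht : t ∈ I)
include h hI hconn ht₀ ht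

lemma spatialField_eq : M.spatialField t = M.spatialField t₀ := by
  ext i
  exact hI.is_const_of_deriv_eq_zero hconn.isPreconnected
    (fun s hs => (h.hasDerivAt_spatialField hI hs i).differentiableAt.differentiableWithinAt)
    (fun s hs => (h.hasDerivAt_spatialField hI hs i).deriv) ht ht₀

lemma ρ_pos (hρ : 0 < M.ρ t₀) : 0 < M.ρ t := by
  have hrate : ContinuousOn (fun s => -γ * (M.mixed s).trace) I := fun s hs =>
    ((h.hasDerivAt_trace hI hs).continuousAt.const_mul (-γ)).continuousWithinAt
  rw [eq_mul_exp_of_hasDerivAt_mul hI hconn hrate (fun s hs => h.hasDerivAt_ρ hI hs) ht₀ ht]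
  positivity

lemma hubble_pos (hH : 0 < M.hubble t₀) (hρ : 0 < M.ρ t₀) (hJ : M.spatialField t₀ ≠ 0) :
    0 < M.hubble t := by
  have hne : ∀ s ∈ I, M.hubble s ≠ 0 := fun s hs =>
    hubble_ne_zero h hI hs (ρ_pos h hI hconn ht₀ hs hρ)
      (by rwa [spatialField_eq h hI hconn ht₀ hs])
  have hcont : ContinuousOn M.hubble I := fun s hs =>
    (h.hasDerivAt_hubble hI hs (hne s hs)).continuousAt.continuousWithinAt
  by_contra! hneg
  obtain ⟨s, hs, hs₀⟩ := hconn.isPreconnected.intermediate_value ht ht₀ hcont ⟨hneg, hH.le⟩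
  exact hne s hs hs₀

omit ht in
lemma isReducedFlow (hH : 0 < M.hubble t₀) (hρ : 0 < M.ρ t₀) (hJ : M.spatialField t₀ ≠ 0) :
    IsReducedFlow ((3 * γ - 2) / 2) I M.hubble M.shear M.tilt M.coupling M.vSq M.omega := by
  have hubble_pos : ∀ t ∈ I, 0 < M.hubble t := fun t ht =>
    hubble_pos h hI hconn ht₀ ht hH hρ hJ
  have ρ_pos : ∀ t ∈ I, 0 < M.ρ t := fun t ht => ρ_pos h hI hconn ht₀ ht hρ
  have exists_frame : ∀ t ∈ I, ∃ E, IsAlignedFrame M t E := fun t ht =>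
    exists_isAlignedFrame (h.posDef t ht) (by rwa [spatialField_eq h hI hconn ht₀ ht])
  have moment_pos : ∀ t ∈ I, 0 < M.moment 0 t := fun t ht =>
    moment_zero_pos (exists_frame t ht).choose_spec
  have exists_readOff : ∀ t ∈ I, ∃ S : State,
      IsReadOff S (M.shear t) (M.tilt t) (M.coupling t) (M.vSq t) (M.omega t) := fun t ht =>
    ⟨_, isReadOff_state h hI ht (hubble_pos t ht).ne' (exists_frame t ht).choose_spec⟩
  exact {
    H_pos := hubble_pos
    V_pos := fun t ht => div_pos (moment_pos t ht) (by have := hubble_pos t ht; positivity)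
    W_pos := fun t ht => div_pos (ρ_pos t ht) (by have := hubble_pos t ht; positivity)
    w_nonneg := fun t ht => by
      obtain ⟨S, hS⟩ := exists_readOff t ht
      rw [← hS.tilt]
      positivity
    y_nonneg := fun t ht => by
      obtain ⟨S, hS⟩ := exists_readOff t ht
      rw [← hS.transverse]
      positivity
    z_sq_le := fun t ht => (exists_readOff t ht).choose_spec.coupling_sq_le
    H_deriv := fun t ht => h.hasDerivAt_hubble hI ht (hubble_pos t ht).ne'
    s_deriv := fun t ht =>
      h.hasDerivAt_shear hI ht (hubble_pos t ht).ne' (moment_pos t ht).ne'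
    w_deriv := fun t ht => h.hasDerivAt_tilt hI ht (hubble_pos t ht).ne' (moment_pos t ht).ne'
    z_deriv := fun t ht =>
      h.hasDerivAt_coupling hI ht (hubble_pos t ht).ne' (moment_pos t ht).ne'
    V_deriv := fun t ht => h.hasDerivAt_vSq hI ht (hubble_pos t ht).ne' (moment_pos t ht).ne'
    W_deriv := fun t ht => h.hasDerivAt_omega hI ht (hubble_pos t ht).ne' }

end Expanding

/-! ### Barbalat's lemma with a rescaled time -/

lemma le_of_hasDerivAt_nonneg {f f' : ℝ → ℝ} {a b : ℝ} (hab : a ≤ b)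
    (hf : ∀ t ∈ Icc a b, HasDerivAt f (f' t) t) (hnonneg : ∀ t ∈ Icc a b, 0 ≤ f' t) :
    f a ≤ f b :=
  monotoneOn_of_hasDerivWithinAt_nonneg (convex_Icc a b)
    (fun t ht => (hf t ht).continuousAt.continuousWithinAt)
    (fun t ht => (hf t (interior_subset ht)).hasDerivWithinAt)
    (fun t ht => hnonneg t (interior_subset ht)) (left_mem_Icc.2 hab) (right_mem_Icc.2 hab) hab

lemma mul_sub_le_sub_of_hasDerivAt {f f' τ τ' : ℝ → ℝ} {a b c : ℝ} (hab : a ≤ b)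
    (hf : ∀ t ∈ Icc a b, HasDerivAt f (f' t) t) (hτ : ∀ t ∈ Icc a b, HasDerivAt τ (τ' t) t)
    (hle : ∀ t ∈ Icc a b, c * τ' t ≤ f' t) : c * (τ b - τ a) ≤ f b - f a := by
  have hmono := le_of_hasDerivAt_nonneg (f := fun t => f t - c * τ t) hab
    (fun t ht => (hf t ht).sub ((hτ t ht).const_mul c)) (fun t ht => sub_nonneg.2 (hle t ht))
  linear_combination hmono

section Barbalat

variable {a C L : ℝ} {f F G H τ : ℝ → ℝ} (hf : ∀ t > a, HasDerivAt f (H t * F t) t)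
  (hF : ∀ t > a, HasDerivAt F (H t * G t) t) (hτ : ∀ t > a, HasDerivAt τ (H t) t)
  (hH : ∀ t > a, 0 < H t) (hG : ∀ t > a, |G t| ≤ C) (hτtop : Tendsto τ atTop atTop)
  (hfL : Tendsto f atTop (𝓝 L))
include hf hF hτ hH hG hτtop hfL

/-- Where `F t ≥ ε`, the bound on `G` keeps `F ≥ ε / 2` for a fixed amount of rescaled time, so that
`f` grows by a fixed amount, which is impossible at late times. -/
lemma eventually_lt_of_tendsto {ε : ℝ} (hε : 0 < ε) : ∀ᶠ t in atTop, F t < ε := by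
  set D := |C| + 1
  have hD : 0 < D := by positivity
  have hGD : ∀ t > a, -D ≤ G t := fun t ht => by
    linarith [(abs_le.1 (hG t ht)).1, le_abs_self C, show D = |C| + 1 from rfl]
  set δ := ε / (2 * D)
  have hδ : 0 < δ := by positivity
  have hDδ : D * δ = ε / 2 := by simp only [δ]; field_simp
  obtain ⟨N, hN⟩ := Metric.tendsto_atTop.1 hfL (ε * δ / 4) (by positivity)
  filter_upwards [eventually_ge_atTop N, eventually_gt_atTop a] with t htN hta
  by_contra! hFt
  obtain ⟨b, hτb, htb⟩ := ((hτtop.eventually_ge_atTop (τ t + δ)).and (eventually_ge_atTop t)).exists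
  obtain ⟨t₁, ⟨ht₁, -⟩, hτ₁⟩ := intermediate_value_Icc htb
    (fun u hu => (hτ u (hta.trans_le hu.1)).continuousAt.continuousWithinAt)
    (show τ t + δ ∈ Icc (τ t) (τ b) from ⟨by linarith, hτb⟩)
  have hFu : ∀ u ∈ Icc t t₁, ε / 2 ≤ F u := by
    intro u hu
    have hdrop := mul_sub_le_sub_of_hasDerivAt (c := -D) hu.1
      (fun x hx => hF x (hta.trans_le hx.1)) (fun x hx => hτ x (hta.trans_le hx.1))
      (fun x hx => by
        have hx' := hta.trans_le hx.1
        nlinarith [hGD x hx', hH x hx'])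
    have hτu : τ u ≤ τ t₁ := le_of_hasDerivAt_nonneg hu.2
      (fun x hx => hτ x (hta.trans_le (hu.1.trans hx.1)))
      (fun x hx => (hH x (hta.trans_le (hu.1.trans hx.1))).le)
    nlinarith
  have hgrowth := mul_sub_le_sub_of_hasDerivAt (c := ε / 2) ht₁
    (fun x hx => hf x (hta.trans_le hx.1)) (fun x hx => hτ x (hta.trans_le hx.1))
    (fun x hx => by nlinarith [hFu x hx, hH x (hta.trans_le hx.1)])
  have hclose := abs_lt.1 (Real.dist_eq _ _ ▸ hN t htN)
  have hclose₁ := abs_lt.1 (Real.dist_eq _ _ ▸ hN t₁ (htN.trans ht₁))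
  nlinarith

lemma tendsto_zero_of_tendsto : Tendsto F atTop (𝓝 0) := by
  rw [Metric.tendsto_nhds]
  intro ε hε
  have hupper := eventually_lt_of_tendsto hf hF hτ hH hG hτtop hfL hε
  have hlower := eventually_lt_of_tendsto (f := fun t => -f t) (F := fun t => -F t)
    (G := fun t => -G t) (fun t ht => (hf t ht).neg.congr_deriv (by ring))
    (fun t ht => (hF t ht).neg.congr_deriv (by ring)) hτ hH
    (fun t ht => by simpa only [abs_neg] using hG t ht) hτtop hfL.neg hε
  filter_upwards [hupper, hlower] with t hlt hgt
  rw [Real.dist_eq, sub_zero, abs_lt]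
  constructor <;> linarith

end Barbalat

/-! ### Bounds on the reduced state space -/

section Bounds

variable {s w V W : ℝ} (hV : 0 < V) (hW : 0 < W) (hw : 0 ≤ w) (hy : 0 ≤ transverse s w V W)
include hV hW hw hy

lemma reduced_bounds :
    s ^ 2 < 4 ∧ V < 1 ∧ W < 1 ∧ w < 3 ∧ transverse s w V W < 6 := by
  rw [transverse] at hy ⊢
  refine ⟨?_, ?_, ?_, ?_, ?_⟩ <;> nlinarith [sq_nonneg s]

lemma abs_shear_lt_two : |s| < 2 :=
  abs_lt_of_sq_lt_sq (by linarith [(reduced_bounds hV hW hw hy).1]) (by norm_num)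

lemma abs_coupling_le {z : ℝ} (hz : z ^ 2 ≤ transverse s w V W * w ^ 2 / 2) : |z| ≤ 6 := by
  obtain ⟨-, -, -, hw3, hy6⟩ := reduced_bounds hV hW hw hy
  have hwsq : w ^ 2 ≤ 9 := by nlinarith
  exact abs_le_of_sq_le_sq (by nlinarith) (by norm_num)

variable {σ : ℝ} (hσ : 0 < σ) (hσ2 : σ < 2)
include hσ hσ2

lemma denom_pos : 0 < 1 - σ * s / 4 := by
  nlinarith [abs_lt.1 (abs_shear_lt_two hV hW hw hy)]

lemma denom_lt_two : 1 - σ * s / 4 < 2 := by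
  nlinarith [abs_lt.1 (abs_shear_lt_two hV hW hw hy)]

lemma abs_decel_sub_two_le : |decel σ V W - 2| ≤ 4 := by
  obtain ⟨-, hV1, hW1, -, -⟩ := reduced_bounds hV hW hw hy
  rw [decel, abs_le]
  constructor <;> nlinarith

end Bounds

/-! ### The Lyapunov function -/

/-- A function that increases along the reduced flow if `σ ≤ 4 / 5`, that is, `γ ≤ 6 / 5`. -/
def lyapunov (σ s V W : ℝ) : ℝ :=
  σ * Real.log V + 2 * Real.log W - (4 + 2 * σ) * Real.log (1 - σ * s / 4)

/-- The value of `lyapunov` at the equilibrium, which is its maximum. -/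
def lyapunovMax (σ : ℝ) : ℝ := lyapunov σ σ (σ * (2 - σ) / 4) ((2 - σ) / 2)

/-- The rate of growth of `lyapunov` per unit of `∫ H dt`. -/
def lyapunovRate (σ s w V W : ℝ) : ℝ :=
  2 / (1 - σ * s / 4) * ((s - σ) ^ 2 + (4 - σ ^ 2) * transverse s w V W / 6
    + (2 + σ) * (4 - 5 * σ) / 6 * w)

lemma sq_sqrt_sub_one_le {x : ℝ} (hx : 0 < x) : (√x - 1) ^ 2 ≤ x - 1 - Real.log x := by
  have hlog := Real.log_le_sub_one_of_pos (Real.sqrt_pos.2 hx)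
  rw [Real.log_sqrt hx.le] at hlog
  linear_combination 2 * hlog + Real.sq_sqrt hx.le

lemma log_mul_sq_div {x y c d : ℝ} (hx : 0 < x) (hy : 0 < y) (hc : 0 < c) (hd : 0 < d) :
    Real.log (x * c ^ 2 / (y * d ^ 2))
      = Real.log x + 2 * Real.log c - Real.log y - 2 * Real.log d := by
  rw [Real.log_div (by positivity) (by positivity), Real.log_mul hx.ne' (by positivity),
    Real.log_mul hy.ne' (by positivity), Real.log_pow, Real.log_pow]
  push_cast
  ring

section ReducedState

variable {σ : ℝ} (hσ : 0 < σ) {s w V W : ℝ} (hV : 0 < V) (hW : 0 < W) (hw : 0 ≤ w)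
  (hy : 0 ≤ transverse s w V W)
include hσ hV hW hw hy

/-- In terms of the ratios `A`, `B` of `V`, `Ω`, each divided by the square of `1 - σ Σ_11 / 4`, to
their equilibrium values, the gap is `-σ log A - 2 log B`, while the constraint bounds
`σ (A - 1) + 2 (B - 1)`; hence `log x ≤ x - 1` gives the claim. -/
lemma lyapunov_gap (hσ2 : σ < 2) :
    (2 + σ) / (4 * (1 - σ * s / 4) ^ 2) * ((s - σ) ^ 2
        + (4 - σ ^ 2) * (w / 3 + transverse s w V W / 6))
      + 2 * (√(W * (1 - σ * σ / 4) ^ 2 / ((2 - σ) / 2 * (1 - σ * s / 4) ^ 2)) - 1) ^ 2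
      ≤ lyapunovMax σ - lyapunov σ s V W := by
  have hD := denom_pos hV hW hw hy hσ hσ2
  have hD₀ : 0 < 1 - σ * σ / 4 := by nlinarith
  have hsub : 0 < 2 - σ := by linarith
  have hV₀ : 0 < σ * (2 - σ) / 4 := by positivity
  have hW₀ : 0 < (2 - σ) / 2 := by positivity
  set D := 1 - σ * s / 4 with hDdef
  set D₀ := 1 - σ * σ / 4 with hD₀def
  have hgap : lyapunovMax σ - lyapunov σ s V W
      = -σ * Real.log (V * D₀ ^ 2 / (σ * (2 - σ) / 4 * D ^ 2))
        - 2 * Real.log (W * D₀ ^ 2 / ((2 - σ) / 2 * D ^ 2)) := by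
    rw [log_mul_sq_div hV hV₀ hD₀ hD, log_mul_sq_div hW hW₀ hD₀ hD, lyapunovMax, lyapunov,
      lyapunov, ← hDdef, ← hD₀def]
    ring
  have hsum : σ * (V * D₀ ^ 2 / (σ * (2 - σ) / 4 * D ^ 2) - 1)
        + 2 * (W * D₀ ^ 2 / ((2 - σ) / 2 * D ^ 2) - 1)
      = -((2 + σ) / (4 * D ^ 2) * ((s - σ) ^ 2
        + (4 - σ ^ 2) * (w / 3 + transverse s w V W / 6))) := by
    rw [transverse]
    field_simp
    rw [hDdef, hD₀def]
    ring
  have hlogV := Real.log_le_sub_one_of_pos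
    (show 0 < V * D₀ ^ 2 / (σ * (2 - σ) / 4 * D ^ 2) by positivity)
  have hlogW := sq_sqrt_sub_one_le (show 0 < W * D₀ ^ 2 / ((2 - σ) / 2 * D ^ 2) by positivity)
  rw [hgap]
  linear_combination hsum + σ * hlogV + 2 * hlogW

lemma lyapunov_le (hσ2 : σ < 2) :
    lyapunov σ s V W ≤ lyapunovMax σ := by
  have hfour : 0 ≤ 4 - σ ^ 2 := by nlinarith
  exact sub_nonneg.1 (le_trans (by positivity) (lyapunov_gap hσ hV hW hw hy hσ2))

lemma sq_sub_add_le_lyapunovMax_sub (hσ2 : σ < 2) :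
    (s - σ) ^ 2 + (4 - σ ^ 2) * (w / 3 + transverse s w V W / 6)
      ≤ 16 / (2 + σ) * (lyapunovMax σ - lyapunov σ s V W) := by
  have hD := denom_pos hV hW hw hy hσ hσ2
  have hD2 := denom_lt_two hV hW hw hy hσ hσ2
  have hfour : 0 ≤ 4 - σ ^ 2 := by nlinarith
  have hcoeff : (2 + σ) / 16 ≤ (2 + σ) / (4 * (1 - σ * s / 4) ^ 2) :=
    div_le_div_of_nonneg_left (by positivity) (by positivity) (by nlinarith)
  have hgap := (le_add_of_nonneg_right (by positivity)).trans (lyapunov_gap hσ hV hW hw hy hσ2)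
  rw [div_mul_eq_mul_div, le_div_iff₀ (by positivity)]
  linarith [(mul_le_mul_of_nonneg_right hcoeff (show 0 ≤ (s - σ) ^ 2
    + (4 - σ ^ 2) * (w / 3 + transverse s w V W / 6) by positivity)).trans hgap]

lemma sq_sqrt_omega_ratio_sub_one_le (hσ2 : σ < 2) :
    (√(W * (1 - σ * σ / 4) ^ 2 / ((2 - σ) / 2 * (1 - σ * s / 4) ^ 2)) - 1) ^ 2
      ≤ lyapunovMax σ - lyapunov σ s V W := by
  have hfour : 0 ≤ 4 - σ ^ 2 := by nlinarith
  have hgap := (le_add_of_nonneg_left (by positivity)).trans (lyapunov_gap hσ hV hW hw hy hσ2)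
  linarith [sq_nonneg (√(W * (1 - σ * σ / 4) ^ 2 / ((2 - σ) / 2 * (1 - σ * s / 4) ^ 2)) - 1)]

lemma le_lyapunovRate (hσ45 : σ ≤ 4 / 5) :
    (s - σ) ^ 2 + (4 - σ ^ 2) * transverse s w V W / 6 ≤ lyapunovRate σ s w V W := by
  have hfactor : 1 ≤ 2 / (1 - σ * s / 4) :=
    (one_le_div (denom_pos hV hW hw hy hσ (by linarith))).2
      (denom_lt_two hV hW hw hy hσ (by linarith)).le
  have htilt : 0 ≤ (2 + σ) * (4 - 5 * σ) / 6 * w := by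
    have : 0 ≤ 4 - 5 * σ := by linarith
    positivity
  have hrest : 0 ≤ (s - σ) ^ 2 + (4 - σ ^ 2) * transverse s w V W / 6 := by
    have : 0 ≤ 4 - σ ^ 2 := by nlinarith
    positivity
  exact (le_add_of_nonneg_right htilt).trans
    (le_mul_of_one_le_left (add_nonneg hrest htilt) hfactor)

lemma lyapunovRate_nonneg (hσ45 : σ ≤ 4 / 5) : 0 ≤ lyapunovRate σ s w V W := by
  have : 0 ≤ 4 - σ ^ 2 := by nlinarith
  exact le_trans (by positivity) (le_lyapunovRate hσ hV hW hw hy hσ45)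

end ReducedState

/-! ### Convergence of the reduced flow -/

/-- The vector field of the reduced system, in the variables `(s, w, z, V, W)`. -/
def reducedField (σ : ℝ) (x : Fin 5 → ℝ) : Fin 5 → ℝ :=
  ![(decel σ (x 3) (x 4) - 2) * x 0 + 4 * x 3 - 2 * x 1,
    2 * (decel σ (x 3) (x 4) - 2 + 3 / 2 * x 0) * x 1 - 2 * x 2,
    3 * (decel σ (x 3) (x 4) - 2 + x 0) * x 2 + x 1 ^ 2
      - transverse (x 0) (x 1) (x 3) (x 4) * x 1,
    2 * (decel σ (x 3) (x 4) - x 0) * x 3,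
    2 * (decel σ (x 3) (x 4) - σ) * x 4]

lemma continuous_reducedField (σ : ℝ) : Continuous (reducedField σ) := by
  refine continuous_pi fun i => ?_
  fin_cases i <;>
    simp only [reducedField, decel, transverse, Fin.zero_eta, Fin.mk_one, Fin.reduceFinMk,
      Matrix.cons_val] <;>
    fun_prop

lemma tendsto_zero_of_sq_le {ι : Type*} {l : Filter ι} {f g : ι → ℝ}
    (hfg : ∀ᶠ i in l, f i ^ 2 ≤ g i) (hg : Tendsto g l (𝓝 0)) : Tendsto f l (𝓝 0) := by
  refine squeeze_zero_norm' (hfg.mono fun i hi => Real.abs_le_sqrt hi) ?_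
  simpa using hg.sqrt

lemma tendsto_atTop_of_inv_deriv_le {τ H : ℝ → ℝ} {b c k : ℝ} (hc : 0 < c) (hk : 0 < k)
    (hτ : ∀ t ≥ b, HasDerivAt τ (H t) t) (hH : ∀ t ≥ b, 0 < H t)
    (hinv : ∀ t ≥ b, (H t)⁻¹ ≤ c + k * (t - b)) : Tendsto τ atTop atTop := by
  have hpos : ∀ t ≥ b, 0 < c + k * (t - b) := fun t ht =>
    add_pos_of_pos_of_nonneg hc (mul_nonneg hk.le (sub_nonneg.2 ht))
  have hlog : ∀ t ≥ b,
      HasDerivAt (fun u => Real.log (c + k * (u - b))) (k / (c + k * (t - b))) t := fun t ht =>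
    (((((hasDerivAt_id t).sub_const b).const_mul k).const_add c).log (hpos t ht).ne').congr_deriv
      (by rw [mul_one, id])
  have hlower : ∀ t ≥ b,
      τ b + k⁻¹ * (Real.log (c + k * (t - b)) - Real.log (c + k * (b - b))) ≤ τ t := by
    intro t ht
    have hgrowth := mul_sub_le_sub_of_hasDerivAt (c := k⁻¹) ht (fun u hu => hτ u hu.1)
      (fun u hu => hlog u hu.1) (fun u hu => by
        rw [mul_div_assoc', inv_mul_cancel₀ hk.ne', one_div,
          inv_le_comm₀ (hpos u hu.1) (hH u hu.1)]
        exact hinv u hu.1)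
    linarith
  refine tendsto_atTop_mono' _ ((eventually_ge_atTop b).mono hlower) ?_
  refine tendsto_atTop_add_const_left _ _ (Tendsto.const_mul_atTop (inv_pos.2 hk) ?_)
  refine tendsto_atTop_add_const_right _ _ (Real.tendsto_log_atTop.comp ?_)
  refine tendsto_atTop_add_const_left _ _ (Tendsto.const_mul_atTop hk ?_)
  exact tendsto_atTop_add_const_right _ _ tendsto_id

/-- A box containing all values of `(s, w, z, V, W)` along reduced flows; its compactness provides
the bounds needed for Barbalat's lemma. -/
def reducedBox : Set (Fin 5 → ℝ) := Icc ![-2, 0, -6, 0, 0] ![2, 3, 6, 1, 1]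

namespace IsReducedFlow

variable {σ a : ℝ} {H s w z V W : ℝ → ℝ} (h : IsReducedFlow σ (Ioi a) H s w z V W)
include h

section Pointwise

variable {t : ℝ} (ht : a < t)
include ht

lemma bounds : s t ^ 2 < 4 ∧ V t < 1 ∧ W t < 1 ∧ w t < 3 ∧
    transverse (s t) (w t) (V t) (W t) < 6 :=
  reduced_bounds (h.V_pos t ht) (h.W_pos t ht) (h.w_nonneg t ht) (h.y_nonneg t ht)

lemma hasDerivAt_point : HasDerivAt (fun t => ![s t, w t, z t, V t, W t])
    (H t • reducedField σ ![s t, w t, z t, V t, W t]) t := by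
  rw [hasDerivAt_pi]
  intro i
  fin_cases i
  · exact h.s_deriv t ht
  · exact h.w_deriv t ht
  · exact h.z_deriv t ht
  · exact h.V_deriv t ht
  · exact h.W_deriv t ht

lemma point_mem_reducedBox : ![s t, w t, z t, V t, W t] ∈ reducedBox := by
  obtain ⟨-, hV1, hW1, hw3, -⟩ := h.bounds ht
  have hs := abs_lt.1 (abs_shear_lt_two (h.V_pos t ht) (h.W_pos t ht) (h.w_nonneg t ht)
    (h.y_nonneg t ht))
  have hz := abs_le.1 (abs_coupling_le (h.V_pos t ht) (h.W_pos t ht) (h.w_nonneg t ht)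
    (h.y_nonneg t ht) (h.z_sq_le t ht))
  constructor <;> intro i <;> fin_cases i
  exacts [hs.1.le, h.w_nonneg t ht, hz.1, (h.V_pos t ht).le, (h.W_pos t ht).le,
    hs.2.le, hw3.le, hz.2, hV1.le, hW1.le]

lemma hasDerivAt_lyapunov (hσ : 0 < σ) (hσ2 : σ < 2) :
    HasDerivAt (fun t => lyapunov σ (s t) (V t) (W t))
      (H t * lyapunovRate σ (s t) (w t) (V t) (W t)) t := by
  have hV := h.V_pos t ht
  have hW := h.W_pos t ht
  have hD := denom_pos hV hW (h.w_nonneg t ht) (h.y_nonneg t ht) hσ hσ2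
  refine (((((h.V_deriv t ht).log hV.ne').const_mul σ).add
    (((h.W_deriv t ht).log hW.ne').const_mul 2)).sub
    (((((h.s_deriv t ht).const_mul σ).div_const 4).const_sub 1).log hD.ne'
      |>.const_mul (4 + 2 * σ))).congr_deriv ?_
  have hne : 4 - σ * s t ≠ 0 := by linarith
  rw [lyapunovRate, transverse, decel]
  field_simp
  ring

/-- The evolution equations of `Ω` and `H` combine so that `q` cancels. -/
lemma hasDerivAt_rescaledTime (hσ : 0 < σ) :
    HasDerivAt (fun t => -(Real.log (W t) + 2 * Real.log (H t)) / (2 * (1 + σ))) (H t) t := by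
  have hW := h.W_pos t ht
  have hH := h.H_pos t ht
  refine ((((h.W_deriv t ht).log hW.ne').add
    (((h.H_deriv t ht).log hH.ne').const_mul 2)).neg.div_const (2 * (1 + σ))).congr_deriv ?_
  field_simp
  ring

omit ht in
lemma inv_hubble_le (hσ2 : σ < 2) {b : ℝ} (hb : a < b) (hbt : b ≤ t) :
    (H t)⁻¹ ≤ (H b)⁻¹ + 3 * (t - b) := by
  have hderiv : ∀ u ∈ Icc b t, HasDerivAt (fun u => -(H u)⁻¹)
      (-(1 + decel σ (V u) (W u))) u := by
    intro u hu
    have hH := h.H_pos u (hb.trans_le hu.1)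
    refine ((h.H_deriv u (hb.trans_le hu.1)).inv hH.ne').neg.congr_deriv ?_
    field_simp
  have hgrowth := mul_sub_le_sub_of_hasDerivAt (c := -3) hbt hderiv (fun u _ => hasDerivAt_id u)
    (fun u hu => by
      have hV := h.V_pos u (hb.trans_le hu.1)
      have hW := mul_pos (sub_pos.2 hσ2) (h.W_pos u (hb.trans_le hu.1))
      rw [decel]
      linarith)
  simp only [id] at hgrowth
  linarith

end Pointwise

lemma exists_rescaledTime (hσ : 0 < σ) (hσ2 : σ < 2) :
    ∃ τ : ℝ → ℝ, (∀ t > a, HasDerivAt τ (H t) t) ∧ Tendsto τ atTop atTop := by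
  refine ⟨_, fun t ht => h.hasDerivAt_rescaledTime ht hσ, ?_⟩
  have hafter : ∀ t ≥ a + 1, a < t := fun t ht => (lt_add_one a).trans_le ht
  exact tendsto_atTop_of_inv_deriv_le (inv_pos.2 (h.H_pos _ (lt_add_one a))) three_pos
    (fun t ht => h.hasDerivAt_rescaledTime (hafter t ht) hσ)
    (fun t ht => h.H_pos t (hafter t ht))
    (fun t ht => h.inv_hubble_le hσ2 (lt_add_one a) ht)

lemma tendsto_rate_zero (hσ : 0 < σ) (hσ2 : σ < 2) {Ψ : (Fin 5 → ℝ) → ℝ}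
    (hΨ : ContDiffOn ℝ 1 Ψ {x | 0 < 1 - σ * x 0 / 4}) {f : ℝ → ℝ} {L : ℝ}
    (hf : ∀ t > a, HasDerivAt f (H t * Ψ ![s t, w t, z t, V t, W t]) t)
    (hL : Tendsto f atTop (𝓝 L)) :
    Tendsto (fun t => Ψ ![s t, w t, z t, V t, W t]) atTop (𝓝 0) := by
  have hopen : IsOpen {x : Fin 5 → ℝ | 0 < 1 - σ * x 0 / 4} :=
    isOpen_lt continuous_const (by fun_prop)
  have hbox : reducedBox ⊆ {x | 0 < 1 - σ * x 0 / 4} := by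
    intro x hx
    have hx0 : x 0 ≤ 2 := hx.2 0
    simp only [mem_ofPred_eq]
    nlinarith
  obtain ⟨τ, hτ, hτtop⟩ := h.exists_rescaledTime hσ hσ2
  have hcont : ContinuousOn (fun x => fderiv ℝ Ψ x (reducedField σ x)) reducedBox :=
    ((hΨ.continuousOn_fderiv_of_isOpen hopen le_rfl).mono hbox).clm_apply
      (continuous_reducedField σ).continuousOn
  obtain ⟨C, hC⟩ := isCompact_Icc.exists_bound_of_continuousOn hcont
  refine tendsto_zero_of_tendsto (H := H) (C := C) hf
    (G := fun t => fderiv ℝ Ψ ![s t, w t, z t, V t, W t]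
      (reducedField σ ![s t, w t, z t, V t, W t])) (fun t ht => ?_) hτ h.H_pos
    (fun t ht => hC _ (h.point_mem_reducedBox ht)) hτtop hL
  have hΨderiv := ((hΨ.differentiableOn one_ne_zero).differentiableAt
    (hopen.mem_nhds (hbox (h.point_mem_reducedBox ht)))).hasFDerivAt
  refine (hΨderiv.comp_hasDerivAt t (h.hasDerivAt_point ht)).congr_deriv ?_
  rw [map_smul, smul_eq_mul]

variable (hσ : 0 < σ) (hσ45 : σ ≤ 4 / 5)
include hσ hσ45

lemma lyapunov_mono {t₁ t₂ : ℝ} (ht₁ : a < t₁) (ht : t₁ ≤ t₂) :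
    lyapunov σ (s t₁) (V t₁) (W t₁) ≤ lyapunov σ (s t₂) (V t₂) (W t₂) :=
  le_of_hasDerivAt_nonneg ht
    (fun t ht => h.hasDerivAt_lyapunov (ht₁.trans_le ht.1) hσ (by linarith)) fun t ht => by
      have hat := ht₁.trans_le ht.1
      exact mul_nonneg (h.H_pos t hat).le (lyapunovRate_nonneg hσ (h.V_pos t hat) (h.W_pos t hat)
        (h.w_nonneg t hat) (h.y_nonneg t hat) hσ45)

lemma exists_tendsto_lyapunov :
    ∃ L, Tendsto (fun t => lyapunov σ (s t) (V t) (W t)) atTop (𝓝 L) := by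
  have hafter : ∀ t, a < max t (a + 1) := fun t => (lt_add_one a).trans_le (le_max_right _ _)
  have hmono : Monotone fun t => lyapunov σ (s (max t (a + 1))) (V (max t (a + 1)))
      (W (max t (a + 1))) := fun t₁ t₂ ht =>
    h.lyapunov_mono hσ hσ45 (hafter t₁) (max_le_max_right _ ht)
  have hbdd : BddAbove (range fun t => lyapunov σ (s (max t (a + 1))) (V (max t (a + 1)))
      (W (max t (a + 1)))) := by
    refine ⟨lyapunovMax σ, ?_⟩
    rintro _ ⟨t, rfl⟩
    exact lyapunov_le hσ (h.V_pos _ (hafter t)) (h.W_pos _ (hafter t)) (h.w_nonneg _ (hafter t))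
      (h.y_nonneg _ (hafter t)) (by linarith)
  refine ⟨_, (tendsto_atTop_ciSup hmono hbdd).congr' ?_⟩
  filter_upwards [eventually_ge_atTop (a + 1)] with t ht
  rw [max_eq_left ht]

lemma tendsto_lyapunovRate :
    Tendsto (fun t => lyapunovRate σ (s t) (w t) (V t) (W t)) atTop (𝓝 0) := by
  obtain ⟨L, hL⟩ := h.exists_tendsto_lyapunov hσ hσ45
  refine h.tendsto_rate_zero hσ (by linarith)
    (Ψ := fun x => lyapunovRate σ (x 0) (x 1) (x 3) (x 4)) ?_
    (fun t ht => h.hasDerivAt_lyapunov ht hσ (by linarith)) hL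
  unfold lyapunovRate transverse
  exact (contDiffOn_const.div (by fun_prop) fun x hx => ne_of_gt hx).mul (by fun_prop)

lemma eventually_le_lyapunovRate : ∀ᶠ t in atTop,
    (s t - σ) ^ 2 + (4 - σ ^ 2) * transverse (s t) (w t) (V t) (W t) / 6
      ≤ lyapunovRate σ (s t) (w t) (V t) (W t) :=
  (eventually_gt_atTop a).mono fun t ht => le_lyapunovRate hσ (h.V_pos t ht) (h.W_pos t ht)
    (h.w_nonneg t ht) (h.y_nonneg t ht) hσ45

lemma tendsto_shear : Tendsto s atTop (𝓝 σ) := by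
  refine tendsto_sub_nhds_zero_iff.1
    (tendsto_zero_of_sq_le ?_ (h.tendsto_lyapunovRate hσ hσ45))
  filter_upwards [eventually_gt_atTop a, h.eventually_le_lyapunovRate hσ hσ45] with t ht hrate
  have hy := h.y_nonneg t ht
  have hfour : 0 ≤ 4 - σ ^ 2 := by nlinarith
  exact le_trans (le_add_of_nonneg_right (by positivity)) hrate

lemma tendsto_transverse :
    Tendsto (fun t => transverse (s t) (w t) (V t) (W t)) atTop (𝓝 0) := by
  have hfour : 0 < 4 - σ ^ 2 := by nlinarith
  have hbound := (h.tendsto_lyapunovRate hσ hσ45).const_mul (6 / (4 - σ ^ 2))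
  rw [mul_zero] at hbound
  refine squeeze_zero' ((eventually_gt_atTop a).mono h.y_nonneg) ?_ hbound
  filter_upwards [h.eventually_le_lyapunovRate hσ hσ45] with t hrate
  rw [div_mul_eq_mul_div, le_div_iff₀ hfour]
  linarith [sq_nonneg (s t - σ)]

lemma tendsto_coupling : Tendsto z atTop (𝓝 0) := by
  have hbound := (h.tendsto_transverse hσ hσ45).const_mul (9 / 2)
  rw [mul_zero] at hbound
  refine tendsto_zero_of_sq_le ?_ hbound
  filter_upwards [eventually_gt_atTop a] with t ht
  have hz := h.z_sq_le t ht
  have hw : w t ^ 2 ≤ 9 := by nlinarith [h.w_nonneg t ht, (h.bounds ht).2.2.2.1]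
  linarith [mul_le_mul_of_nonneg_left hw (h.y_nonneg t ht)]

/-- Barbalat applied to `z → 0` gives `z' / H → 0`, in which `w²` is the only term not already known
to vanish in the limit. -/
lemma tendsto_tilt : Tendsto w atTop (𝓝 0) := by
  have hrate : Tendsto (fun t => 3 * (decel σ (V t) (W t) - 2 + s t) * z t + w t ^ 2
      - transverse (s t) (w t) (V t) (W t) * w t) atTop (𝓝 0) := by
    refine h.tendsto_rate_zero hσ (by linarith)
      (Ψ := fun x => 3 * (decel σ (x 3) (x 4) - 2 + x 0) * x 2 + x 1 ^ 2
        - transverse (x 0) (x 1) (x 3) (x 4) * x 1) ?_ h.z_deriv (h.tendsto_coupling hσ hσ45)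
    unfold decel transverse
    fun_prop
  have hfactor : IsBoundedUnder (· ≤ ·) atTop
      ((‖·‖) ∘ fun t => 3 * (decel σ (V t) (W t) - 2 + s t)) := by
    refine isBoundedUnder_of_eventually_le (a := 18) ?_
    filter_upwards [eventually_gt_atTop a] with t ht
    have hq := abs_le.1 (abs_decel_sub_two_le (h.V_pos t ht) (h.W_pos t ht) (h.w_nonneg t ht)
      (h.y_nonneg t ht) hσ (by linarith))
    have hs := abs_lt.1 (abs_shear_lt_two (h.V_pos t ht) (h.W_pos t ht) (h.w_nonneg t ht)
      (h.y_nonneg t ht))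
    rw [Function.comp_apply, Real.norm_eq_abs, abs_le]
    constructor <;> linarith
  have hwbdd : IsBoundedUnder (· ≤ ·) atTop ((‖·‖) ∘ w) := by
    refine isBoundedUnder_of_eventually_le (a := 3) ?_
    filter_upwards [eventually_gt_atTop a] with t ht
    rw [Function.comp_apply, Real.norm_of_nonneg (h.w_nonneg t ht)]
    exact (h.bounds ht).2.2.2.1.le
  have hsq := (hrate.sub ((h.tendsto_coupling hσ hσ45).zero_mul_isBoundedUnder_le hfactor)).add
    ((h.tendsto_transverse hσ hσ45).zero_mul_isBoundedUnder_le hwbdd)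
  rw [sub_zero, add_zero] at hsq
  exact tendsto_zero_of_sq_le (Eventually.of_forall fun t => by linarith) hsq

lemma tendsto_vSq_add_omega : Tendsto (fun t => V t + W t) atTop (𝓝 (1 - σ ^ 2 / 4)) := by
  have hlim := (((((h.tendsto_shear hσ hσ45).pow 2).const_mul (1 / 4)).add
    ((h.tendsto_tilt hσ hσ45).const_mul (1 / 3))).add
    ((h.tendsto_transverse hσ hσ45).const_mul (1 / 6))).const_sub 1
  refine (hlim.congr fun t => ?_).trans_eq (by congr 1; ring)
  rw [transverse]
  ring

/-- Barbalat applied to `s → σ` gives a second linear relation between the limits of `V` and `W`,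
besides the constraint. -/
lemma tendsto_omega : Tendsto W atTop (𝓝 ((2 - σ) / 2)) := by
  have hs := h.tendsto_shear hσ hσ45
  have hrate : Tendsto (fun t => (decel σ (V t) (W t) - 2) * s t + 4 * V t - 2 * w t) atTop
      (𝓝 0) := by
    refine h.tendsto_rate_zero hσ (by linarith)
      (Ψ := fun x => (decel σ (x 3) (x 4) - 2) * x 0 + 4 * x 3 - 2 * x 1) ?_ h.s_deriv hs
    unfold decel
    fun_prop
  have hq : IsBoundedUnder (· ≤ ·) atTop ((‖·‖) ∘ fun t => decel σ (V t) (W t) - 2) :=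
    isBoundedUnder_of_eventually_le (a := 4) <| (eventually_gt_atTop a).mono fun t ht =>
      abs_decel_sub_two_le (h.V_pos t ht) (h.W_pos t ht) (h.w_nonneg t ht) (h.y_nonneg t ht) hσ
        (by linarith)
  have hshear := (tendsto_sub_nhds_zero_iff.2 hs).zero_mul_isBoundedUnder_le hq
  have hlim := (((h.tendsto_vSq_add_omega hσ hσ45).const_mul (4 - 2 * σ)).sub
    ((hrate.sub hshear).add ((h.tendsto_tilt hσ hσ45).const_mul 2))).const_mul (1 / (4 - σ ^ 2))
  have hfour : 4 - σ ^ 2 ≠ 0 := by nlinarith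
  refine (hlim.congr fun t => ?_).trans_eq ?_
  · rw [decel]
    field_simp
    ring
  · congr 1
    field_simp
    ring

end IsReducedFlow

/-! ### Convergence of states -/

lemma isReadOff_of_mem_stateSpace {S : State} (hS : S ∈ stateSpace) :
    IsReadOff S (S.1 0 0) (S.1 0 1 ^ 2 + S.1 0 2 ^ 2)
      ((S.1 1 1 - S.1 2 2) / 2 * (S.1 0 1 ^ 2 - S.1 0 2 ^ 2) + 2 * S.1 1 2 * S.1 0 1 * S.1 0 2)
      (S.2.1 0 ^ 2) S.2.2 := by
  obtain ⟨hsymm, htrace, -, hV₁, hV₂, -, hconstraint⟩ := hS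
  refine ⟨rfl, rfl, rfl, ?_, rfl, rfl⟩
  rw [trace_mul_self_of_transpose_eq hsymm, Fin.sum_univ_three, hV₁, hV₂] at hconstraint
  rw [Matrix.trace_fin_three] at htrace
  rw [transverse]
  linear_combination 6 * hconstraint + (S.1 0 0 - S.1 1 1 - S.1 2 2) / 2 * htrace

section

variable {ι : Type*} {l : Filter ι} {c : ℝ}

lemma tendsto_diagonal_of_trace_eq_zero {A : ι → Matrix (Fin 3) (Fin 3) ℝ}
    (hsymm : ∀ᶠ i in l, (A i)ᵀ = A i) (htrace : ∀ᶠ i in l, (A i).trace = 0)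
    (hshear : Tendsto (fun i => A i 0 0) l (𝓝 c))
    (htilt : Tendsto (fun i => A i 0 1 ^ 2 + A i 0 2 ^ 2) l (𝓝 0))
    (htransverse : Tendsto (fun i => (A i 1 1 - A i 2 2) ^ 2 / 2 + 2 * A i 1 2 ^ 2) l (𝓝 0)) :
    Tendsto A l (𝓝 (Matrix.diagonal ![c, -c / 2, -c / 2])) := by
  have h01 : Tendsto (fun i => A i 0 1) l (𝓝 0) :=
    tendsto_zero_of_sq_le (.of_forall fun i => by linarith [sq_nonneg (A i 0 2)]) htilt
  have h02 : Tendsto (fun i => A i 0 2) l (𝓝 0) :=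
    tendsto_zero_of_sq_le (.of_forall fun i => by linarith [sq_nonneg (A i 0 1)]) htilt
  have h12 : Tendsto (fun i => A i 1 2) l (𝓝 0) :=
    tendsto_zero_of_sq_le (.of_forall fun i => by
      linarith [sq_nonneg (A i 1 2), sq_nonneg (A i 1 1 - A i 2 2)]) htransverse
  have hdiff : Tendsto (fun i => A i 1 1 - A i 2 2) l (𝓝 0) :=
    tendsto_zero_of_sq_le (.of_forall fun i => by linarith [sq_nonneg (A i 1 2)])
      ((htransverse.const_mul 2).trans_eq (by rw [mul_zero]))
  have h11 : Tendsto (fun i => A i 1 1) l (𝓝 (-c / 2)) := by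
    refine (((hdiff.sub hshear).div_const 2).congr' ?_).trans_eq (by rw [zero_sub])
    filter_upwards [htrace] with i hi
    rw [Matrix.trace_fin_three] at hi
    linear_combination (-1 / 2) * hi
  have h22 : Tendsto (fun i => A i 2 2) l (𝓝 (-c / 2)) := by
    simpa only [sub_sub_cancel, sub_zero] using h11.sub hdiff
  have hswap : ∀ p q, (fun i => A i p q) =ᶠ[l] fun i => A i q p := fun p q =>
    hsymm.mono fun i hi => congrFun (congrFun hi q) p
  refine tendsto_pi_nhds.2 fun p => tendsto_pi_nhds.2 fun q => ?_
  fin_cases p <;> fin_cases q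
  exacts [hshear, h01, h02, h01.congr' (hswap 0 1), h11, h12, h02.congr' (hswap 0 2),
    h12.congr' (hswap 1 2), h22]

lemma tendsto_state_of_mem_stateSpace {S : ι → State} {d : ℝ} (hS : ∀ᶠ i in l, S i ∈ stateSpace)
    (hshear : Tendsto (fun i => (S i).1 0 0) l (𝓝 c))
    (htilt : Tendsto (fun i => (S i).1 0 1 ^ 2 + (S i).1 0 2 ^ 2) l (𝓝 0))
    (htransverse : Tendsto
      (fun i => ((S i).1 1 1 - (S i).1 2 2) ^ 2 / 2 + 2 * (S i).1 1 2 ^ 2) l (𝓝 0))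
    (homega : Tendsto (fun i => (S i).2.2) l (𝓝 d)) :
    Tendsto S l
      (𝓝 (Matrix.diagonal ![c, -c / 2, -c / 2], ![√(1 - c ^ 2 / 4 - d), 0, 0], d)) := by
  have hV₀ : Tendsto (fun i => (S i).2.1 0) l (𝓝 √(1 - c ^ 2 / 4 - d)) := by
    have hconstraint := ((((hshear.pow 2).div_const 4).add (htilt.div_const 3)).add
      (htransverse.div_const 6)).add homega
    have hsq : Tendsto (fun i => (S i).2.1 0 ^ 2) l (𝓝 (1 - c ^ 2 / 4 - d)) := by
      refine ((hconstraint.const_sub 1).congr' ?_).trans_eq (by congr 1; ring)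
      filter_upwards [hS] with i hi
      rw [(isReadOff_of_mem_stateSpace hi).transverse, transverse]
      ring
    refine hsq.sqrt.congr' ?_
    filter_upwards [hS] with i hi
    exact Real.sqrt_sq hi.2.2.1.le
  refine Tendsto.prodMk_nhds (tendsto_diagonal_of_trace_eq_zero (hS.mono fun i hi => hi.1)
    (hS.mono fun i hi => hi.2.1) hshear htilt htransverse)
    (Tendsto.prodMk_nhds (tendsto_pi_nhds.2 fun p => ?_) homega)
  fin_cases p
  exacts [hV₀, tendsto_const_nhds.congr' (hS.mono fun i hi => hi.2.2.2.1.symm),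
    tendsto_const_nhds.congr' (hS.mono fun i hi => hi.2.2.2.2.1.symm)]

end

lemma wonderlandState_eq (γ : ℝ) : wonderlandState γ =
    (Matrix.diagonal ![(3 * γ - 2) / 2, -((3 * γ - 2) / 2) / 2, -((3 * γ - 2) / 2) / 2],
      ![√(1 - ((3 * γ - 2) / 2) ^ 2 / 4 - (2 - (3 * γ - 2) / 2) / 2), 0, 0],
      (2 - (3 * γ - 2) / 2) / 2) := by
  have hsqrt : √(1 - ((3 * γ - 2) / 2) ^ 2 / 4 - (2 - (3 * γ - 2) / 2) / 2) =
      √(3 * (2 - γ) * (3 * γ - 2)) / 4 := by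
    rw [show 1 - ((3 * γ - 2) / 2) ^ 2 / 4 - (2 - (3 * γ - 2) / 2) / 2 =
      3 * (2 - γ) * (3 * γ - 2) / 4 ^ 2 by ring, Real.sqrt_div' _ (by norm_num),
      Real.sqrt_sq (by norm_num)]
  rw [wonderlandState, hsqrt]
  ring_nf

/-- The limits are the coordinates of `wonderlandState γ`, written in terms of
`σ = (3 * γ - 2) / 2`. -/
lemma tendsto_wonderlandState {ι : Type*} {l : Filter ι} {S : ι → State} {γ : ℝ}
    (hS : ∀ᶠ i in l, S i ∈ stateSpace)
    (hshear : Tendsto (fun i => (S i).1 0 0) l (𝓝 ((3 * γ - 2) / 2)))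
    (htilt : Tendsto (fun i => (S i).1 0 1 ^ 2 + (S i).1 0 2 ^ 2) l (𝓝 0))
    (htransverse : Tendsto
      (fun i => ((S i).1 1 1 - (S i).1 2 2) ^ 2 / 2 + 2 * (S i).1 1 2 ^ 2) l (𝓝 0))
    (homega : Tendsto (fun i => (S i).2.2) l (𝓝 ((2 - (3 * γ - 2) / 2) / 2))) :
    Tendsto S l (𝓝 (wonderlandState γ)) := by
  rw [wonderlandState_eq]
  exact tendsto_state_of_mem_stateSpace hS hshear htilt htransverse homega

/-! ### Level sets of the Lyapunov function -/

section LevelSets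

variable {ι : Type*} {l : Filter ι} {σ : ℝ} {s w V W : ι → ℝ} (hσ : 0 < σ) (hσ2 : σ < 2)
  (hS : ∀ᶠ i in l, 0 < V i ∧ 0 < W i ∧ 0 ≤ w i ∧ 0 ≤ transverse (s i) (w i) (V i) (W i))
  (hL : Tendsto (fun i => lyapunov σ (s i) (V i) (W i)) l (𝓝 (lyapunovMax σ)))
include hσ hσ2 hS hL

lemma tendsto_sq_sub_add_of_tendsto_lyapunov :
    Tendsto (fun i => (s i - σ) ^ 2 + (4 - σ ^ 2) *
      (w i / 3 + transverse (s i) (w i) (V i) (W i) / 6)) l (𝓝 0) := by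
  have hfour : 0 ≤ 4 - σ ^ 2 := by nlinarith
  have hbound := (hL.const_sub (lyapunovMax σ)).const_mul (16 / (2 + σ))
  rw [sub_self, mul_zero] at hbound
  refine squeeze_zero' ?_ ?_ hbound
  · filter_upwards [hS] with i ⟨_, _, hw, hy⟩
    positivity
  · filter_upwards [hS] with i ⟨hV, hW, hw, hy⟩
    exact sq_sub_add_le_lyapunovMax_sub hσ hV hW hw hy hσ2

lemma tendsto_shear_of_tendsto_lyapunov : Tendsto s l (𝓝 σ) := by
  have hfour : 0 ≤ 4 - σ ^ 2 := by nlinarith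
  refine tendsto_sub_nhds_zero_iff.1 (tendsto_zero_of_sq_le ?_
    (tendsto_sq_sub_add_of_tendsto_lyapunov hσ hσ2 hS hL))
  filter_upwards [hS] with i ⟨_, _, hw, hy⟩
  exact le_add_of_nonneg_right (by positivity)

lemma tendsto_tilt_add_transverse_of_tendsto_lyapunov :
    Tendsto (fun i => w i / 3 + transverse (s i) (w i) (V i) (W i) / 6) l (𝓝 0) := by
  have hfour : 4 - σ ^ 2 ≠ 0 := by nlinarith
  have hs := (tendsto_sub_nhds_zero_iff.2
    (tendsto_shear_of_tendsto_lyapunov hσ hσ2 hS hL)).pow 2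
  have hlim := ((tendsto_sq_sub_add_of_tendsto_lyapunov hσ hσ2 hS hL).sub hs).div_const
    (4 - σ ^ 2)
  refine (hlim.congr fun i => ?_).trans_eq (by simp)
  rw [add_sub_cancel_left, mul_div_cancel_left₀ _ hfour]

lemma tendsto_tilt_of_tendsto_lyapunov : Tendsto w l (𝓝 0) := by
  have hbound := (tendsto_tilt_add_transverse_of_tendsto_lyapunov hσ hσ2 hS hL).const_mul 3
  rw [mul_zero] at hbound
  exact squeeze_zero' (hS.mono fun i hi => hi.2.2.1)
    (hS.mono fun i ⟨_, _, _, _⟩ => by linarith) hbound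

lemma tendsto_transverse_of_tendsto_lyapunov :
    Tendsto (fun i => transverse (s i) (w i) (V i) (W i)) l (𝓝 0) := by
  have hbound := (tendsto_tilt_add_transverse_of_tendsto_lyapunov hσ hσ2 hS hL).const_mul 6
  rw [mul_zero] at hbound
  exact squeeze_zero' (hS.mono fun i hi => hi.2.2.2)
    (hS.mono fun i ⟨_, _, _, _⟩ => by linarith) hbound

lemma tendsto_omega_of_tendsto_lyapunov : Tendsto W l (𝓝 ((2 - σ) / 2)) := by
  have hD₀ : 1 - σ * σ / 4 ≠ 0 := by nlinarith
  have : 0 < 2 - σ := by linarith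
  have hgap := hL.const_sub (lyapunovMax σ)
  rw [sub_self] at hgap
  have hratio : Tendsto (fun i => √(W i * (1 - σ * σ / 4) ^ 2 /
      ((2 - σ) / 2 * (1 - σ * s i / 4) ^ 2))) l (𝓝 1) := by
    refine tendsto_sub_nhds_zero_iff.1 (tendsto_zero_of_sq_le ?_ hgap)
    filter_upwards [hS] with i ⟨hV, hW, hw, hy⟩
    exact sq_sqrt_omega_ratio_sub_one_le hσ hV hW hw hy hσ2
  have hdenom : Tendsto (fun i => (2 - σ) / 2 * (1 - σ * s i / 4) ^ 2 / (1 - σ * σ / 4) ^ 2) l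
      (𝓝 ((2 - σ) / 2 * (1 - σ * σ / 4) ^ 2 / (1 - σ * σ / 4) ^ 2)) :=
    (((((tendsto_shear_of_tendsto_lyapunov hσ hσ2 hS hL).const_mul σ).div_const 4).const_sub
      1).pow 2).const_mul ((2 - σ) / 2) |>.div_const _
  refine (((hratio.pow 2).mul hdenom).congr' ?_).trans_eq ?_
  · filter_upwards [hS] with i ⟨hV, hW, hw, hy⟩
    have hD := denom_pos hV hW hw hy hσ hσ2
    rw [Real.sq_sqrt (by positivity), div_mul_div_cancel₀ (by positivity),
      mul_div_cancel_right₀ _ (pow_ne_zero 2 hD₀)]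
  · rw [one_pow, one_mul, mul_div_cancel_right₀ _ (pow_ne_zero 2 hD₀)]

end LevelSets

/-- The Lyapunov function as a function of the state. -/
def stateLyapunov (σ : ℝ) (S : State) : ℝ := lyapunov σ (S.1 0 0) (S.2.1 0 ^ 2) S.2.2

section WonderlandState

variable {γ : ℝ} (hγ : 2 / 3 < γ) (hγ2 : γ < 2)
include hγ hγ2

lemma stateLyapunov_wonderlandState :
    stateLyapunov ((3 * γ - 2) / 2) (wonderlandState γ) = lyapunovMax ((3 * γ - 2) / 2) := by
  have hradicand : 0 ≤ 3 * (2 - γ) * (3 * γ - 2) := mul_nonneg (by linarith) (by linarith)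
  simp only [stateLyapunov, lyapunovMax, wonderlandState, Matrix.diagonal_apply_eq,
    Matrix.cons_val_zero, div_pow, Real.sq_sqrt hradicand]
  ring_nf

lemma continuousAt_stateLyapunov :
    ContinuousAt (stateLyapunov ((3 * γ - 2) / 2)) (wonderlandState γ) := by
  have hradicand : 0 < 3 * (2 - γ) * (3 * γ - 2) := mul_pos (by linarith) (by linarith)
  have hV : (wonderlandState γ).2.1 0 ^ 2 ≠ 0 :=
    pow_ne_zero 2 (div_pos (Real.sqrt_pos.2 hradicand) (by norm_num)).ne'
  have hW : (wonderlandState γ).2.2 ≠ 0 := by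
    simp only [wonderlandState]
    linarith
  have hD : 1 - (3 * γ - 2) / 2 * (wonderlandState γ).1 0 0 / 4 ≠ 0 := by
    simp only [wonderlandState, Matrix.diagonal_apply_eq, Matrix.cons_val_zero]
    nlinarith
  unfold stateLyapunov lyapunov
  fun_prop (disch := assumption)

lemma tendsto_comap_stateLyapunov :
    Tendsto id (comap (stateLyapunov ((3 * γ - 2) / 2))
      (𝓝 (stateLyapunov ((3 * γ - 2) / 2) (wonderlandState γ))) ⊓ 𝓟 stateSpace)
      (𝓝 (wonderlandState γ)) := by
  rw [stateLyapunov_wonderlandState hγ hγ2]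
  have hσ : 0 < (3 * γ - 2) / 2 := by linarith
  have hσ2 : (3 * γ - 2) / 2 < 2 := by linarith
  have hmem : ∀ᶠ S in comap (stateLyapunov ((3 * γ - 2) / 2))
      (𝓝 (lyapunovMax ((3 * γ - 2) / 2))) ⊓ 𝓟 stateSpace, S ∈ stateSpace :=
    mem_inf_of_right (mem_principal_self _)
  have hpos := hmem.mono fun S hS =>
    show 0 < S.2.1 0 ^ 2 ∧ 0 < S.2.2 ∧ 0 ≤ S.1 0 1 ^ 2 + S.1 0 2 ^ 2 ∧
        0 ≤ transverse (S.1 0 0) (S.1 0 1 ^ 2 + S.1 0 2 ^ 2) (S.2.1 0 ^ 2) S.2.2 from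
      ⟨pow_pos hS.2.2.1 2, hS.2.2.2.2.2.1, by positivity,
        (isReadOff_of_mem_stateSpace hS).transverse ▸ by positivity⟩
  have hL : Tendsto (stateLyapunov ((3 * γ - 2) / 2)) (comap (stateLyapunov ((3 * γ - 2) / 2))
      (𝓝 (lyapunovMax ((3 * γ - 2) / 2))) ⊓ 𝓟 stateSpace)
      (𝓝 (lyapunovMax ((3 * γ - 2) / 2))) :=
    tendsto_comap.mono_left inf_le_left
  exact tendsto_wonderlandState hmem (tendsto_shear_of_tendsto_lyapunov hσ hσ2 hpos hL)
    (tendsto_tilt_of_tendsto_lyapunov hσ hσ2 hpos hL)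
    ((tendsto_transverse_of_tendsto_lyapunov hσ hσ2 hpos hL).congr'
      (hmem.mono fun S hS => (isReadOff_of_mem_stateSpace hS).transverse.symm))
    (tendsto_omega_of_tendsto_lyapunov hσ hσ2 hpos hL)

end WonderlandState

/-! ### Attraction and stability -/

lemma IsAlignedFrame.spatialField_ne_zero {M : Model} {t : ℝ} {E : Matrix (Fin 3) (Fin 3) ℝ}
    (hE : IsAlignedFrame M t E) : M.spatialField t ≠ 0 := by
  intro hzero
  have hpos : 0 < (M.spatialField t ᵥ* E) 0 := hE.pos
  rw [hzero, Matrix.zero_vecMul] at hpos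
  exact lt_irrefl 0 hpos

section Evolution

variable {γ : ℝ} {M : Model} {I : Set ℝ} (h : IsEvolution γ M I) {t : ℝ} (ht : t ∈ I)
include h ht

lemma stateLyapunov_state (hI : IsOpen I) (hH : M.hubble t ≠ 0) {E : Matrix (Fin 3) (Fin 3) ℝ}
    (hE : IsAlignedFrame M t E) (σ : ℝ) :
    stateLyapunov σ (M.state t E) = lyapunov σ (M.shear t) (M.vSq t) (M.omega t) := by
  have hread := isReadOff_state h hI ht hH hE
  rw [stateLyapunov, hread.shear, hread.vSq, hread.omega]

lemma spatialField_ne_zero (hJ : M.J t ≠ 0) : M.spatialField t ≠ 0 := fun hzero =>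
  hJ (funext (Fin.cases (h.spatial t ht) (congrFun hzero)))

end Evolution

lemma exists_nhds_forall_stateLyapunov_mem {γ : ℝ} (hγ : 2 / 3 < γ) (hγ2 : γ < 2) {U : Set State}
    (hU : U ∈ 𝓝 (wonderlandState γ)) :
    ∃ N ∈ 𝓝 (stateLyapunov ((3 * γ - 2) / 2) (wonderlandState γ)),
      ∀ S ∈ stateSpace, stateLyapunov ((3 * γ - 2) / 2) S ∈ N → S ∈ U := by
  have hcomap := tendsto_comap_stateLyapunov hγ hγ2 hU
  rw [mem_map, preimage_id, mem_inf_principal] at hcomap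
  obtain ⟨N, hN, hsub⟩ := hcomap
  exact ⟨N, hN, fun S hS hSN => hsub hSN hS⟩

section Attractor

variable {γ : ℝ} (hγ : 2 / 3 < γ) (hγ65 : γ ≤ 6 / 5)
include hγ hγ65

theorem tendsto_state {M : Model} {a : ℝ} (h : IsEvolution γ M (Ioi a)) {t₀ : ℝ}
    (ht₀ : a < t₀) (hH : 0 < M.hubble t₀) (hρ : 0 < M.ρ t₀) (hJ : M.J t₀ ≠ 0)
    {E : ℝ → Matrix (Fin 3) (Fin 3) ℝ} (hE : ∀ t > a, IsAlignedFrame M t (E t)) :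
    Tendsto (fun t => M.state t (E t)) atTop (𝓝 (wonderlandState γ)) := by
  have hσ : 0 < (3 * γ - 2) / 2 := by linarith
  have hσ45 : (3 * γ - 2) / 2 ≤ 4 / 5 := by linarith
  have hflow := isReducedFlow h isOpen_Ioi ordConnected_Ioi ht₀ hH hρ
    (spatialField_ne_zero h ht₀ hJ)
  have hread : ∀ᶠ t in atTop, IsReadOff (M.state t (E t)) (M.shear t) (M.tilt t) (M.coupling t)
      (M.vSq t) (M.omega t) := (eventually_gt_atTop a).mono fun t ht =>
    isReadOff_state h isOpen_Ioi ht (hflow.H_pos t ht).ne' (hE t ht)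
  have hmem : ∀ᶠ t in atTop, M.state t (E t) ∈ stateSpace :=
    (eventually_gt_atTop a).mono fun t ht =>
    state_mem_stateSpace h isOpen_Ioi ht (hE t ht) (hflow.H_pos t ht)
      (ρ_pos h isOpen_Ioi ordConnected_Ioi ht₀ ht hρ)
  exact tendsto_wonderlandState hmem
    ((hflow.tendsto_shear hσ hσ45).congr' (hread.mono fun t ht => ht.shear.symm))
    ((hflow.tendsto_tilt hσ hσ45).congr' (hread.mono fun t ht => ht.tilt.symm))
    ((hflow.tendsto_transverse hσ hσ45).congr' (hread.mono fun t ht => ht.transverse.symm))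
    ((hflow.tendsto_omega hσ hσ45).congr' (hread.mono fun t ht => ht.omega.symm))

theorem wonderlandState_stable {U : Set State} (hU : U ∈ 𝓝 (wonderlandState γ)) :
    ∃ U₀ ∈ 𝓝 (wonderlandState γ), ∀ (a : ℝ) (M : Model), IsSolution γ M (Ioi a) → ∀ t₀ > a,
      0 < M.hubble t₀ → 0 < M.ρ t₀ →
      ∀ E₀, IsAlignedFrame M t₀ E₀ → M.state t₀ E₀ ∈ U₀ →
        ∀ t ≥ t₀, ∀ E, IsAlignedFrame M t E → M.state t E ∈ U := by
  have hγ2 : γ < 2 := by linarith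
  obtain ⟨N, hN, hNU⟩ := exists_nhds_forall_stateLyapunov_mem hγ hγ2 hU
  have hcont := continuousAt_stateLyapunov hγ hγ2
  have hmax := stateLyapunov_wonderlandState hγ hγ2
  set σ := (3 * γ - 2) / 2 with hσdef
  have hσ : 0 < σ := by linarith
  have hσ45 : σ ≤ 4 / 5 := by linarith
  rw [hmax] at hN
  obtain ⟨ε, hε, hball⟩ := Metric.mem_nhds_iff.1 hN
  refine ⟨stateLyapunov σ ⁻¹' Ioi (lyapunovMax σ - ε),
    hcont.preimage_mem_nhds (Ioi_mem_nhds (by linarith)), ?_⟩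
  intro a M hM t₀ ht₀ hH hρ E₀ hE₀ hmem t ht E hE
  have h := (isSolution_iff_isEvolution γ isOpen_Ioi).1 hM
  have hat : a < t := lt_of_lt_of_le ht₀ ht
  have hflow := isReducedFlow h isOpen_Ioi ordConnected_Ioi ht₀ hH hρ hE₀.spatialField_ne_zero
  have hHt := hflow.H_pos t hat
  have hρt := ρ_pos h isOpen_Ioi ordConnected_Ioi ht₀ hat hρ
  refine hNU _ (state_mem_stateSpace h isOpen_Ioi hat hE hHt hρt) (hball ?_)
  have hmono := hflow.lyapunov_mono hσ hσ45 ht₀ ht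
  have hle := lyapunov_le hσ (hflow.V_pos t hat) (hflow.W_pos t hat) (hflow.w_nonneg t hat)
    (hflow.y_nonneg t hat) (by linarith)
  rw [mem_preimage, mem_Ioi, stateLyapunov_state h ht₀ isOpen_Ioi hH.ne' hE₀] at hmem
  rw [Metric.mem_ball, Real.dist_eq, stateLyapunov_state h hat isOpen_Ioi hHt.ne' hE, abs_lt]
  constructor <;> linarith

end Attractor

/-! ### Power-law metrics -/

/-- The Kasner-type spatial metric with scale factors `t ^ p i`. -/
def powerLawMetric (p : Fin 3 → ℝ) (t : ℝ) : Matrix (Fin 3) (Fin 3) ℝ :=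
  Matrix.diagonal fun i => t ^ (2 * p i)

lemma powerLawMetric_posDef (p : Fin 3 → ℝ) {t : ℝ} (ht : 0 < t) : (powerLawMetric p t).PosDef :=
  Matrix.posDef_diagonal_iff.2 fun _ => Real.rpow_pos_of_pos ht _

lemma powerLawMetric_inv (p : Fin 3 → ℝ) {t : ℝ} (ht : 0 < t) :
    (powerLawMetric p t)⁻¹ = Matrix.diagonal fun i => (t ^ (2 * p i))⁻¹ := by
  apply Matrix.inv_eq_right_inv
  rw [powerLawMetric, Matrix.diagonal_mul_diagonal, ← Matrix.diagonal_one]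
  congr 1
  funext i
  exact mul_inv_cancel₀ (Real.rpow_pos_of_pos ht _).ne'

lemma contDiffOn_powerLawMetric (p : Fin 3 → ℝ) (n : WithTop ℕ∞) (i j : Fin 3) :
    ContDiffOn ℝ n (fun t => powerLawMetric p t i j) (Ioi 0) := by
  rcases eq_or_ne i j with rfl | hij
  · simp only [powerLawMetric, Matrix.diagonal_apply_eq]
    exact fun t ht => (Real.contDiffAt_rpow_const_of_ne (ne_of_gt ht)).contDiffWithinAt
  · simp only [powerLawMetric, Matrix.diagonal_apply_ne _ hij]
    exact contDiffOn_const

lemma hasEntryDeriv_powerLawMetric (p : Fin 3 → ℝ) {t : ℝ} (ht : 0 < t) :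
    HasEntryDeriv (powerLawMetric p)
      ((2 : ℝ) • t⁻¹ • (powerLawMetric p t * Matrix.diagonal p)) t := by
  have hscale (i : Fin 3) : HasDerivAt (fun s : ℝ => s ^ (2 * p i))
      (2 * (t⁻¹ * (t ^ (2 * p i) * p i))) t := by
    refine (Real.hasDerivAt_rpow_const (Or.inl ht.ne')).congr_deriv ?_
    rw [Real.rpow_sub_one ht.ne']
    ring
  refine (HasEntryDeriv.diagonal hscale).congr_deriv ?_
  rw [powerLawMetric, Matrix.diagonal_mul_diagonal, ← Matrix.diagonal_smul, ← Matrix.diagonal_smul]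
  rfl

lemma Model.expansion_eq_of_hasEntryDeriv {M : Model} {t : ℝ} {A : Matrix (Fin 3) (Fin 3) ℝ}
    (h : HasEntryDeriv M.g ((2 : ℝ) • A) t) : M.expansion t = A := by
  ext i j
  rw [Model.expansion, Matrix.of_apply, (h i j).deriv, Matrix.smul_apply, smul_eq_mul]
  ring

section PowerLaw

variable {p : Fin 3 → ℝ} {M : Model} (hM : M.g = powerLawMetric p) {t : ℝ} (ht : 0 < t)
include hM ht

lemma expansion_of_powerLaw : M.expansion t = t⁻¹ • (M.g t * Matrix.diagonal p) := by
  apply Model.expansion_eq_of_hasEntryDeriv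
  rw [hM]
  exact hasEntryDeriv_powerLawMetric p ht

lemma mixed_of_powerLaw : M.mixed t = t⁻¹ • Matrix.diagonal p := by
  have hdet : IsUnit (M.g t).det := isUnit_det_of_posDef (hM ▸ powerLawMetric_posDef p ht)
  rw [Model.mixed, expansion_of_powerLaw hM ht, Matrix.mul_smul,
    Matrix.nonsing_inv_mul_cancel_left _ _ hdet]

lemma trace_mixed_of_powerLaw : (M.mixed t).trace = (∑ i, p i) / t := by
  rw [mixed_of_powerLaw hM ht, Matrix.trace_smul, Matrix.trace_diagonal, smul_eq_mul,
    inv_mul_eq_div]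

lemma hubble_of_powerLaw : M.hubble t = (∑ i, p i) / 3 / t := by
  linear_combination (trace_mixed_of_powerLaw hM ht - M.trace_mixed_eq t) / 3

lemma hasEntryDeriv_mixed_of_powerLaw : HasEntryDeriv M.mixed (-t⁻¹ • M.mixed t) t := by
  have hmixed : M.mixed =ᶠ[𝓝 t] fun s => Matrix.diagonal fun i => s⁻¹ * p i := by
    filter_upwards [lt_mem_nhds ht] with s hs
    rw [mixed_of_powerLaw hM hs, ← Matrix.diagonal_smul]
    rfl
  refine ((HasEntryDeriv.diagonal fun i => (hasDerivAt_inv ht.ne').mul_const (p i)).congr_deriv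
    ?_).congr_of_eventuallyEq hmixed
  rw [mixed_of_powerLaw hM ht, smul_smul, ← Matrix.diagonal_smul]
  congr 1
  funext i
  simp only [Pi.smul_apply, smul_eq_mul]
  ring

lemma hasEntryDeriv_expansion_of_powerLaw : HasEntryDeriv M.expansion
    ((2 : ℝ) • (M.expansion t * M.mixed t) - t⁻¹ • M.expansion t) t := by
  have hexpansion {s : ℝ} (hs : 0 < s) : M.expansion s = M.g s * M.mixed s := by
    rw [expansion_of_powerLaw hM hs, mixed_of_powerLaw hM hs, Matrix.mul_smul]
  have hg : HasEntryDeriv M.g ((2 : ℝ) • M.expansion t) t := by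
    rw [expansion_of_powerLaw hM ht, hM]
    exact hasEntryDeriv_powerLawMetric p ht
  refine ((hg.mul (hasEntryDeriv_mixed_of_powerLaw hM ht)).congr_deriv ?_).congr_of_eventuallyEq
    (eventually_of_mem (Ioi_mem_nhds ht) fun s hs => hexpansion hs)
  rw [Matrix.mul_smul, ← hexpansion ht, Matrix.smul_mul, neg_smul, sub_eq_add_neg]

end PowerLaw

section PowerLawSolution

variable {γ : ℝ} {p : Fin 3 → ℝ} {M : Model} (hM : M.g = powerLawMetric p)
  (h : IsEvolution γ M (Ioi 0)) {t : ℝ} (ht : 0 < t)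
include hM h ht

lemma mixed_equation_of_powerLaw : (((∑ i, p i) - 1) / t ^ 2) • Matrix.diagonal p
    = Matrix.vecMulVec ((M.g t)⁻¹ *ᵥ M.spatialField t) (M.spatialField t)
      + ((2 - γ) / 2 * M.ρ t) • (1 : Matrix (Fin 3) (Fin 3) ℝ) := by
  have hderiv : -t⁻¹ • M.mixed t = -(M.mixed t).trace • M.mixed t
      + Matrix.vecMulVec ((M.g t)⁻¹ *ᵥ M.spatialField t) (M.spatialField t)
      + ((2 - γ) / 2 * M.ρ t) • (1 : Matrix (Fin 3) (Fin 3) ℝ) := by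
    ext i j
    exact (hasEntryDeriv_mixed_of_powerLaw hM ht i j).unique
      (h.hasEntryDeriv_mixed isOpen_Ioi ht i j)
  rw [add_assoc, ← sub_eq_iff_eq_add'] at hderiv
  rw [← hderiv, trace_mixed_of_powerLaw hM ht, mixed_of_powerLaw hM ht, smul_smul, smul_smul,
    ← sub_smul]
  congr 1
  field_simp
  ring

lemma spatialField_mul_eq_zero_of_powerLaw {i j : Fin 3} (hij : i ≠ j) :
    M.spatialField t i * M.spatialField t j = 0 := by
  have hentry := congrFun₂ (mixed_equation_of_powerLaw hM h ht) i j
  rw [hM, powerLawMetric_inv p ht] at hentry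
  simp only [Matrix.add_apply, Matrix.smul_apply, Matrix.vecMulVec_apply, Matrix.mulVec_diagonal,
    Matrix.diagonal_apply_ne _ hij, Matrix.one_apply_ne hij, smul_zero, add_zero,
    mul_assoc] at hentry
  exact (mul_eq_zero.1 hentry.symm).resolve_left (inv_pos.2 (Real.rpow_pos_of_pos ht _)).ne'

lemma diagonal_equation_of_powerLaw (i : Fin 3) : ((∑ i, p i) - 1) / t ^ 2 * p i
    = M.spatialField t i ^ 2 / t ^ (2 * p i) + (2 - γ) / 2 * M.ρ t := by
  have hentry := congrFun₂ (mixed_equation_of_powerLaw hM h ht) i i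
  rw [hM, powerLawMetric_inv p ht] at hentry
  simp only [Matrix.add_apply, Matrix.smul_apply, Matrix.vecMulVec_apply, Matrix.mulVec_diagonal,
    Matrix.diagonal_apply_eq, Matrix.one_apply_eq, smul_eq_mul, mul_one] at hentry
  rw [hentry]
  ring

lemma spatialField_eq_zero_of_exponent_eq {i j : Fin 3} (hij : i ≠ j) (hp : p i = p j) :
    M.spatialField t i = 0 := by
  have hpos : 0 < t ^ (2 * p j) := Real.rpow_pos_of_pos ht _
  have hsq : M.spatialField t i ^ 2 = M.spatialField t j ^ 2 := by
    have hi := diagonal_equation_of_powerLaw hM h ht i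
    rw [hp, diagonal_equation_of_powerLaw hM h ht j] at hi
    exact (div_left_inj' hpos.ne').1 (add_right_cancel hi).symm
  rcases mul_eq_zero.1 (spatialField_mul_eq_zero_of_powerLaw hM h ht hij) with hi | hj
  · exact hi
  · rwa [hj, zero_pow two_ne_zero, sq_eq_zero_iff] at hsq

end PowerLawSolution

/-! ### Existence of Wonderland -/

/-- The exponent of the two scale factors of Wonderland orthogonal to the field. -/
def transverseExponent (γ : ℝ) : ℝ := (2 - γ) / (2 * γ)

/-- The exponents of the scale factors of Wonderland. -/
def wonderlandExponents (γ : ℝ) : Fin 3 → ℝ :=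
  ![1, transverseExponent γ, transverseExponent γ]

lemma wonderlandMetric_eq (γ : ℝ) :
    wonderlandMetric γ = powerLawMetric (wonderlandExponents γ) := by
  have hexponent : (2 - γ) / γ = 2 * transverseExponent γ := by
    rw [transverseExponent, ← mul_div_assoc, mul_div_mul_left _ _ two_ne_zero]
  funext t
  rw [wonderlandMetric, powerLawMetric, hexponent]
  congr 1
  funext i
  fin_cases i
  · simp [wonderlandExponents]
  · rfl
  · rfl

lemma wonderlandExponents_of_ne_zero (γ : ℝ) {i : Fin 3} (hi : i ≠ 0) :
    wonderlandExponents γ i = transverseExponent γ := by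
  fin_cases i
  exacts [absurd rfl hi, rfl, rfl]

lemma sum_wonderlandExponents {γ : ℝ} (hγ : γ ≠ 0) : ∑ i, wonderlandExponents γ i = 2 / γ := by
  simp only [Fin.sum_univ_three, wonderlandExponents, transverseExponent, Matrix.cons_val_zero,
    Matrix.cons_val_one, Matrix.cons_val]
  field_simp
  ring

lemma transverseExponent_pos_iff {γ : ℝ} (hγ : 0 < γ) : 0 < transverseExponent γ ↔ γ < 2 := by
  rw [transverseExponent, div_pos_iff_of_pos_right (by positivity), sub_pos]

lemma transverseExponent_lt_one_iff {γ : ℝ} (hγ : 0 < γ) :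
    transverseExponent γ < 1 ↔ 2 / 3 < γ := by
  rw [transverseExponent, div_lt_one (by positivity)]
  constructor <;> intro h <;> linarith

section Necessity

variable {γ : ℝ} {M : Model} (hM : IsWonderland γ M) {t : ℝ}
include hM

lemma IsWonderland.isEvolution : IsEvolution γ M (Ioi 0) :=
  (isSolution_iff_isEvolution γ isOpen_Ioi).1 hM.solution

lemma IsWonderland.g_eq : M.g = powerLawMetric (wonderlandExponents γ) :=
  hM.metric_eq.trans (wonderlandMetric_eq γ)

lemma IsWonderland.spatialField_eq (ht : 0 < t) :
    M.spatialField t = Pi.single 0 (M.spatialField t 0) := by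
  funext i
  fin_cases i
  · simp
  · exact spatialField_eq_zero_of_exponent_eq hM.g_eq hM.isEvolution ht (j := 2) (by decide) rfl
  · exact spatialField_eq_zero_of_exponent_eq hM.g_eq hM.isEvolution ht (j := 1) (by decide) rfl

variable (hγ : 0 < γ) (ht : 0 < t)
include hγ ht

lemma IsWonderland.ρ_equation :
    (2 - γ) / 2 * M.ρ t = 2 * transverseExponent γ ^ 2 / t ^ 2 := by
  have hdiag := diagonal_equation_of_powerLaw hM.g_eq hM.isEvolution ht 1
  have hfield : M.spatialField t 1 = 0 := by
    rw [hM.spatialField_eq ht, Pi.single_eq_of_ne one_ne_zero]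
  rw [hfield, zero_pow two_ne_zero, zero_div, zero_add, sum_wonderlandExponents hγ.ne'] at hdiag
  rw [← hdiag]
  simp only [wonderlandExponents, Matrix.cons_val_one, Matrix.cons_val_zero, transverseExponent]
  field_simp

lemma IsWonderland.spatialField_sq :
    M.spatialField t 0 ^ 2 = 2 * transverseExponent γ * (1 - transverseExponent γ) := by
  have hdiag := diagonal_equation_of_powerLaw hM.g_eq hM.isEvolution ht 0
  rw [hM.ρ_equation hγ ht, sum_wonderlandExponents hγ.ne'] at hdiag
  simp only [wonderlandExponents, Matrix.cons_val_zero, mul_one, Real.rpow_two] at hdiag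
  have hsum : 2 / γ = 1 + 2 * transverseExponent γ := by
    rw [transverseExponent]
    field_simp
    ring
  rw [hsum] at hdiag
  field_simp at hdiag
  linear_combination -hdiag

omit ht in
lemma range_of_isWonderland : 2 / 3 < γ ∧ γ < 2 := by
  have hfield : M.spatialField 1 0 ≠ 0 := by
    intro hzero
    refine spatialField_ne_zero hM.isEvolution (mem_Ioi.2 one_pos) (hM.field_ne 1 one_pos) ?_
    rw [hM.spatialField_eq one_pos, hzero, Pi.single_zero]
  have hsq := sq_pos_of_ne_zero hfield
  rw [hM.spatialField_sq hγ one_pos, mul_assoc] at hsq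
  have hβ : 0 < transverseExponent γ ∧ transverseExponent γ < 1 := by
    constructor <;> nlinarith
  exact ⟨(transverseExponent_lt_one_iff hγ).1 hβ.2, (transverseExponent_pos_iff hγ).1 hβ.1⟩

end Necessity

/-- The power-law metric with exponents `p` and a constant field `a dx`, with a fluid of density
`c / t ^ 2`. -/
def powerLawModel (p : Fin 3 → ℝ) (c a : ℝ) : Model where
  g := powerLawMetric p
  ρ := fun t => c / t ^ 2
  J := fun _ => Pi.single 1 a

lemma powerLawModel_spatialField (p : Fin 3 → ℝ) (c a t : ℝ) :
    (powerLawModel p c a).spatialField t = Pi.single 0 a := by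
  funext i
  fin_cases i <;> rfl

lemma hasDerivAt_div_sq (c : ℝ) {t : ℝ} (ht : t ≠ 0) :
    HasDerivAt (fun s : ℝ => c / s ^ 2) (-(2 * c / t ^ 3)) t := by
  refine ((hasDerivAt_const t c).div (hasDerivAt_pow 2 t) (pow_ne_zero 2 ht)).congr_deriv ?_
  field_simp
  ring

section PowerLawModel

variable {γ c a : ℝ} {p : Fin 3 → ℝ} {t : ℝ} (ht : 0 < t)
include ht

lemma powerLawModel_expansion_eq (hp : p 0 = 1)
    (hlong : (∑ i, p i) - 1 = a ^ 2 + (2 - γ) / 2 * c)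
    (htrans : ∀ i ≠ 0, ((∑ i, p i) - 1) * p i = (2 - γ) / 2 * c) (i j : Fin 3) :
    deriv (fun s => (powerLawModel p c a).expansion s i j) t
      = 2 * ((powerLawModel p c a).expansion t * (powerLawModel p c a).mixed t) i j
        - ((powerLawModel p c a).mixed t).trace * (powerLawModel p c a).expansion t i j
        + (powerLawModel p c a).spatialField t i * (powerLawModel p c a).spatialField t j
        + (2 - γ) / 2 * (powerLawModel p c a).ρ t * (powerLawModel p c a).g t i j := by
  have hg : (powerLawModel p c a).g = powerLawMetric p := rfl
  have hmatter : ((∑ i, p i) - 1) / t ^ 2 * (powerLawMetric p t i j * p j)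
      = (Pi.single 0 a : Fin 3 → ℝ) i * (Pi.single 0 a : Fin 3 → ℝ) j
        + (2 - γ) / 2 * (c / t ^ 2) * powerLawMetric p t i j := by
    rcases eq_or_ne i j with rfl | hij
    · rw [powerLawMetric, Matrix.diagonal_apply_eq]
      rcases eq_or_ne i 0 with rfl | hi
      · rw [hp, mul_one, mul_one, Pi.single_eq_same, Real.rpow_two, hlong]
        field_simp
      · rw [Pi.single_eq_of_ne hi, mul_zero, zero_add]
        linear_combination t ^ (2 * p i) / t ^ 2 * htrans i hi
    · have hfield : (Pi.single 0 a : Fin 3 → ℝ) i * (Pi.single 0 a : Fin 3 → ℝ) j = 0 := by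
        rcases eq_or_ne i 0 with rfl | hi
        · rw [Pi.single_eq_of_ne hij.symm, mul_zero]
        · rw [Pi.single_eq_of_ne hi, zero_mul]
      rw [powerLawMetric, Matrix.diagonal_apply_ne _ hij, hfield]
      ring
  have hexpansion : (powerLawModel p c a).expansion t i j
      = t⁻¹ * (powerLawMetric p t i j * p j) := by
    rw [expansion_of_powerLaw hg ht, Matrix.smul_apply, Matrix.mul_diagonal, hg, smul_eq_mul]
  rw [(hasEntryDeriv_expansion_of_powerLaw hg ht i j).deriv, Matrix.sub_apply, Matrix.smul_apply,
    Matrix.smul_apply, trace_mixed_of_powerLaw hg ht, powerLawModel_spatialField, hexpansion]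
  simp only [powerLawModel, smul_eq_mul]
  linear_combination hmatter

lemma powerLawModel_raychaudhuri (h : ∑ i, p i = (∑ i, p i ^ 2) + (3 * γ - 2) / 2 * c) :
    ∑ i, deriv (fun s => (powerLawModel p c a).mixed s i i) t
      = -((powerLawModel p c a).mixed t * (powerLawModel p c a).mixed t).trace
        - (3 * γ - 2) / 2 * (powerLawModel p c a).ρ t := by
  have hg : (powerLawModel p c a).g = powerLawMetric p := rfl
  have htrace : ∑ i, deriv (fun s => (powerLawModel p c a).mixed s i i) t
      = (-t⁻¹ • (powerLawModel p c a).mixed t).trace :=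
    Finset.sum_congr rfl fun i _ => (hasEntryDeriv_mixed_of_powerLaw hg ht i i).deriv
  rw [htrace, Matrix.trace_smul, trace_mixed_of_powerLaw hg ht, mixed_of_powerLaw hg ht,
    Matrix.smul_mul, Matrix.mul_smul, Matrix.diagonal_mul_diagonal, Matrix.trace_smul,
    Matrix.trace_smul, Matrix.trace_diagonal]
  simp only [powerLawModel, smul_eq_mul, ← sq]
  field_simp
  linear_combination -2 * h

lemma powerLawModel_fluid (h : γ * ∑ i, p i = 2) :
    deriv (powerLawModel p c a).ρ t
      = -γ * ((powerLawModel p c a).mixed t).trace * (powerLawModel p c a).ρ t := by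
  rw [trace_mixed_of_powerLaw (p := p) rfl ht, powerLawModel, (hasDerivAt_div_sq c ht.ne').deriv,
    ← h]
  field_simp

end PowerLawModel

lemma isEvolution_powerLawModel {γ c a : ℝ} {p : Fin 3 → ℝ} (hp : p 0 = 1)
    (hlong : (∑ i, p i) - 1 = a ^ 2 + (2 - γ) / 2 * c)
    (htrans : ∀ i ≠ 0, ((∑ i, p i) - 1) * p i = (2 - γ) / 2 * c)
    (hray : ∑ i, p i = (∑ i, p i ^ 2) + (3 * γ - 2) / 2 * c) (hfluid : γ * ∑ i, p i = 2) :
    IsEvolution γ (powerLawModel p c a) (Ioi 0) where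
  posDef _ ht := powerLawMetric_posDef p ht
  contDiff_g := contDiffOn_powerLawMetric p 2
  contDiff_ρ := contDiffOn_const.div (contDiffOn_id.pow 2) fun _ ht => pow_ne_zero 2 (ne_of_gt ht)
  contDiff_J _ := contDiffOn_const
  spatial _ _ := rfl
  expansion_eq _ ht := powerLawModel_expansion_eq ht hp hlong htrans
  raychaudhuri _ ht := powerLawModel_raychaudhuri ht hray
  fluid _ ht := powerLawModel_fluid ht hfluid
  field _ _ _ := deriv_const _ _

lemma exists_isWonderland {γ : ℝ} (hγ : 2 / 3 < γ) (hγ2 : γ < 2) : ∃ M, IsWonderland γ M := by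
  have hγ0 : 0 < γ := by linarith
  have hβ : 0 < transverseExponent γ := (transverseExponent_pos_iff hγ0).2 hγ2
  have hβ1 : 0 < 1 - transverseExponent γ :=
    sub_pos.2 ((transverseExponent_lt_one_iff hγ0).2 hγ)
  have hc : 0 < (2 - γ) / γ ^ 2 := div_pos (sub_pos.2 hγ2) (by positivity)
  have ha : 0 < 2 * transverseExponent γ * (1 - transverseExponent γ) := by positivity
  have hβ_eq : transverseExponent γ = (2 - γ) / (2 * γ) := rfl
  refine ⟨powerLawModel (wonderlandExponents γ) ((2 - γ) / γ ^ 2)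
    (√(2 * transverseExponent γ * (1 - transverseExponent γ))), (wonderlandMetric_eq γ).symm,
    (isSolution_iff_isEvolution γ isOpen_Ioi).2 (isEvolution_powerLawModel rfl ?_ ?_ ?_ ?_),
    fun t ht => div_pos hc (by positivity), fun t _ hzero => ?_⟩
  · rw [sum_wonderlandExponents hγ0.ne', Real.sq_sqrt ha.le, hβ_eq]
    field_simp
    ring
  · intro i hi
    rw [sum_wonderlandExponents hγ0.ne', wonderlandExponents_of_ne_zero γ hi, hβ_eq]
    field_simp
  · rw [sum_wonderlandExponents hγ0.ne', Fin.sum_univ_three]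
    simp only [wonderlandExponents, Matrix.cons_val_zero, Matrix.cons_val_one, Matrix.cons_val,
      hβ_eq]
    field_simp
    ring
  · rw [sum_wonderlandExponents hγ0.ne']
    field_simp
  · exact (Real.sqrt_pos.2 ha).ne' (by simpa [powerLawModel] using congrFun hzero 1)

theorem exists_isWonderland_iff {γ : ℝ} (hγ : 0 < γ) :
    (∃ M : Model, IsWonderland γ M) ↔ 2 / 3 < γ ∧ γ < 2 :=
  ⟨fun ⟨_, hM⟩ => range_of_isWonderland hM hγ, fun h => exists_isWonderland h.1 h.2⟩

/-! ### The Wonderland state -/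

theorem wonderlandState_mem {γ : ℝ} (hγ : 2 / 3 < γ) (hγ2 : γ < 2) :
    wonderlandState γ ∈ stateSpace := by
  have hγ2' : 0 < 2 - γ := sub_pos.2 hγ2
  have hγ' : 0 < 3 * γ - 2 := by linarith
  have hV : 0 < 3 * (2 - γ) * (3 * γ - 2) := by positivity
  refine ⟨Matrix.diagonal_transpose _, ?_, by simpa [wonderlandState] using hV, rfl, rfl,
    by simpa [wonderlandState] using hγ2', ?_⟩
  · simp only [wonderlandState, Matrix.trace_diagonal, Fin.sum_univ_three, Matrix.cons_val_zero,
      Matrix.cons_val_one, Matrix.cons_val]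
    ring
  · simp only [wonderlandState, Matrix.diagonal_mul_diagonal, Matrix.trace_diagonal,
      Fin.sum_univ_three, Matrix.cons_val_zero, Matrix.cons_val_one, Matrix.cons_val, div_pow,
      Real.sq_sqrt hV.le]
    ring

lemma wonderlandState_prolate {γ : ℝ} (hγ : 2 / 3 < γ) :
    (wonderlandState γ).1 1 1 < (wonderlandState γ).1 0 0 := by
  simp only [wonderlandState, Matrix.diagonal_apply_eq, Matrix.cons_val_zero, Matrix.cons_val_one]
  linarith

lemma continuous_wonderlandState : Continuous wonderlandState := by
  unfold wonderlandState
  refine (Continuous.matrix_diagonal (continuous_pi ?_)).prodMk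
    ((continuous_pi ?_).prodMk (by fun_prop)) <;>
  · simp only [Fin.forall_fin_succ, Matrix.cons_val_zero, Matrix.cons_val_succ, IsEmpty.forall_iff,
      and_true]
    refine ⟨?_, ?_, ?_⟩ <;> fun_prop

lemma wonderlandState_two_thirds : wonderlandState (2 / 3) = flrwState := by
  simp only [wonderlandState, flrwState]
  refine Prod.ext ?_ (Prod.ext ?_ (by norm_num))
  · ext i j
    fin_cases i <;> fin_cases j <;> norm_num
  · funext i
    fin_cases i <;> norm_num

lemma wonderlandState_two : wonderlandState 2 = kasnerState := by
  simp only [wonderlandState, kasnerState]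
  refine Prod.ext ?_ (Prod.ext ?_ (by norm_num))
  · norm_num
  · funext i
    fin_cases i <;> norm_num

theorem tendsto_wonderlandState_flrw :
    Tendsto wonderlandState (𝓝[>] (2 / 3)) (𝓝 flrwState) :=
  wonderlandState_two_thirds ▸ continuous_wonderlandState.continuousAt.continuousWithinAt

theorem tendsto_wonderlandState_kasner :
    Tendsto wonderlandState (𝓝[<] 2) (𝓝 kasnerState) :=
  wonderlandState_two ▸ continuous_wonderlandState.continuousAt.continuousWithinAt

/-! ### Symmetries and kinematics of Wonderland -/

lemma isLRSAboutX_of_diagonal {M : Model} {I : Set ℝ}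
    (hg : ∀ t ∈ I, ∃ a b, M.g t = Matrix.diagonal ![a, b, b])
    (hJ : ∀ t ∈ I, ∃ j, M.J t = Pi.single 1 j) : IsLRSAboutX M I := by
  intro φ x hx
  have htime : (rotX φ *ᵥ x) 0 = x 0 := by
    simp [rotX, Matrix.mulVec, dotProduct, Fin.sum_univ_four]
  constructor
  · obtain ⟨a, b, hab⟩ := hg _ hx
    have hdiagonal {y : Point} (hy : y 0 = x 0) :
        M.metric y = Matrix.diagonal ![-1, a, b, b] := by
      rw [metric_eq_block, hy, hab]
      ext μ ν
      fin_cases μ <;> fin_cases ν <;> rfl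
    have hcircle : Real.cos φ * b * Real.cos φ + Real.sin φ * b * Real.sin φ = b := by
      linear_combination b * Real.sin_sq_add_cos_sq φ
    have hcross : Real.sin φ * b * Real.cos φ = Real.cos φ * b * Real.sin φ := by ring
    rw [hdiagonal htime, hdiagonal rfl]
    ext μ ν
    fin_cases μ <;> fin_cases ν <;>
      simp [rotX, Matrix.mul_apply, Fin.sum_univ_four, Matrix.diagonal, hcircle, hcross,
        add_comm (Real.sin φ * b * Real.sin φ)]
  · obtain ⟨j, hj⟩ := hJ _ hx
    rw [Model.field, Model.field, htime, hj]
    funext μ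
    fin_cases μ <;> simp [rotX, Matrix.vecMul, dotProduct, Fin.sum_univ_four]

/-- The vector field `t ∂_t + ∑ i, c i x^i ∂_i`. -/
def dilation (c : Fin 3 → ℝ) (x : Point) : Fin 4 → ℝ :=
  Fin.cases (x 0) fun i => c i * x i.succ

lemma contDiff_dilation (c : Fin 3 → ℝ) {n : WithTop ℕ∞} : ContDiff ℝ n (dilation c) := by
  refine contDiff_pi.2 (Fin.cases ?_ fun i => ?_)
  · exact contDiff_apply ℝ ℝ (0 : Fin 4)
  · exact contDiff_const.mul (contDiff_apply ℝ ℝ i.succ)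

lemma pd_dilation_zero (c : Fin 3 → ℝ) (μ : Fin 4) (x : Point) :
    pd μ (fun y => dilation c y 0) x = (Pi.single μ 1 : Fin 4 → ℝ) 0 := by
  have hline : (fun s : ℝ => dilation c (x + s • (Pi.single μ 1 : Fin 4 → ℝ)) 0)
      = fun s => x 0 + s * (Pi.single μ 1 : Fin 4 → ℝ) 0 := rfl
  rw [pd, lineDeriv, hline]
  simp

lemma pd_dilation_succ (c : Fin 3 → ℝ) (μ : Fin 4) (i : Fin 3) (x : Point) :
    pd μ (fun y => dilation c y i.succ) x = c i * (Pi.single μ 1 : Fin 4 → ℝ) i.succ := by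
  have hline : (fun s : ℝ => dilation c (x + s • (Pi.single μ 1 : Fin 4 → ℝ)) i.succ)
      = fun s => c i * (x i.succ + s * (Pi.single μ 1 : Fin 4 → ℝ) i.succ) := rfl
  rw [pd, lineDeriv, hline]
  simp

lemma lieDeriv_dilation_metric (c : Fin 3 → ℝ) (M : Model) (x : Point) :
    lieDeriv (dilation c) M.metric x = block (-2) (Matrix.of fun i j =>
      2 * x 0 * M.expansion (x 0) i j + (c i + c j) * M.g (x 0) i j) := by
  have hzero : dilation c x 0 = x 0 := rfl
  apply matrix_ext_zero_succ
  · simp [lieDeriv, sum_fin_four, pd_dilation_zero, pd_dilation_succ, metric_eq_block]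
    norm_num
  · intro j
    simp [lieDeriv, sum_fin_four, pd_dilation_zero, pd_dilation_succ, metric_eq_block]
  · intro j
    simp [lieDeriv, sum_fin_four, pd_dilation_zero, pd_dilation_succ, metric_eq_block]
  · intro i j
    simp only [lieDeriv, Matrix.of_apply, sum_fin_four, pd_zero_metric_succ, pd_succ_metric]
    simp only [pd_dilation_zero, pd_dilation_succ, metric_eq_block, block_zero_succ,
      block_succ_zero, block_succ_succ, Pi.single_apply, Fin.succ_inj, mul_ite, mul_one,
      mul_zero, ite_self, zero_add, add_zero, Finset.sum_add_distrib, Finset.sum_ite_eq',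
      Finset.mem_univ, if_true, Matrix.of_apply, hzero]
    ring

lemma isSelfSimilar_of_powerLaw {M : Model} {p : Fin 3 → ℝ} (hM : M.g = powerLawMetric p) :
    IsSelfSimilar M (Ioi 0) := by
  refine ⟨dilation fun i => 1 - p i, (contDiff_dilation _).contDiffOn, 1, one_ne_zero,
    fun x hx => ⟨ne_of_gt hx, ?_⟩⟩
  have hx0 : x 0 ≠ 0 := ne_of_gt hx
  rw [lieDeriv_dilation_metric, expansion_of_powerLaw hM hx, metric_eq_block, hM, powerLawMetric]
  apply matrix_ext_zero_succ
  · simp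
  · simp
  · simp
  · intro i j
    rcases eq_or_ne i j with rfl | hij
    · simp
      field_simp
      ring
    · simp [Matrix.diagonal_apply_ne _ hij]

lemma deceleration_of_powerLaw {M : Model} {p : Fin 3 → ℝ} (hM : M.g = powerLawMetric p) {t : ℝ}
    (ht : 0 < t) (hp : ∑ i, p i ≠ 0) : M.deceleration t = 3 / (∑ i, p i) - 1 := by
  have hhubble : M.hubble =ᶠ[𝓝 t] fun s => (∑ i, p i) / 3 * s⁻¹ :=
    eventually_of_mem (Ioi_mem_nhds ht) fun s hs => hubble_of_powerLaw hM hs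
  rw [Model.deceleration, hhubble.deriv_eq, ((hasDerivAt_inv ht.ne').const_mul _).deriv,
    hubble_of_powerLaw hM ht]
  field_simp
  ring

namespace IsAlignedFrame

variable {M : Model} {t : ℝ} {E : Matrix (Fin 3) (Fin 3) ℝ} (hE : IsAlignedFrame M t E)
include hE

lemma fieldSq_eq : M.fieldSq t = M.frameField t E 0 ^ 2 := by
  rw [← M.moment_zero, hE.moment_eq, pow_zero, Matrix.one_apply_eq, mul_one]

lemma frameField_eq_sqrt : M.frameField t E = Pi.single 0 √(M.fieldSq t) := by
  rw [hE.fieldSq_eq, Real.sqrt_sq hE.pos.le]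
  exact hE.frameField_eq

lemma frame_expansion_of_eq_smul_add {α κ : ℝ} (hθ : M.expansion t
      = α • M.g t + κ • Matrix.vecMulVec (M.spatialField t) (M.spatialField t)) :
    Eᵀ * M.expansion t * E = Matrix.diagonal ![α + κ * M.fieldSq t, α, α] := by
  have hfield : Eᵀ * Matrix.vecMulVec (M.spatialField t) (M.spatialField t) * E
      = Matrix.vecMulVec (M.frameField t E) (M.frameField t E) := by
    rw [Matrix.mul_vecMulVec, Matrix.vecMulVec_mul, Matrix.mulVec_transpose]
    rfl
  have hnonneg : 0 ≤ M.fieldSq t := hE.fieldSq_eq ▸ sq_nonneg _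
  rw [hθ, Matrix.mul_add, Matrix.add_mul, Matrix.mul_smul, Matrix.smul_mul, hE.orthonormal,
    Matrix.mul_smul, Matrix.smul_mul, hfield, hE.frameField_eq_sqrt]
  ext i j
  fin_cases i <;> fin_cases j <;> simp [Matrix.vecMulVec_apply, Real.mul_self_sqrt hnonneg]

end IsAlignedFrame

section Wonderland

variable {γ : ℝ} {M : Model} (hM : IsWonderland γ M)
include hM

lemma IsWonderland.field_eq {t : ℝ} (ht : 0 < t) : M.J t = Pi.single 1 (M.J t 1) := by
  refine funext (Fin.cases ?_ fun i => ?_)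
  · rw [hM.solution.spatial t ht, Pi.single_eq_of_ne zero_ne_one]
  · change M.spatialField t i = _
    rw [hM.spatialField_eq ht]
    fin_cases i <;> rfl

lemma IsWonderland.isLRSAboutX : IsLRSAboutX M (Ioi 0) :=
  isLRSAboutX_of_diagonal
    (fun t _ => ⟨t ^ 2, t ^ ((2 - γ) / γ), by rw [hM.metric_eq, wonderlandMetric]⟩)
    (fun t ht => ⟨M.J t 1, hM.field_eq ht⟩)

variable (hγ : 0 < γ) {t : ℝ} (ht : 0 < t)
include hγ ht

lemma IsWonderland.hubble_eq : M.hubble t = 2 / (3 * γ) / t := by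
  rw [hubble_of_powerLaw hM.g_eq ht, sum_wonderlandExponents hγ.ne']
  field_simp

lemma IsWonderland.deceleration_eq : M.deceleration t = 3 * γ / 2 - 1 := by
  have hsum := sum_wonderlandExponents hγ.ne'
  rw [deceleration_of_powerLaw hM.g_eq ht (by rw [hsum]; positivity), hsum]
  field_simp

lemma IsWonderland.fieldSq_eq :
    M.fieldSq t = 2 * transverseExponent γ * (1 - transverseExponent γ) / t ^ 2 := by
  rw [Model.fieldSq, hM.g_eq, powerLawMetric_inv _ ht, hM.spatialField_eq ht,
    single_dotProduct, Matrix.mulVec_diagonal, Pi.single_eq_same, ← hM.spatialField_sq hγ ht]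
  simp only [wonderlandExponents, Matrix.cons_val_zero, mul_one, Real.rpow_two]
  ring

lemma IsWonderland.expansion_eq : M.expansion t = (transverseExponent γ / t) • M.g t
    + (t / (2 * transverseExponent γ)) •
      Matrix.vecMulVec (M.spatialField t) (M.spatialField t) := by
  have hβ : transverseExponent γ ≠ 0 :=
    ((transverseExponent_pos_iff hγ).2 (range_of_isWonderland hM hγ).2).ne'
  have hsq := hM.spatialField_sq hγ ht
  rw [sq] at hsq
  rw [expansion_of_powerLaw hM.g_eq ht, hM.g_eq, powerLawMetric, Matrix.diagonal_mul_diagonal,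
    hM.spatialField_eq ht]
  ext i j
  fin_cases i <;> fin_cases j <;>
    simp [wonderlandExponents, Matrix.vecMulVec_apply, hsq, div_eq_mul_inv, mul_comm, mul_assoc,
      mul_left_comm]
  field_simp
  ring

lemma IsWonderland.frame_expansion {E : Matrix (Fin 3) (Fin 3) ℝ} (hE : IsAlignedFrame M t E) :
    Eᵀ * M.expansion t * E = t⁻¹ • Matrix.diagonal (wonderlandExponents γ) := by
  have hβ : transverseExponent γ ≠ 0 :=
    ((transverseExponent_pos_iff hγ).2 (range_of_isWonderland hM hγ).2).ne'
  have hlong : transverseExponent γ / t + t / (2 * transverseExponent γ) * M.fieldSq t = t⁻¹ := by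
    rw [hM.fieldSq_eq hγ ht]
    field_simp
    ring
  rw [hE.frame_expansion_of_eq_smul_add (hM.expansion_eq hγ ht), hlong, ← Matrix.diagonal_smul,
    wonderlandExponents]
  simp [div_eq_inv_mul]

lemma IsWonderland.state_eq {E : Matrix (Fin 3) (Fin 3) ℝ} (hE : IsAlignedFrame M t E) :
    M.state t E = wonderlandState γ := by
  obtain ⟨hγ1, hγ2⟩ := range_of_isWonderland hM hγ
  have hshear : (M.hubble t)⁻¹ • (Eᵀ * M.expansion t * E) - 1 = (wonderlandState γ).1 := by
    rw [hM.frame_expansion hγ ht hE, hM.hubble_eq hγ ht, smul_smul, ← Matrix.diagonal_smul,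
      ← Matrix.diagonal_one, Matrix.diagonal_sub, wonderlandState]
    congr 1
    funext i
    fin_cases i <;> simp [wonderlandExponents, transverseExponent] <;> field_simp <;> ring
  have hfield : (√6 * M.hubble t)⁻¹ * √(M.fieldSq t) = √(3 * (2 - γ) * (3 * γ - 2)) / 4 := by
    have hnonneg : 0 ≤ 3 * (2 - γ) * (3 * γ - 2) :=
      mul_nonneg (mul_nonneg zero_le_three (sub_nonneg.2 hγ2.le)) (by linarith)
    rw [← sq_eq_sq₀ (by rw [hM.hubble_eq hγ ht]; positivity) (by positivity), mul_pow, inv_pow,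
      mul_pow, div_pow, Real.sq_sqrt (by positivity), Real.sq_sqrt hnonneg,
      Real.sq_sqrt (hE.fieldSq_eq ▸ sq_nonneg _), hM.fieldSq_eq hγ ht, hM.hubble_eq hγ ht,
      transverseExponent]
    field_simp
    ring
  have hdensity : M.ρ t / (3 * M.hubble t ^ 2) = 3 * (2 - γ) / 4 := by
    have hρ := hM.ρ_equation hγ ht
    have hne : 2 - γ ≠ 0 := (sub_pos.2 hγ2).ne'
    rw [transverseExponent] at hρ
    rw [hM.hubble_eq hγ ht]
    field_simp at hρ ⊢
    linear_combination 4 * hρ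
  refine Prod.ext hshear (Prod.ext ?_ hdensity)
  rw [Model.state, hE.frameField_eq_sqrt, ← Pi.single_smul, smul_eq_mul, hfield]
  funext i
  fin_cases i <;> rfl

end Wonderland

/-! ### Global solutions of autonomous differential equations -/

section ODE

variable {X : Type*} [NormedAddCommGroup X] [NormedSpace ℝ X]

open scoped Manifold in
lemma exists_hasDerivAt_of_hasCompactSupport [CompleteSpace X] {f : X → X} (hf : ContDiff ℝ 1 f)
    (hsupp : HasCompactSupport f) (t₀ : ℝ) (x₀ : X) :
    ∃ α : ℝ → X, α t₀ = x₀ ∧ ∀ t, HasDerivAt α (f (α t)) t := by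
  obtain ⟨K, hK⟩ := ContDiff.lipschitzWith_of_hasCompactSupport hsupp hf one_ne_zero
  obtain ⟨C, hC⟩ := hsupp.exists_bound_of_continuous hf.continuous
  have hlocal (x : X) : ∃ α : ℝ → X, α 0 = x ∧
      IsMIntegralCurveOn (I := 𝓘(ℝ, X)) α f (Ioo (-1) 1) := by
    have hpicard : IsPicardLindelof (fun _ => f) (tmin := -1) (tmax := 1) ⟨0, by simp⟩ x
        C.toNNReal 0 C.toNNReal K :=
      .of_time_independent (fun y _ => (hC y).trans (Real.le_coe_toNNReal C))
        hK.lipschitzOnWith (by simp)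
    obtain ⟨α, hα0, hα⟩ := hpicard.exists_eq_forall_mem_Icc_hasDerivWithinAt₀
    exact ⟨α, hα0, fun t ht => ((hα t (Ioo_subset_Icc_self ht)).mono
      Ioo_subset_Icc_self).hasFDerivWithinAt.hasMFDerivWithinAt⟩
  obtain ⟨α, hα0, hα⟩ := exists_isMIntegralCurve_of_isMIntegralCurveOn (I := 𝓘(ℝ, X)) (v := f)
    (contMDiff_vectorSpace_iff_contDiff.2 hf) one_pos hlocal x₀
  refine ⟨fun t => α (t - t₀), by simpa using hα0, fun t => ?_⟩
  have hderiv : HasDerivAt α (f (α (t - t₀))) (t - t₀) :=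
    hasDerivAt_iff_hasFDerivAt.2 (hasMFDerivAt_iff_hasFDerivAt.1 (hα (t - t₀)))
  exact hderiv.comp_sub_const t t₀

-- Cutting `f` off outside a ball makes the flow complete and multiplies `f` by a nonnegative factor
-- along each solution, which is why the bound is asked for all solutions slowed down by some `ψ`.
lemma exists_hasDerivAt_Ioi_of_bound [FiniteDimensional ℝ X] {f : X → X} (hf : ContDiff ℝ 1 f)
    {t₀ : ℝ} {x₀ : X} {R : ℝ}
    (hR : ∀ (ψ : ℝ → ℝ) (α : ℝ → X), Continuous ψ → (∀ t, 0 ≤ ψ t) → α t₀ = x₀ →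
      (∀ t, HasDerivAt α (ψ t • f (α t)) t) → ∀ t ≥ t₀, ‖α t‖ ≤ R) :
    ∃ a < t₀, ∃ α : ℝ → X, α t₀ = x₀ ∧ ∀ t > a, HasDerivAt α (f (α t)) t := by
  have : CompleteSpace X := FiniteDimensional.complete ℝ X
  let cutoff : ContDiffBump (0 : X) :=
    ⟨|R| + 1, |R| + 2, by positivity, add_lt_add_right one_lt_two _⟩
  obtain ⟨α, hα0, hα⟩ := exists_hasDerivAt_of_hasCompactSupport (cutoff.contDiff.smul hf)
    cutoff.hasCompactSupport.smul_right t₀ x₀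
  have hcont : Continuous α := continuous_iff_continuousAt.2 fun t => (hα t).continuousAt
  have hbound (t : ℝ) (ht : t₀ ≤ t) : ‖α t‖ < |R| + 1 :=
    (hR (fun t => cutoff (α t)) α (cutoff.continuous.comp hcont) (fun _ => cutoff.nonneg) hα0 hα t
      ht).trans_lt ((le_abs_self R).trans_lt (lt_add_one _))
  have hsolution (t : ℝ) (ht : ‖α t‖ < |R| + 1) : HasDerivAt α (f (α t)) t := by
    have hone : cutoff (α t) = 1 :=
      cutoff.one_of_mem_closedBall (mem_closedBall_zero_iff.2 ht.le)
    simpa [hone] using hα t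
  obtain ⟨a, hat₀, ha⟩ := exists_Ioc_subset_of_mem_nhds
    (hcont.norm.continuousAt.eventually_lt_const (hbound t₀ le_rfl)) (exists_lt t₀)
  refine ⟨a, hat₀, α, hα0, fun t ht => hsolution t ?_⟩
  rcases le_total t₀ t with hle | hle
  exacts [hbound t hle, ha ⟨ht, hle⟩]

lemma contDiffOn_of_hasDerivAt {f : X → X} {I : Set ℝ} (hI : IsOpen I) {α : ℝ → X}
    (hα : ∀ t ∈ I, HasDerivAt α (f (α t)) t) (n : ℕ) (hf : ContDiff ℝ n f) :
    ContDiffOn ℝ n α I := by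
  induction n with
  | zero =>
    exact contDiffOn_zero.2 fun t ht => (hα t ht).continuousAt.continuousWithinAt
  | succ n ih =>
    have hf' : ContDiff ℝ n f := hf.of_le (by exact_mod_cast n.le_succ)
    rw [Nat.cast_succ, contDiffOn_succ_iff_deriv_of_isOpen hI]
    exact ⟨fun t ht => (hα t ht).differentiableAt.differentiableWithinAt, by simp,
      (hf'.comp_contDiffOn (ih hf')).congr fun t ht => (hα t ht).deriv⟩

end ODE

/-! ### The field equations in a propagated orthonormal frame -/

section QuadraticForms

variable {n : Type*} [Fintype n]

lemma sq_apply_le_dotProduct_self (v : n → ℝ) (i : n) : v i ^ 2 ≤ v ⬝ᵥ v := by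
  simp only [dotProduct, ← sq]
  exact Finset.single_le_sum (f := fun k => v k ^ 2) (fun k _ => sq_nonneg (v k))
    (Finset.mem_univ i)

lemma trace_mul_self_eq_vec_dotProduct_vec {A : Matrix n n ℝ} (hA : Aᵀ = A) :
    (A * A).trace = A.vec ⬝ᵥ A.vec := by
  rw [Matrix.vec_dotProduct_vec, hA]

lemma trace_mul_self_nonneg {A : Matrix n n ℝ} (hA : Aᵀ = A) : 0 ≤ (A * A).trace := by
  rw [trace_mul_self_eq_vec_dotProduct_vec hA]
  exact dotProduct_star_self_nonneg A.vec

lemma sq_apply_le_trace_mul_self {A : Matrix n n ℝ} (hA : Aᵀ = A) (k l : n) :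
    A k l ^ 2 ≤ (A * A).trace := by
  rw [trace_mul_self_eq_vec_dotProduct_vec hA]
  exact sq_apply_le_dotProduct_self A.vec (l, k)

lemma dotProduct_mulVec_le {A : Matrix n n ℝ} {μ : ℝ} (hA : ∀ k l, |A k l| ≤ μ) (v : n → ℝ) :
    v ⬝ᵥ A *ᵥ v ≤ Fintype.card n * μ * (v ⬝ᵥ v) := by
  have hentry (k l : n) : v k * (A k l * v l) ≤ μ / 2 * (v k ^ 2 + v l ^ 2) := by
    have hbound := abs_le.1 (hA k l)
    nlinarith [sq_nonneg (v k + v l), sq_nonneg (v k - v l)]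
  calc v ⬝ᵥ A *ᵥ v = ∑ k, ∑ l, v k * (A k l * v l) := by
        simp only [dotProduct, Matrix.mulVec, Finset.mul_sum]
    _ ≤ ∑ k, ∑ l, μ / 2 * (v k ^ 2 + v l ^ 2) :=
        Finset.sum_le_sum fun k _ => Finset.sum_le_sum fun l _ => hentry k l
    _ = Fintype.card n * μ * (v ⬝ᵥ v) := by
        simp only [dotProduct, ← sq, ← Finset.mul_sum, Finset.sum_add_distrib, Finset.sum_const,
          Finset.card_univ, nsmul_eq_mul]
        ring

lemma hasDerivAt_dotProduct_self {v : ℝ → n → ℝ} {v' : n → ℝ} {t : ℝ}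
    (hv : ∀ i, HasDerivAt (fun s => v s i) (v' i) t) :
    HasDerivAt (fun s => v s ⬝ᵥ v s) (2 * (v t ⬝ᵥ v')) t := by
  refine (HasDerivAt.fun_sum fun i _ => (hv i).mul (hv i)).congr_deriv ?_
  rw [dotProduct, Finset.mul_sum]
  exact Finset.sum_congr rfl fun i _ => by ring

lemma antitoneOn_dotProduct_self_of_damped {ψ : ℝ → ℝ} {A : ℝ → Matrix n n ℝ} {v : ℝ → n → ℝ}
    {μ t₀ : ℝ} (hψ : ∀ t, 0 ≤ ψ t)
    (hv : ∀ t i, HasDerivAt (fun s => v s i)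
      (ψ t * ((A t *ᵥ v t) i - Fintype.card n * μ * v t i)) t)
    (hA : ∀ t ≥ t₀, ∀ k l, |A t k l| ≤ μ) : AntitoneOn (fun t => v t ⬝ᵥ v t) (Ici t₀) := by
  have hderiv (t : ℝ) : HasDerivAt (fun t => v t ⬝ᵥ v t)
      (2 * ψ t * (v t ⬝ᵥ A t *ᵥ v t - Fintype.card n * μ * (v t ⬝ᵥ v t))) t := by
    refine (hasDerivAt_dotProduct_self (hv t)).congr_deriv ?_
    simp only [dotProduct, Finset.mul_sum, ← Finset.sum_sub_distrib]
    exact Finset.sum_congr rfl fun i _ => by ring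
  refine antitoneOn_of_deriv_nonpos (convex_Ici t₀)
    (fun t _ => (hderiv t).continuousAt.continuousWithinAt)
    (fun t _ => (hderiv t).differentiableAt.differentiableWithinAt) fun t ht => ?_
  rw [(hderiv t).deriv]
  exact mul_nonpos_of_nonneg_of_nonpos (mul_nonneg zero_le_two (hψ t))
    (sub_nonpos.2 (dotProduct_mulVec_le (hA t (interior_subset ht)) (v t)))

end QuadraticForms

/-- The momentary values of the expansion tensor, the field strength and the density in an
orthonormal frame obey the Hamiltonian constraint and describe an expanding universe containing
fluid. -/
structure IsExpandingData (Θ : Matrix (Fin 3) (Fin 3) ℝ) (j : Fin 3 → ℝ) (ρ : ℝ) : Prop where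
  transpose_eq : Θᵀ = Θ
  constraint : Θ.trace ^ 2 - (Θ * Θ).trace - 2 * ρ - j ⬝ᵥ j = 0
  density_pos : 0 < ρ
  trace_pos : 0 < Θ.trace

namespace IsExpandingData

variable {Θ : Matrix (Fin 3) (Fin 3) ℝ} {j : Fin 3 → ℝ} {ρ : ℝ} (h : IsExpandingData Θ j ρ)
include h

lemma trace_sq_eq : Θ.trace ^ 2 = (Θ * Θ).trace + 2 * ρ + j ⬝ᵥ j := by
  linear_combination h.constraint

lemma abs_expansion_le (k l : Fin 3) : |Θ k l| ≤ Θ.trace := by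
  have hfield : 0 ≤ j ⬝ᵥ j := dotProduct_star_self_nonneg j
  refine abs_le_of_sq_le_sq ?_ h.trace_pos.le
  linarith [h.trace_sq_eq, sq_apply_le_trace_mul_self h.transpose_eq k l, h.density_pos]

lemma abs_field_le (k : Fin 3) : |j k| ≤ Θ.trace := by
  refine abs_le_of_sq_le_sq ?_ h.trace_pos.le
  linarith [h.trace_sq_eq, trace_mul_self_nonneg h.transpose_eq, h.density_pos,
    sq_apply_le_dotProduct_self j k]

lemma density_le : ρ ≤ Θ.trace ^ 2 := by
  have hfield : 0 ≤ j ⬝ᵥ j := dotProduct_star_self_nonneg j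
  linarith [h.trace_sq_eq, trace_mul_self_nonneg h.transpose_eq, h.density_pos]

end IsExpandingData

/-- The evolution equations for the frame components of the expansion tensor, the field strength and
the density, run at speed `ψ`. -/
structure IsFrameFlow (γ : ℝ) (ψ : ℝ → ℝ) (Θ : ℝ → Matrix (Fin 3) (Fin 3) ℝ) (j : ℝ → Fin 3 → ℝ)
    (ρ : ℝ → ℝ) (I : Set ℝ) : Prop where
  continuousOn_speed : ContinuousOn ψ I
  hasEntryDeriv : ∀ t ∈ I, HasEntryDeriv Θ (ψ t • (-(Θ t).trace • Θ t
    + Matrix.vecMulVec (j t) (j t) + ((2 - γ) / 2 * ρ t) • (1 : Matrix (Fin 3) (Fin 3) ℝ))) t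
  hasDerivAt_field : ∀ t ∈ I, ∀ i, HasDerivAt (fun s => j s i) (ψ t * -(j t ᵥ* Θ t) i) t
  hasDerivAt_density : ∀ t ∈ I, HasDerivAt ρ (ψ t * (-γ * (Θ t).trace * ρ t)) t

namespace IsFrameFlow

variable {γ : ℝ} {ψ : ℝ → ℝ} {Θ : ℝ → Matrix (Fin 3) (Fin 3) ℝ} {j : ℝ → Fin 3 → ℝ} {ρ : ℝ → ℝ}
  {I : Set ℝ} (h : IsFrameFlow γ ψ Θ j ρ I)
include h

lemma hasDerivAt_trace {t : ℝ} (ht : t ∈ I) : HasDerivAt (fun s => (Θ s).trace)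
    (ψ t * (-(Θ t).trace ^ 2 + j t ⬝ᵥ j t + 3 / 2 * (2 - γ) * ρ t)) t := by
  refine (h.hasEntryDeriv t ht).trace.congr_deriv ?_
  simp only [Matrix.trace_add, Matrix.trace_smul, Matrix.trace_vecMulVec, Matrix.trace_one,
    Fintype.card_fin, smul_eq_mul]
  push_cast
  ring

lemma continuousOn_trace : ContinuousOn (fun s => (Θ s).trace) I := fun _ ht =>
  (h.hasDerivAt_trace ht).continuousAt.continuousWithinAt

lemma hasDerivAt_trace_mul_self {t : ℝ} (ht : t ∈ I) : HasDerivAt (fun s => (Θ s * Θ s).trace)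
    (2 * ψ t * (-(Θ t).trace * (Θ t * Θ t).trace + j t ⬝ᵥ Θ t *ᵥ j t
      + (2 - γ) / 2 * ρ t * (Θ t).trace)) t := by
  have hderiv := h.hasEntryDeriv t ht
  refine (hderiv.mul hderiv).trace.congr_deriv ?_
  rw [Matrix.trace_add, Matrix.trace_mul_comm (Θ t), Matrix.dotProduct_mulVec,
    dotProduct_comm _ (j t)]
  simp only [Matrix.smul_mul, Matrix.add_mul, Matrix.trace_add, Matrix.trace_smul,
    Matrix.vecMulVec_mul, Matrix.trace_vecMulVec, Matrix.one_mul, smul_eq_mul]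
  ring

lemma hasDerivAt_constraint {t : ℝ} (ht : t ∈ I) :
    HasDerivAt (fun s => (Θ s).trace ^ 2 - (Θ s * Θ s).trace - 2 * ρ s - j s ⬝ᵥ j s)
      (-2 * ψ t * (Θ t).trace *
        ((Θ t).trace ^ 2 - (Θ t * Θ t).trace - 2 * ρ t - j t ⬝ᵥ j t)) t := by
  have hfield : j t ⬝ᵥ (fun i => ψ t * -(j t ᵥ* Θ t) i) = -ψ t * (j t ⬝ᵥ Θ t *ᵥ j t) := by
    rw [Matrix.dotProduct_mulVec, dotProduct_comm _ (j t)]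
    simp only [dotProduct, Finset.mul_sum]
    exact Finset.sum_congr rfl fun i _ => by ring
  refine ((((h.hasDerivAt_trace ht).pow 2).sub (h.hasDerivAt_trace_mul_self ht)).sub
    ((h.hasDerivAt_density t ht).const_mul 2)).sub
    (hasDerivAt_dotProduct_self (h.hasDerivAt_field t ht)) |>.congr_deriv ?_
  rw [hfield]
  push_cast
  ring

variable (hI : IsOpen I) (hconn : I.OrdConnected) {t₀ t : ℝ} (ht₀ : t₀ ∈ I) (ht : t ∈ I)
include hI hconn ht₀ ht

lemma transpose_eq (hΘ : (Θ t₀)ᵀ = Θ t₀) : (Θ t)ᵀ = Θ t := by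
  ext k l
  have hcont : ContinuousOn (fun s => -(ψ s * (Θ s).trace)) I :=
    (h.continuousOn_speed.mul h.continuousOn_trace).neg
  have hderiv : ∀ s ∈ I, HasDerivAt (fun s => Θ s l k - Θ s k l)
      (-(ψ s * (Θ s).trace) * (Θ s l k - Θ s k l)) s := by
    intro s hs
    refine ((h.hasEntryDeriv s hs l k).sub (h.hasEntryDeriv s hs k l)).congr_deriv ?_
    simp only [Matrix.smul_apply, Matrix.add_apply, Matrix.vecMulVec_apply, smul_eq_mul,
      Matrix.one_apply, eq_comm (a := l) (b := k)]
    ring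
  have hantisymm := eq_mul_exp_of_hasDerivAt_mul hI hconn hcont hderiv ht₀ ht
  rw [show Θ t₀ l k = Θ t₀ k l from congrFun₂ hΘ k l, sub_self, zero_mul] at hantisymm
  exact sub_eq_zero.1 hantisymm

lemma constraint_eq_zero
    (hΘ : (Θ t₀).trace ^ 2 - (Θ t₀ * Θ t₀).trace - 2 * ρ t₀ - j t₀ ⬝ᵥ j t₀ = 0) :
    (Θ t).trace ^ 2 - (Θ t * Θ t).trace - 2 * ρ t - j t ⬝ᵥ j t = 0 := by
  have hcont : ContinuousOn (fun s => -2 * ψ s * (Θ s).trace) I :=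
    (continuousOn_const.mul h.continuousOn_speed).mul h.continuousOn_trace
  rw [eq_mul_exp_of_hasDerivAt_mul hI hconn hcont (fun s hs => h.hasDerivAt_constraint hs) ht₀ ht,
    hΘ, zero_mul]

lemma density_pos (hρ : 0 < ρ t₀) : 0 < ρ t := by
  have hcont : ContinuousOn (fun s => ψ s * (-γ * (Θ s).trace)) I :=
    h.continuousOn_speed.mul (continuousOn_const.mul h.continuousOn_trace)
  rw [eq_mul_exp_of_hasDerivAt_mul hI hconn hcont
    (fun s hs => (h.hasDerivAt_density s hs).congr_deriv (by ring)) ht₀ ht]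
  positivity

lemma trace_pos (hdata : IsExpandingData (Θ t₀) (j t₀) (ρ t₀)) : 0 < (Θ t).trace := by
  have hne : ∀ s ∈ I, (Θ s).trace ≠ 0 := by
    intro s hs hzero
    have hconstraint := h.constraint_eq_zero hI hconn ht₀ hs hdata.constraint
    have hshear := trace_mul_self_nonneg (h.transpose_eq hI hconn ht₀ hs hdata.transpose_eq)
    have hρ := h.density_pos hI hconn ht₀ hs hdata.density_pos
    have hfield : 0 ≤ j s ⬝ᵥ j s := dotProduct_star_self_nonneg (j s)
    rw [hzero] at hconstraint
    linarith
  by_contra hneg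
  obtain ⟨s, hs, hzero⟩ := hconn.isPreconnected.intermediate_value ht ht₀ h.continuousOn_trace
    ⟨not_lt.1 hneg, hdata.trace_pos.le⟩
  exact hne s hs hzero

lemma isExpandingData (hdata : IsExpandingData (Θ t₀) (j t₀) (ρ t₀)) :
    IsExpandingData (Θ t) (j t) (ρ t) where
  transpose_eq := h.transpose_eq hI hconn ht₀ ht hdata.transpose_eq
  constraint := h.constraint_eq_zero hI hconn ht₀ ht hdata.constraint
  density_pos := h.density_pos hI hconn ht₀ ht hdata.density_pos
  trace_pos := h.trace_pos hI hconn ht₀ ht hdata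

omit hI hconn ht₀ in
lemma hasDerivAt_trace_of_constraint
    (hΘ : (Θ t).trace ^ 2 - (Θ t * Θ t).trace - 2 * ρ t - j t ⬝ᵥ j t = 0) :
    HasDerivAt (fun s => (Θ s).trace)
      (-(ψ t * ((Θ t * Θ t).trace + (3 * γ - 2) / 2 * ρ t))) t := by
  refine (h.hasDerivAt_trace ht).congr_deriv ?_
  linear_combination -ψ t * hΘ

omit hI ht₀ ht in
lemma antitoneOn_trace (hγ : 2 / 3 ≤ γ) (hψ : ∀ t ∈ I, 0 ≤ ψ t)
    (hdata : ∀ t ∈ I, IsExpandingData (Θ t) (j t) (ρ t)) :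
    AntitoneOn (fun t => (Θ t).trace) I := by
  refine antitoneOn_of_deriv_nonpos hconn.convex h.continuousOn_trace
    (fun s hs => (h.hasDerivAt_trace (interior_subset hs)).differentiableAt
      |>.differentiableWithinAt) fun s hs => ?_
  have hs := interior_subset hs
  rw [(h.hasDerivAt_trace_of_constraint hs (hdata s hs).constraint).deriv]
  have hfluid : 0 ≤ (3 * γ - 2) / 2 * ρ s :=
    mul_nonneg (by linarith) (hdata s hs).density_pos.le
  exact neg_nonpos.2 (mul_nonneg (hψ s hs)
    (add_nonneg (trace_mul_self_nonneg (hdata s hs).transpose_eq) hfluid))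

end IsFrameFlow

/-! ### From the frame equations to a solution -/

lemma HasEntryDeriv.det_of_mul {F : ℝ → Matrix (Fin 3) (Fin 3) ℝ} {A : Matrix (Fin 3) (Fin 3) ℝ}
    {t : ℝ} (hF : HasEntryDeriv F (A * F t) t) :
    HasDerivAt (fun s => (F s).det) (A.trace * (F t).det) t := by
  simp only [Matrix.det_fin_three]
  refine ((((((hF 0 0).mul (hF 1 1)).mul (hF 2 2)).sub (((hF 0 0).mul (hF 1 2)).mul (hF 2 1))).sub
    (((hF 0 1).mul (hF 1 0)).mul (hF 2 2))).add (((hF 0 1).mul (hF 1 2)).mul (hF 2 0))).add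
    (((hF 0 2).mul (hF 1 0)).mul (hF 2 1)) |>.sub (((hF 0 2).mul (hF 1 1)).mul (hF 2 0))
    |>.congr_deriv ?_
  simp only [Matrix.mul_apply, Matrix.trace_fin_three, Fin.sum_univ_three, Pi.mul_apply]
  ring

/-- The model whose metric is `Fᵀ F`, that is, in which the rows of `F` form an orthonormal coframe,
with a constant field strength. -/
def frameModel (F : ℝ → Matrix (Fin 3) (Fin 3) ℝ) (ρ : ℝ → ℝ) (f : Fin 3 → ℝ) : Model where
  g := fun t => (F t)ᵀ * F t
  ρ := ρ
  J := fun _ => Fin.cons 0 f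

section Kinematics

variable {F : ℝ → Matrix (Fin 3) (Fin 3) ℝ} (ρ : ℝ → ℝ) (f : Fin 3 → ℝ) {t : ℝ}

lemma frameModel_posDef (hdet : IsUnit (F t).det) : ((frameModel F ρ f).g t).PosDef := by
  have hg : (frameModel F ρ f).g t = (F t)ᴴ * F t := by
    rw [Matrix.conjTranspose_eq_transpose_of_trivial, frameModel]
  rw [hg]
  exact Matrix.PosDef.conjTranspose_mul_self _
    (Matrix.mulVec_injective_iff_isUnit.2 ((Matrix.isUnit_iff_isUnit_det _).2 hdet))

variable {Θ : Matrix (Fin 3) (Fin 3) ℝ} (hF : HasEntryDeriv F (Θ * F t) t) (hΘ : Θᵀ = Θ)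
include hF hΘ

lemma frameModel_expansion : (frameModel F ρ f).expansion t = (F t)ᵀ * Θ * F t := by
  ext k l
  simp only [Model.expansion, Matrix.of_apply, frameModel]
  rw [((hF.transpose.mul hF) k l).deriv, Matrix.transpose_mul, hΘ, ← Matrix.mul_assoc,
    Matrix.add_apply]
  ring

variable (hdet : IsUnit (F t).det)
include hdet

lemma frameModel_mixed : (frameModel F ρ f).mixed t = (F t)⁻¹ * Θ * F t := by
  have hdet' : IsUnit (F t)ᵀ.det := by rwa [Matrix.det_transpose]
  rw [Model.mixed, frameModel_expansion ρ f hF hΘ]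
  simp only [frameModel, Matrix.mul_inv_rev, Matrix.mul_assoc,
    Matrix.nonsing_inv_mul_cancel_left _ _ hdet']

lemma frameModel_trace_mixed : ((frameModel F ρ f).mixed t).trace = Θ.trace := by
  rw [frameModel_mixed ρ f hF hΘ hdet, Matrix.mul_assoc, Matrix.trace_mul_comm,
    Matrix.mul_nonsing_inv_cancel_right _ _ hdet]

lemma frameModel_trace_mixed_mul_self :
    ((frameModel F ρ f).mixed t * (frameModel F ρ f).mixed t).trace = (Θ * Θ).trace := by
  rw [frameModel_mixed ρ f hF hΘ hdet]
  simp only [Matrix.mul_assoc, Matrix.mul_nonsing_inv_cancel_left _ _ hdet]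
  rw [Matrix.trace_mul_comm]
  simp only [Matrix.mul_assoc, Matrix.mul_nonsing_inv _ hdet, Matrix.mul_one]

end Kinematics

section Dynamics

variable {γ : ℝ} {Θ F : ℝ → Matrix (Fin 3) (Fin 3) ℝ} {j : ℝ → Fin 3 → ℝ} {ρ : ℝ → ℝ} {I : Set ℝ}
  (h : IsFrameFlow γ (fun _ => 1) Θ j ρ I) (hF : ∀ t ∈ I, HasEntryDeriv F (Θ t * F t) t)
  (hI : IsOpen I)
include h hF hI

lemma isUnit_det_frame (hconn : I.OrdConnected) {t₀ t : ℝ} (ht₀ : t₀ ∈ I) (ht : t ∈ I)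
    (hdet : IsUnit (F t₀).det) : IsUnit (F t).det := by
  rw [eq_mul_exp_of_hasDerivAt_mul hI hconn h.continuousOn_trace
    (fun s hs => (hF s hs).det_of_mul) ht₀ ht]
  exact hdet.mul (Real.exp_pos _).ne'.isUnit

lemma vecMul_frame_eq (hconn : I.OrdConnected) {t₀ t : ℝ} (ht₀ : t₀ ∈ I) (ht : t ∈ I) :
    j t ᵥ* F t = j t₀ ᵥ* F t₀ := by
  have hderiv (s : ℝ) (hs : s ∈ I) (k : Fin 3) : HasDerivAt (fun s => (j s ᵥ* F s) k) 0 s := by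
    have hsum := HasDerivAt.fun_sum (u := Finset.univ) fun i _ =>
      (h.hasDerivAt_field s hs i).mul (hF s hs i k)
    refine HasDerivAt.congr_deriv hsum ?_
    have hcancel := congrFun (Matrix.vecMul_vecMul (j s) (Θ s) (F s)) k
    simp only [Matrix.vecMul, dotProduct] at hcancel ⊢
    rw [Finset.sum_add_distrib, ← hcancel]
    simp
  exact funext fun k => hI.is_const_of_deriv_eq_zero hconn.isPreconnected
    (fun s hs => (hderiv s hs k).differentiableAt.differentiableWithinAt)
    (fun s hs => (hderiv s hs k).deriv) ht ht₀

variable (f : Fin 3 → ℝ) (hdet : ∀ t ∈ I, IsUnit (F t).det) (hΘ : ∀ t ∈ I, (Θ t)ᵀ = Θ t) {t : ℝ}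
  (ht : t ∈ I)
include hdet hΘ ht

lemma frameModel_hasEntryDeriv_expansion (hf : j t ᵥ* F t = f) :
    HasEntryDeriv (frameModel F ρ f).expansion
      ((2 : ℝ) • ((frameModel F ρ f).expansion t * (frameModel F ρ f).mixed t)
        - ((frameModel F ρ f).mixed t).trace • (frameModel F ρ f).expansion t
        + Matrix.vecMulVec f f + ((2 - γ) / 2 * ρ t) • (frameModel F ρ f).g t) t := by
  have hexpansion : (frameModel F ρ f).expansion =ᶠ[𝓝 t] fun s => (F s)ᵀ * Θ s * F s := by
    filter_upwards [hI.mem_nhds ht] with s hs using frameModel_expansion ρ f (hF s hs) (hΘ s hs)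
  have hfield : (F t)ᵀ * Matrix.vecMulVec (j t) (j t) * F t = Matrix.vecMulVec f f := by
    rw [Matrix.mul_vecMulVec, Matrix.vecMulVec_mul, Matrix.mulVec_transpose, hf]
  have hquadratic : (F t)ᵀ * Θ t * F t * ((F t)⁻¹ * Θ t * F t) = (F t)ᵀ * Θ t * Θ t * F t := by
    simp only [Matrix.mul_assoc, Matrix.mul_nonsing_inv_cancel_left _ _ (hdet t ht)]
  refine ((((hF t ht).transpose.mul (h.hasEntryDeriv t ht)).mul (hF t ht)).congr_of_eventuallyEq
    hexpansion).congr_deriv ?_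
  rw [frameModel_trace_mixed ρ f (hF t ht) (hΘ t ht) (hdet t ht),
    frameModel_mixed ρ f (hF t ht) (hΘ t ht) (hdet t ht),
    frameModel_expansion ρ f (hF t ht) (hΘ t ht), hquadratic, ← hfield, Matrix.transpose_mul,
    hΘ t ht, frameModel]
  simp only [one_smul, Matrix.mul_add, Matrix.add_mul, Matrix.mul_smul, Matrix.smul_mul,
    Matrix.mul_one, ← Matrix.mul_assoc]
  module

lemma frameModel_differentiableAt_mixed (k l : Fin 3) :
    DifferentiableAt ℝ (fun s => (frameModel F ρ f).mixed s k l) t := by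
  have hinv := (hF t ht).inv (hI.eventually_mem ht |>.mono hdet)
  have hmixed : (frameModel F ρ f).mixed =ᶠ[𝓝 t] fun s => (F s)⁻¹ * Θ s * F s := by
    filter_upwards [hI.mem_nhds ht] with s hs
      using frameModel_mixed ρ f (hF s hs) (hΘ s hs) (hdet s hs)
  exact (((hinv.mul (h.hasEntryDeriv t ht)).mul (hF t ht)).congr_of_eventuallyEq hmixed k l)
    |>.differentiableAt

lemma frameModel_sum_deriv_mixed
    (hc : (Θ t).trace ^ 2 - (Θ t * Θ t).trace - 2 * ρ t - j t ⬝ᵥ j t = 0) :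
    ∑ i, deriv (fun s => (frameModel F ρ f).mixed s i i) t
      = -((frameModel F ρ f).mixed t * (frameModel F ρ f).mixed t).trace
        - (3 * γ - 2) / 2 * ρ t := by
  have htrace : (fun s => ((frameModel F ρ f).mixed s).trace) =ᶠ[𝓝 t] fun s => (Θ s).trace := by
    filter_upwards [hI.mem_nhds ht] with s hs
      using frameModel_trace_mixed ρ f (hF s hs) (hΘ s hs) (hdet s hs)
  calc ∑ i, deriv (fun s => (frameModel F ρ f).mixed s i i) t
      = deriv (fun s => ((frameModel F ρ f).mixed s).trace) t := (deriv_fun_sum fun i _ =>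
        frameModel_differentiableAt_mixed h hF hI f hdet hΘ ht i i).symm
    _ = -((Θ t * Θ t).trace + (3 * γ - 2) / 2 * ρ t) := by
        rw [htrace.deriv_eq, (h.hasDerivAt_trace_of_constraint ht hc).deriv, one_mul]
    _ = _ := by
        rw [frameModel_trace_mixed_mul_self ρ f (hF t ht) (hΘ t ht) (hdet t ht)]
        ring

omit ht in
lemma frameModel_isEvolution
    (hc : ∀ t ∈ I, (Θ t).trace ^ 2 - (Θ t * Θ t).trace - 2 * ρ t - j t ⬝ᵥ j t = 0)
    (hf : ∀ t ∈ I, j t ᵥ* F t = f) (hF₂ : ∀ k l, ContDiffOn ℝ 2 (fun t => F t k l) I)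
    (hρ : ContDiffOn ℝ 1 ρ I) : IsEvolution γ (frameModel F ρ f) I where
  posDef t ht := frameModel_posDef ρ f (hdet t ht)
  contDiff_g k l := by
    simp only [frameModel, Matrix.mul_apply, Matrix.transpose_apply]
    exact ContDiffOn.sum fun i _ => (hF₂ i k).mul (hF₂ i l)
  contDiff_ρ := hρ
  contDiff_J _ := contDiffOn_const
  spatial _ _ := rfl
  expansion_eq t ht k l :=
    (frameModel_hasEntryDeriv_expansion h hF hI f hdet hΘ ht (hf t ht) k l).deriv
  raychaudhuri t ht := frameModel_sum_deriv_mixed h hF hI f hdet hΘ ht (hc t ht)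
  fluid t ht := by
    rw [frameModel_trace_mixed ρ f (hF t ht) (hΘ t ht) (hdet t ht)]
    exact (h.hasDerivAt_density t ht).deriv.trans (one_mul _)
  field _ _ i := deriv_const _ (f i)

end Dynamics

/-! ### Existence of solutions with given initial state -/

/-- Frame components of the expansion tensor and the field strength, the density, and a rescaled
coframe. -/
abbrev FrameData := (Fin 3 → Fin 3 → ℝ) × (Fin 3 → ℝ) × ℝ × (Fin 3 → Fin 3 → ℝ)

/-- The right-hand side of the frame equations. The coframe is rescaled by an exponential of rate
`3 * μ`, which keeps it bounded as long as the expansion is bounded by `μ`. -/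
def frameVectorField (γ μ : ℝ) (x : FrameData) : FrameData :=
  (fun k l => -(∑ m, x.1 m m) * x.1 k l + x.2.1 k * x.2.1 l
      + (2 - γ) / 2 * x.2.2.1 * (1 : Matrix (Fin 3) (Fin 3) ℝ) k l,
    fun k => -∑ m, x.2.1 m * x.1 m k,
    -γ * (∑ m, x.1 m m) * x.2.2.1,
    fun k l => (∑ m, x.1 k m * x.2.2.2 m l) - 3 * μ * x.2.2.2 k l)

lemma contDiff_frameVectorField (γ μ : ℝ) {n : WithTop ℕ∞} :
    ContDiff ℝ n (frameVectorField γ μ) := by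
  unfold frameVectorField
  fun_prop

section Curve

variable {γ μ t c : ℝ} {α : ℝ → FrameData}
  (hα : HasDerivAt α (c • frameVectorField γ μ (α t)) t)
include hα

lemma hasEntryDeriv_frameData_expansion : HasEntryDeriv (fun s => Matrix.of (α s).1)
    (c • (-(Matrix.of (α t).1).trace • Matrix.of (α t).1
      + Matrix.vecMulVec (α t).2.1 (α t).2.1
      + ((2 - γ) / 2 * (α t).2.2.1) • (1 : Matrix (Fin 3) (Fin 3) ℝ))) t := by
  intro k l
  exact hasDerivAt_pi.1 (hasDerivAt_pi.1 hα.fst k) l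

lemma hasDerivAt_frameData_field (k : Fin 3) : HasDerivAt (fun s => (α s).2.1 k)
    (c * -((α t).2.1 ᵥ* Matrix.of (α t).1) k) t :=
  hasDerivAt_pi.1 hα.snd.fst k

lemma hasDerivAt_frameData_density : HasDerivAt (fun s => (α s).2.2.1)
    (c * (-γ * (Matrix.of (α t).1).trace * (α t).2.2.1)) t :=
  hα.snd.snd.fst

lemma hasEntryDeriv_frameData_coframe : HasEntryDeriv (fun s => Matrix.of (α s).2.2.2)
    (c • (Matrix.of (α t).1 * Matrix.of (α t).2.2.2 - (3 * μ) • Matrix.of (α t).2.2.2)) t := by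
  intro k l
  exact hasDerivAt_pi.1 (hasDerivAt_pi.1 hα.snd.snd.snd k) l

end Curve

lemma isFrameFlow_of_hasDerivAt {γ μ : ℝ} {ψ : ℝ → ℝ} {α : ℝ → FrameData} {I : Set ℝ}
    (hψ : ContinuousOn ψ I) (hα : ∀ t ∈ I, HasDerivAt α (ψ t • frameVectorField γ μ (α t)) t) :
    IsFrameFlow γ ψ (fun s => Matrix.of (α s).1) (fun s => (α s).2.1) (fun s => (α s).2.2.1) I where
  continuousOn_speed := hψ
  hasEntryDeriv t ht := hasEntryDeriv_frameData_expansion (hα t ht)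
  hasDerivAt_field t ht := hasDerivAt_frameData_field (hα t ht)
  hasDerivAt_density t ht := hasDerivAt_frameData_density (hα t ht)

lemma abs_frameData_coframe_le {γ μ : ℝ} {ψ : ℝ → ℝ} {α : ℝ → FrameData} (hψ : ∀ t, 0 ≤ ψ t)
    (hα : ∀ t, HasDerivAt α (ψ t • frameVectorField γ μ (α t)) t) {t₀ : ℝ}
    (hΘ : ∀ t ≥ t₀, ∀ k l, |(α t).1 k l| ≤ μ) (hF : Matrix.of (α t₀).2.2.2 = 1) {t : ℝ}
    (ht : t₀ ≤ t) (k l : Fin 3) : |(α t).2.2.2 k l| ≤ 1 := by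
  set v : ℝ → Fin 3 → ℝ := fun s i => (α s).2.2.2 i l
  have hcolumn (s : ℝ) (i : Fin 3) : HasDerivAt (fun s => v s i)
      (ψ s * ((Matrix.of (α s).1 *ᵥ v s) i - Fintype.card (Fin 3) * μ * v s i)) s := by
    rw [Fintype.card_fin, Nat.cast_ofNat]
    exact hasEntryDeriv_frameData_coframe (hα s) i l
  have hinitial : v t₀ = Pi.single l 1 := by
    ext i
    exact (congrFun₂ hF i l).trans (by rw [Matrix.one_apply, Pi.single_apply])
  refine abs_le_of_sq_le_sq ?_ zero_le_one
  calc v t k ^ 2 ≤ v t ⬝ᵥ v t := sq_apply_le_dotProduct_self (v t) k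
    _ ≤ v t₀ ⬝ᵥ v t₀ :=
        antitoneOn_dotProduct_self_of_damped hψ hcolumn hΘ self_mem_Ici ht ht
    _ = 1 ^ 2 := by simp [hinitial]

lemma norm_frameData_le {x : FrameData} {μ : ℝ} (hμ : 0 ≤ μ) (hΘ : ∀ k l, |x.1 k l| ≤ μ)
    (hj : ∀ k, |x.2.1 k| ≤ μ) (hρ : |x.2.2.1| ≤ μ ^ 2) (hF : ∀ k l, |x.2.2.2 k l| ≤ 1) :
    ‖x‖ ≤ μ + μ ^ 2 + 1 := by
  have hR : 0 ≤ μ + μ ^ 2 + 1 := by positivity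
  have hμR : μ ≤ μ + μ ^ 2 + 1 := by nlinarith
  have hone : 1 ≤ μ + μ ^ 2 + 1 := by nlinarith
  refine norm_prod_le_iff.2 ⟨?_, norm_prod_le_iff.2 ⟨?_, norm_prod_le_iff.2 ⟨?_, ?_⟩⟩⟩
  · exact (pi_norm_le_iff_of_nonneg hR).2 fun k => (pi_norm_le_iff_of_nonneg hR).2 fun l =>
      (hΘ k l).trans hμR
  · exact (pi_norm_le_iff_of_nonneg hR).2 fun k => (hj k).trans hμR
  · exact hρ.trans (by linarith)
  · exact (pi_norm_le_iff_of_nonneg hR).2 fun k => (pi_norm_le_iff_of_nonneg hR).2 fun l =>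
      (hF k l).trans hone

lemma norm_frameData_le_of_hasDerivAt {γ μ : ℝ} (hγ : 2 / 3 ≤ γ) {ψ : ℝ → ℝ} {α : ℝ → FrameData}
    (hψ : Continuous ψ) (hψ₀ : ∀ t, 0 ≤ ψ t)
    (hα : ∀ t, HasDerivAt α (ψ t • frameVectorField γ μ (α t)) t) {t₀ : ℝ}
    (hdata : IsExpandingData (Matrix.of (α t₀).1) (α t₀).2.1 (α t₀).2.2.1)
    (hμ : (Matrix.of (α t₀).1).trace = μ) (hF : Matrix.of (α t₀).2.2.2 = 1) {t : ℝ}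
    (ht : t₀ ≤ t) : ‖α t‖ ≤ μ + μ ^ 2 + 1 := by
  have hflow := isFrameFlow_of_hasDerivAt (I := univ) hψ.continuousOn fun t _ => hα t
  have hexpanding (s : ℝ) : IsExpandingData (Matrix.of (α s).1) (α s).2.1 (α s).2.2.1 :=
    hflow.isExpandingData isOpen_univ ordConnected_univ (mem_univ t₀) (mem_univ s) hdata
  have htrace (s : ℝ) (hs : t₀ ≤ s) : (Matrix.of (α s).1).trace ≤ μ :=
    (hflow.antitoneOn_trace ordConnected_univ hγ (fun s _ => hψ₀ s) (fun s _ => hexpanding s)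
      (mem_univ t₀) (mem_univ s) hs).trans_eq hμ
  have hΘ (s : ℝ) (hs : t₀ ≤ s) (k l : Fin 3) : |(α s).1 k l| ≤ μ :=
    ((hexpanding s).abs_expansion_le k l).trans (htrace s hs)
  have hμ₀ : 0 ≤ μ := hμ ▸ hdata.trace_pos.le
  refine norm_frameData_le hμ₀ (hΘ t ht)
    (fun k => ((hexpanding t).abs_field_le k).trans (htrace t ht)) ?_
    (abs_frameData_coframe_le hψ₀ hα hΘ hF ht)
  rw [abs_of_pos (hexpanding t).density_pos]
  exact (hexpanding t).density_le.trans
    (pow_le_pow_left₀ (hexpanding t).trace_pos.le (htrace t ht) 2)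

lemma exists_frameData {γ : ℝ} (hγ : 2 / 3 ≤ γ) {Θ₀ : Matrix (Fin 3) (Fin 3) ℝ} {j₀ : Fin 3 → ℝ}
    {ρ₀ : ℝ} (hdata : IsExpandingData Θ₀ j₀ ρ₀) (t₀ : ℝ) :
    ∃ a < t₀, ∃ α : ℝ → FrameData, α t₀ = (Θ₀, j₀, ρ₀, (1 : Matrix (Fin 3) (Fin 3) ℝ)) ∧
      ∀ t > a, HasDerivAt α (frameVectorField γ Θ₀.trace (α t)) t := by
  refine exists_hasDerivAt_Ioi_of_bound (R := Θ₀.trace + Θ₀.trace ^ 2 + 1)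
    (contDiff_frameVectorField γ Θ₀.trace) fun ψ α hψ hψ₀ hα₀ hα t ht => ?_
  refine norm_frameData_le_of_hasDerivAt hγ hψ hψ₀ hα ?_ ?_ ?_ ht
  · rw [hα₀]
    exact hdata
  · rw [hα₀]
    rfl
  · rw [hα₀]
    rfl

lemma hasEntryDeriv_exp_smul_coframe {γ μ : ℝ} {α : ℝ → FrameData} {t : ℝ}
    (hα : HasDerivAt α (frameVectorField γ μ (α t)) t) (t₀ : ℝ) :
    HasEntryDeriv (fun s => Real.exp (3 * μ * (s - t₀)) • Matrix.of (α s).2.2.2)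
      (Matrix.of (α t).1 * Real.exp (3 * μ * (t - t₀)) • Matrix.of (α t).2.2.2) t := by
  intro k l
  have hexp : HasDerivAt (fun s : ℝ => Real.exp (3 * μ * (s - t₀)))
      (Real.exp (3 * μ * (t - t₀)) * (3 * μ)) t := by
    simpa using (((hasDerivAt_id t).sub_const t₀).const_mul (3 * μ)).exp
  rw [← one_smul ℝ (frameVectorField γ μ (α t))] at hα
  refine (hexp.mul (hasEntryDeriv_frameData_coframe hα k l)).congr_deriv ?_
  simp only [Matrix.mul_smul, Matrix.smul_apply, Matrix.sub_apply, smul_eq_mul]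
  ring

lemma exists_isEvolution {γ : ℝ} (hγ : 2 / 3 ≤ γ) {Θ₀ : Matrix (Fin 3) (Fin 3) ℝ}
    {j₀ : Fin 3 → ℝ} {ρ₀ : ℝ} (hdata : IsExpandingData Θ₀ j₀ ρ₀) (t₀ : ℝ) :
    ∃ a < t₀, ∃ M : Model, IsEvolution γ M (Ioi a) ∧ M.g t₀ = 1 ∧ M.expansion t₀ = Θ₀ ∧
      M.spatialField t₀ = j₀ ∧ M.ρ t₀ = ρ₀ := by
  obtain ⟨a, ha, α, hα₀, hα⟩ := exists_frameData hγ hdata t₀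
  set F : ℝ → Matrix (Fin 3) (Fin 3) ℝ := fun t =>
    Real.exp (3 * Θ₀.trace * (t - t₀)) • Matrix.of (α t).2.2.2
  have hF : ∀ t ∈ Ioi a, HasEntryDeriv F (Matrix.of (α t).1 * F t) t := fun t ht =>
    hasEntryDeriv_exp_smul_coframe (hα t ht) t₀
  have hF₀ : F t₀ = 1 := by
    simp only [F, hα₀, sub_self, mul_zero, Real.exp_zero, one_smul]
    rfl
  have hflow : IsFrameFlow γ (fun _ => 1) (fun t => Matrix.of (α t).1) (fun t => (α t).2.1)
      (fun t => (α t).2.2.1) (Ioi a) :=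
    isFrameFlow_of_hasDerivAt continuousOn_const fun t ht => by
      rw [one_smul]
      exact hα t ht
  have hexpanding (t : ℝ) (ht : t ∈ Ioi a) :
      IsExpandingData (Matrix.of (α t).1) (α t).2.1 (α t).2.2.1 :=
    hflow.isExpandingData isOpen_Ioi ordConnected_Ioi ha ht (by rw [hα₀]; exact hdata)
  have hsmooth : ContDiffOn ℝ 2 α (Ioi a) := by
    exact_mod_cast contDiffOn_of_hasDerivAt isOpen_Ioi hα 2 (contDiff_frameVectorField γ Θ₀.trace)
  have hdet (t : ℝ) (ht : t ∈ Ioi a) : IsUnit (F t).det :=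
    isUnit_det_frame hflow hF isOpen_Ioi ordConnected_Ioi ha ht (by simp [hF₀])
  have hfield (t : ℝ) (ht : t ∈ Ioi a) : (α t).2.1 ᵥ* F t = j₀ := by
    rw [vecMul_frame_eq hflow hF isOpen_Ioi ordConnected_Ioi ha ht, hF₀, Matrix.vecMul_one, hα₀]
  have hF₂ (k l : Fin 3) : ContDiffOn ℝ 2 (fun t => F t k l) (Ioi a) :=
    ContDiffOn.mul (by fun_prop) (contDiffOn_pi.1 (contDiffOn_pi.1 hsmooth.snd.snd.snd k) l)
  refine ⟨a, ha, frameModel F (fun t => (α t).2.2.1) j₀,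
    frameModel_isEvolution hflow hF isOpen_Ioi j₀ hdet (fun t ht => (hexpanding t ht).transpose_eq)
      (fun t ht => (hexpanding t ht).constraint) hfield hF₂
      (hsmooth.snd.snd.fst.of_le one_le_two), ?_, ?_, rfl, ?_⟩
  · simp [frameModel, hF₀]
  · rw [frameModel_expansion _ _ (hF t₀ ha) (hexpanding t₀ ha).transpose_eq, hF₀, hα₀]
    simp only [Matrix.transpose_one, Matrix.one_mul, Matrix.mul_one]
    rfl
  · simp only [frameModel, hα₀]

section InitialState

variable {S : State} {H : ℝ}

lemma trace_smul_one_add {A : Matrix (Fin 3) (Fin 3) ℝ} (hA : A.trace = 0) (c : ℝ) :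
    (c • (1 + A)).trace = 3 * c := by
  rw [Matrix.trace_smul, Matrix.trace_add, Matrix.trace_one, hA, Fintype.card_fin, smul_eq_mul,
    add_zero, Nat.cast_ofNat, mul_comm]

lemma isExpandingData_of_mem_stateSpace (hS : S ∈ stateSpace) (hH : 0 < H) :
    IsExpandingData (H • (1 + S.1)) ((Real.sqrt 6 * H) • S.2.1) (3 * H ^ 2 * S.2.2) := by
  obtain ⟨hsymm, htraceless, -, -, -, hΩ, hhamilton⟩ := hS
  have htrace := trace_smul_one_add htraceless H
  have hshear : (H • (1 + S.1) * H • (1 + S.1)).trace = H ^ 2 * (3 + (S.1 * S.1).trace) := by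
    simp only [Matrix.smul_mul, Matrix.mul_smul, Matrix.trace_smul, Matrix.add_mul,
      Matrix.mul_add, Matrix.trace_add, Matrix.one_mul, Matrix.mul_one, htraceless,
      Matrix.trace_one, smul_eq_mul, Fintype.card_fin]
    push_cast
    ring
  have hfield : ((Real.sqrt 6 * H) • S.2.1) ⬝ᵥ ((Real.sqrt 6 * H) • S.2.1)
      = 6 * H ^ 2 * ∑ a, S.2.1 a ^ 2 := by
    rw [smul_dotProduct, dotProduct_smul, smul_smul, smul_eq_mul, mul_mul_mul_comm,
      Real.mul_self_sqrt (by norm_num)]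
    simp only [dotProduct, ← sq]
  refine ⟨?_, ?_, by positivity, by rw [htrace]; positivity⟩
  · rw [Matrix.transpose_smul, Matrix.transpose_add, Matrix.transpose_one, hsymm]
  · rw [htrace, hshear, hfield]
    linear_combination -6 * H ^ 2 * hhamilton

variable {M : Model} {t : ℝ}

lemma Model.frameField_one (M : Model) (t : ℝ) : M.frameField t 1 = M.spatialField t :=
  Matrix.vecMul_one _

lemma isAlignedFrame_one (hS : S ∈ stateSpace) (hH : 0 < H) (hg : M.g t = 1)
    (hJ : M.spatialField t = (Real.sqrt 6 * H) • S.2.1) : IsAlignedFrame M t 1 := by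
  obtain ⟨-, -, hV₀, hV₁, hV₂, -⟩ := hS
  refine ⟨by simp [hg], ?_, ?_, ?_⟩ <;> rw [M.frameField_one, hJ, Pi.smul_apply, smul_eq_mul]
  · positivity
  · rw [hV₁, mul_zero]
  · rw [hV₂, mul_zero]

lemma state_one_eq (hH : 0 < H) (hhubble : M.hubble t = H) (hθ : M.expansion t = H • (1 + S.1))
    (hJ : M.spatialField t = (Real.sqrt 6 * H) • S.2.1) (hρ : M.ρ t = 3 * H ^ 2 * S.2.2) :
    M.state t 1 = S := by
  have hsqrt : Real.sqrt 6 * H ≠ 0 := by positivity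
  rw [Model.state, M.frameField_one, hJ, hhubble, hθ, hρ]
  refine Prod.ext ?_ (Prod.ext ?_ ?_)
  · simp [smul_smul, hH.ne']
  · simp only [smul_smul, inv_mul_cancel₀ hsqrt, one_smul]
  · simp only [mul_div_cancel_left₀ S.2.2 (show 3 * H ^ 2 ≠ 0 by positivity)]

theorem exists_isSolution {γ : ℝ} (hγ : 2 / 3 ≤ γ) (hS : S ∈ stateSpace) (hH : 0 < H) (t₀ : ℝ) :
    ∃ a < t₀, ∃ (M : Model) (E : _), IsSolution γ M (Ioi a) ∧ IsAlignedFrame M t₀ E ∧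
      M.hubble t₀ = H ∧ M.state t₀ E = S := by
  obtain ⟨a, ha, M, hM, hg, hθ, hJ, hρ⟩ :=
    exists_isEvolution hγ (isExpandingData_of_mem_stateSpace hS hH) t₀
  have hhubble : M.hubble t₀ = H := by
    rw [Model.hubble, hg, hθ, inv_one, Matrix.one_mul, trace_smul_one_add hS.2.1]
    ring
  exact ⟨a, ha, M, 1, (isSolution_iff_isEvolution γ isOpen_Ioi).2 hM,
    isAlignedFrame_one hS hH hg hJ, hhubble, state_one_eq hH hhubble hθ hJ hρ⟩

end InitialState

/-! ### Wonderland as the global attractor -/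

theorem isGlobalAttractor_wonderlandState {γ : ℝ} (hγ : 2 / 3 < γ) (hγ65 : γ ≤ 6 / 5) :
    IsGlobalAttractor γ (wonderlandState γ) where
  evolves S₀ hS₀ H₀ hH₀ t₀ := exists_isSolution hγ.le hS₀ hH₀ t₀
  invariant a M hM t₀ ht₀ hH hρ hJ t ht := by
    have h := (isSolution_iff_isEvolution γ isOpen_Ioi).1 hM
    have hHt := hubble_pos h isOpen_Ioi ordConnected_Ioi ht₀ ht hH hρ
      (spatialField_ne_zero h ht₀ hJ)
    exact ⟨hHt, fun E hE => state_mem_stateSpace h isOpen_Ioi ht hE hHt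
      (ρ_pos h isOpen_Ioi ordConnected_Ioi ht₀ ht hρ)⟩
  attracts a M hM t₀ ht₀ hH hρ hJ E hE :=
    tendsto_state hγ hγ65 ((isSolution_iff_isEvolution γ isOpen_Ioi).1 hM) ht₀ hH hρ hJ hE
  stable U hU := wonderlandState_stable hγ hγ65 hU

end

end BianchiI

open BianchiI in
theorem mainTheorem3 :
    -- range of existence
    (∀ γ : ℝ, 0 < γ → ((∃ M : Model, IsWonderland γ M) ↔ 2 / 3 < γ ∧ γ < 2)) ∧
    -- properties of the solution
    (∀ γ : ℝ, 2 / 3 < γ → γ < 2 →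
      wonderlandState γ ∈ stateSpace ∧
      (wonderlandState γ).1 1 1 < (wonderlandState γ).1 0 0 ∧
      ∀ M : Model, IsWonderland γ M →
        IsLRSAboutX M (Set.Ioi 0) ∧ IsSelfSimilar M (Set.Ioi 0) ∧
        ∀ t > 0, M.J t = Pi.single 1 (M.J t 1) ∧
          0 < M.hubble t ∧ M.deceleration t = 3 * γ / 2 - 1 ∧
          ∀ E, IsAlignedFrame M t E → M.state t E = wonderlandState γ) ∧
    -- limits at the ends of the range
    Filter.Tendsto wonderlandState (nhdsWithin (2 / 3) (Set.Ioi (2 / 3))) (nhds flrwState) ∧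
    Filter.Tendsto wonderlandState (nhdsWithin 2 (Set.Iio 2)) (nhds kasnerState) ∧
    -- global attractor
    (∀ γ : ℝ, 2 / 3 < γ → γ ≤ 6 / 5 → IsGlobalAttractor γ (wonderlandState γ)) := by
  refine ⟨fun γ hγ => exists_isWonderland_iff hγ, fun γ hγ hγ2 => ?_, tendsto_wonderlandState_flrw,
    tendsto_wonderlandState_kasner, fun γ hγ hγ65 => isGlobalAttractor_wonderlandState hγ hγ65⟩
  have hγ0 : 0 < γ := by linarith
  refine ⟨wonderlandState_mem hγ hγ2, wonderlandState_prolate hγ, fun M hM =>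
    ⟨hM.isLRSAboutX, isSelfSimilar_of_powerLaw hM.g_eq, fun t ht =>
      ⟨hM.field_eq ht, ?_, hM.deceleration_eq hγ0 ht, fun E hE => hM.state_eq hγ0 ht hE⟩⟩⟩
  rw [hM.hubble_eq hγ0 ht]
  positivity
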